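/- Let $k$ be a field of characteristic $0$ and let $V=V_0\oplus V_1$ be a $\mathbb Z_2$-graded Lie algebra over $k$ (the case $V_1=0$ is an ordinary Lie algebra), with bracket $l=[\cdot,\cdot]$ and an invariant inner product, i.e. an even, graded symmetric bilinear form $\langle\cdot,\cdot\rangle$ for which $v\mapsto\langle v,\cdot\rangle$ is an isomorphism $V\to V^*$, and with $\langle[x,y],z\rangle=\langle x,[y,z]\rangle$. In signs, a homogeneous object stands for its parity. **Cyclic cohomology.** A homogeneous $\varphi\in C^n(V)=\mathrm{Hom}(\bigwedge^nV,V)$ ($\bigwedge$ is the graded exterior power) is *cyclic* if $\langle\varphi(v_1,\dots,v_n),v_{n+1}\rangle=(-1)^{n+v_1\varphi}\langle v_1,\varphi(v_2,\dots,v_{n+1})\rangle$ for homogeneous $v_i$; put $\tilde\varphi(v_1,\dots,v_{n+1})=\langle\varphi(v_1,\dots,v_n),v_{n+1}\rangle$. Let $CC^n(V)_q$ be the space of cyclic cochains of degree $n\ge1$ and parity $q$, and let $HC^n(V)_q$, $n\ge 1$, be the cohomology of the complex $CC^1(V)_q\to CC^2(V)_q\to\cdots$ (so $HC^1(V)_q$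 is the kernel of $d$ on $CC^1(V)_q$) with the Lie algebra coboundary operator $$d\varphi(v_1,\dots,v_{n+1})=\sum_{\sigma\in Sh(2,n-1)}(-1)^\sigma\epsilon(\sigma)\,\varphi([v_{\sigma(1)},v_{\sigma(2)}],v_{\sigma(3)},\dots)-(-1)^{n-1}\sum_{\sigma\in Sh(n,1)}(-1)^\sigma\epsilon(\sigma)\,[\varphi(v_{\sigma(1)},\dots,v_{\sigma(n)}),v_{\sigma(n+1)}],$$ where $Sh$ denotes unshuffles and $\epsilon$ the Koszul sign. $H^n(V,k)_q$ is the Lie algebra cohomology with trivial coefficients (parity $q$ part). **$L_\infty$ structures.** An $L_\infty$ structure on a $\mathbb Z_2$-graded space $U$ is a sequence of maps $l_n:\bigwedge^nU\to U$ of parity $n$, $n\ge1$, such that the maps $d_n=\eta_1 l_n\eta_n^{-1}:\bigodot^n\Pi U\to\Pi U$ are the components of a coderivation of square zero of the (reduced) symmetric coalgebra $\bigodot\Pi U$ of the parity reversion; here $\eta_n(v_1\wedge\dots\wedge v_n)=(-1)^{(n-1)v_1+\dots+v_{n-1}}\pi v_1\odot\dots\odot\pi v_n$. **Deformations.** Let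 $t$ be a parameter of parity $p$ with $t^2=0$, and $V[t]=V\oplus tV$. An *infinitesimal deformation of $V$ into an $L_\infty$ algebra preserving the inner product*, with parameter $t$, is a graded $k[t]$-linear $L_\infty$ structure $l_t=l+t\lambda$ on $V[t]$ that reduces to $l$ modulo $t$ and all of whose components $l_{t,n}$ are cyclic for the $k[t]$-bilinear extension of $\langle\cdot,\cdot\rangle$; thus $\lambda=(\lambda_n)_{n\ge1}$ with $\lambda_n\in\mathrm{Hom}(\bigwedge^nV,V)$ of parity $p+n$. Two of them are *equivalent* if there is a $k[t]$-linear automorphism $F$ of the graded coalgebra $\bigodot\Pi V[t]$, with $F\equiv\mathrm{id}$ modulo $t$, that takes the one codifferential to the other and preserves the inner product: $F^*\omega=\omega$ for the constant form $\omega(\pi x,\pi y)=(-1)^x\langle x,y\rangle$ on $\Pi V[t]$. Here, if $F$ has components $f_n:\bigodot^n\Pi V[t]\to\Pi V[t]$, $F^*\omega=\omega$ means that for all homogeneous $w_1,\dots,w_N,x,y$ the sum $\sum_{I\sqcup J=\{1,\dots,N\}}\pm\,\omega(f_{|I|+1}(w_I,x),f_{|J|+1}(w_J,y))$, with Koszul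 signs, equals $\omega(x,y)$ if $N=0$ and $0$ if $N\ge1$. **Theorem.** The cyclic cohomology of $V$ classifies the infinitesimal deformations of $V$ into an $L_\infty$ algebra that preserve the inner product. Precisely: 1. For each parity $p$ of $t$, the map $l+t\lambda\mapsto(\lambda_n)_{n\ge1}$ is a bijection from these deformations onto the sequences of cyclic cocycles $\lambda_n$ of degree $n$ and parity $p+n$. Equivalence of deformations is an equivalence relation, and the map induces a bijection from the set of equivalence classes onto $\prod_{n\ge1}HC^n(V)_{p+n}$. 2. For each parity $q$, the map $\varphi\mapsto\tilde\varphi$ induces isomorphisms $HC^n(V)_q\cong H^{n+1}(V,k)_q$ for $n\ge2$, and an isomorphism of $HC^1(V)_q$ with the space of $2$-cocycles of parity $q$ in $\mathrm{Hom}(\bigwedge^2V,k)$. -/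

import Mathlib

noncomputable section

namespace CyclicLInfinity

/-- `Multi k n V M` is the space of `n`-linear maps `V × ⋯ × V → M` over `k`. -/
abbrev Multi (k : Type*) (n : ℕ) (V M : Type*) [Field k] [AddCommGroup V] [Module k V]
    [AddCommGroup M] [Module k M] : Type _ :=
  MultilinearMap k (fun _ : Fin n => V) M

/-! ### Signs, unshuffles -/

/-- The sign `(-1)^a` for a parity `a`. -/
def sgn (a : ZMod 2) : ℤˣ := (-1 : ℤˣ) ^ a

/-- The Koszul sign `ε(σ; v₁, …, vₙ)` for homogeneous `vᵢ` of parity `p i`: in the graded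
symmetric algebra, `v₁ ⊙ ⋯ ⊙ vₙ = ε(σ; v) v_{σ 1} ⊙ ⋯ ⊙ v_{σ n}`. -/
def koszul {n : ℕ} (p : Fin n → ZMod 2) (σ : Equiv.Perm (Fin n)) : ℤˣ :=
  ∏ i, ∏ j, if i < j ∧ σ j < σ i then sgn (p (σ i) * p (σ j)) else 1

/-- The unshuffles of type `(b, n - b)`: permutations that are increasing on the first `b`
positions and on the remaining ones. -/
def unshuffles (n b : ℕ) : Finset (Equiv.Perm (Fin n)) :=
  Finset.univ.filter fun σ =>
    ∀ i j : Fin n, i < j → ((j : ℕ) < b ∨ b ≤ (i : ℕ)) → σ i < σ j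

section Graded

variable {k V M : Type*} [Field k] [AddCommGroup V] [Module k V] [AddCommGroup M] [Module k M]

/-! ### Graded multilinear maps -/

/-- All `v i` are homogeneous, `v i` of parity `p i`. -/
def Homog (𝒱 : ZMod 2 → Submodule k V) {n : ℕ} (p : Fin n → ZMod 2) (v : Fin n → V) : Prop :=
  ∀ i, v i ∈ 𝒱 (p i)

/-- `φ` is homogeneous of parity `q`. -/
def HasParity (𝒱 : ZMod 2 → Submodule k V) (ℳ : ZMod 2 → Submodule k M) (q : ZMod 2) {n : ℕ}
    (φ : Multi k n V M) : Prop :=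
  ∀ p v, Homog 𝒱 p v → φ v ∈ ℳ (q + ∑ i, p i)

/-- `φ` is graded antisymmetric, i.e. factors through the graded exterior power `⋀ⁿ V`. -/
def IsGradedAlt (𝒱 : ZMod 2 → Submodule k V) {n : ℕ} (φ : Multi k n V M) : Prop :=
  ∀ (σ : Equiv.Perm (Fin n)) p v, Homog 𝒱 p v →
    φ v = (Equiv.Perm.sign σ * koszul p σ) • φ (fun i => v (σ i))

/-- `φ` is graded symmetric, i.e. factors through the graded symmetric power `⊙ⁿ V`. -/
def IsGradedSymm (𝒱 : ZMod 2 → Submodule k V) {n : ℕ} (φ : Multi k n V M) : Prop :=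
  ∀ (σ : Equiv.Perm (Fin n)) p v, Homog 𝒱 p v →
    φ v = koszul p σ • φ (fun i => v (σ i))

/-- The grading of the parity reversion `ΠV`, which is `V` as a module. -/
def parityReversion (𝒱 : ZMod 2 → Submodule k V) : ZMod 2 → Submodule k V := fun i => 𝒱 (i + 1)

/-- The grading of `k` itself, which is purely even. -/
def groundGrading (k : Type*) [Field k] : ZMod 2 → Submodule k k := fun i => if i = 0 then ⊤ else ⊥

/-- The projection of `V` onto its component of parity `i`. -/
def parityProj (𝒱 : ZMod 2 → Submodule k V) [DirectSum.Decomposition 𝒱] (i : ZMod 2) :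
    V →ₗ[k] V :=
  (𝒱 i).subtype ∘ₗ DirectSum.component k (ZMod 2) (fun j => 𝒱 j) i ∘ₗ
    (DirectSum.decomposeLinearEquiv 𝒱).toLinearMap

/-- The parity involution `v ↦ (-1)^v v`. -/
def parityInvolution (𝒱 : ZMod 2 → Submodule k V) [DirectSum.Decomposition 𝒱] : Module.End k V :=
  parityProj 𝒱 0 - parityProj 𝒱 1

/-! ### Compositions -/

/-- `(v₁, …, vₙ) ↦ φ (ψ (v₁, …, v_b), v_{b+1}, …, vₙ)`, where `n = b + a`. -/
def insertMap {n a b : ℕ} (h : b + a = n) (φ : Multi k (a + 1) V M) (ψ : Multi k b V V) :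
    Multi k n V M :=
  (MultilinearMap.uncurrySum (N := fun _ : Fin b ⊕ Fin a => V)
    (φ.curryLeft.compMultilinearMap ψ)).domDomCongr (finSumFinEquiv.trans (finCongr h))

theorem insertMap_apply {n a b : ℕ} (h : b + a = n) (φ : Multi k (a + 1) V M)
    (ψ : Multi k b V V) (v : Fin n → V) :
    insertMap h φ ψ v =
      φ (Fin.cons (ψ fun i => v (Fin.cast h (Fin.castAdd a i)))
        (fun j => v (Fin.cast h (Fin.natAdd b j)))) := by
  rfl

/-- The multilinear map that sends homogeneous `v₁, …, vₙ` to
`∑ (-1)^σ ε(σ; v) φ (ψ (v_{σ 1}, …, v_{σ b}), v_{σ (b+1)}, …, v_{σ n})`,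
the sum being over the unshuffles `σ` of type `(b, a)`. -/
def extComp (𝒱 : ZMod 2 → Submodule k V) [DirectSum.Decomposition 𝒱] {n a b : ℕ}
    (h : b + a = n) (φ : Multi k (a + 1) V M) (ψ : Multi k b V V) : Multi k n V M :=
  ∑ p : Fin n → ZMod 2, ∑ σ ∈ unshuffles n b,
    (Equiv.Perm.sign σ * koszul p σ) •
      ((insertMap h φ ψ).domDomCongr σ).compLinearMap (fun i => parityProj 𝒱 (p i))

/-- The cohomology `Z / B` given by cocycles `Z` and coboundaries `B`, written as `Z / (B ∩ Z)`
so that no proof of `B ⊆ Z` (that is, of `d ∘ d = 0`) is needed for the definition. -/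
abbrev Cohomology {X : Type*} [AddCommGroup X] [Module k X] (Z B : Submodule k X) : Type _ :=
  Z ⧸ B.submoduleOf Z

/-! ### Lie superalgebras, invariant inner products, cyclic cohomology -/

/-- `l` is the bracket of a `ℤ/2`-graded Lie algebra. -/
structure IsLieBracket (𝒱 : ZMod 2 → Submodule k V) (l : Multi k 2 V V) : Prop where
  even : HasParity 𝒱 𝒱 0 l
  antisymm : ∀ i j : ZMod 2, ∀ x ∈ 𝒱 i, ∀ y ∈ 𝒱 j, l ![x, y] = -(sgn (i * j) • l ![y, x])
  jacobi : ∀ i j : ZMod 2, ∀ x ∈ 𝒱 i, ∀ y ∈ 𝒱 j, ∀ z : V,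
    l ![x, l ![y, z]] = l ![l ![x, y], z] + sgn (i * j) • l ![y, l ![x, z]]

/-- `B` is an (even, graded symmetric, non-degenerate) inner product. Non-degeneracy means that
`v ↦ ⟨v, ·⟩` is an isomorphism from `V` onto its dual. -/
structure IsInnerProduct (𝒱 : ZMod 2 → Submodule k V) (B : V →ₗ[k] V →ₗ[k] k) : Prop where
  even : ∀ i j : ZMod 2, i ≠ j → ∀ x ∈ 𝒱 i, ∀ y ∈ 𝒱 j, B x y = 0
  symm : ∀ i j : ZMod 2, ∀ x ∈ 𝒱 i, ∀ y ∈ 𝒱 j, B x y = sgn (i * j) • B y x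
  nondegenerate : Function.Bijective B

/-- The inner product is invariant under the bracket. -/
def IsInvariantForm (l : Multi k 2 V V) (B : V →ₗ[k] V →ₗ[k] k) : Prop :=
  ∀ x y z : V, B (l ![x, y]) z = B x (l ![y, z])

/-- An `n`-linear map `φ` of parity `q` is cyclic with respect to the form `B`:
`⟨φ(v₁, …, vₙ), v_{n+1}⟩ = (-1)^{n + v₁ φ} ⟨v₁, φ(v₂, …, v_{n+1})⟩`. -/
def IsCyclic (𝒱 : ZMod 2 → Submodule k V) (B : V →ₗ[k] V →ₗ[k] M) (q : ZMod 2) {n : ℕ}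
    (φ : Multi k n V V) : Prop :=
  ∀ (p : Fin (n + 1) → ZMod 2) v, Homog 𝒱 p v →
    B (φ fun i => v i.castSucc) (v (Fin.last n)) =
      sgn ((n : ZMod 2) + p 0 * q) • B (v 0) (φ fun i => v i.succ)

/-- The space `CCⁿ(V)_q` of cyclic cochains of degree `n` and parity `q`. -/
def cyclicCochains (𝒱 : ZMod 2 → Submodule k V) (B : V →ₗ[k] V →ₗ[k] k) (q : ZMod 2) (n : ℕ) :
    Submodule k (Multi k n V V) where
  carrier := {φ | HasParity 𝒱 𝒱 q φ ∧ IsGradedAlt 𝒱 φ ∧ IsCyclic 𝒱 B q φ}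
  add_mem' := by
    rintro φ ψ ⟨h1, h2, h3⟩ ⟨h1', h2', h3'⟩
    refine ⟨fun p v hv => ?_, fun σ p v hv => ?_, fun p v hv => ?_⟩
    · exact add_mem (h1 p v hv) (h1' p v hv)
    · simp only [add_apply, smul_add]
      rw [h2 σ p v hv, h2' σ p v hv]
    · simp only [add_apply, map_add, smul_add, LinearMap.add_apply]
      rw [h3 p v hv, h3' p v hv]
  zero_mem' := by
    refine ⟨fun p v hv => ?_, fun σ p v hv => ?_, fun p v hv => ?_⟩ <;> simp
  smul_mem' := by
    rintro c φ ⟨h1, h2, h3⟩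
    refine ⟨fun p v hv => ?_, fun σ p v hv => ?_, fun p v hv => ?_⟩
    · exact Submodule.smul_mem _ _ (h1 p v hv)
    · simp only [smul_apply]
      rw [h2 σ p v hv, smul_comm]
    · simp only [smul_apply, map_smul, LinearMap.smul_apply]
      rw [h3 p v hv, smul_comm]

/-- The space `Cⁿ(V, k)_q` of scalar cochains of degree `n` and parity `q`. -/
def scalarCochains (𝒱 : ZMod 2 → Submodule k V) (q : ZMod 2) (n : ℕ) :
    Submodule k (Multi k n V k) where
  carrier := {f | HasParity 𝒱 (groundGrading k) q f ∧ IsGradedAlt 𝒱 f}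
  add_mem' := by
    rintro φ ψ ⟨h1, h2⟩ ⟨h1', h2'⟩
    refine ⟨fun p v hv => ?_, fun σ p v hv => ?_⟩
    · exact add_mem (h1 p v hv) (h1' p v hv)
    · simp only [add_apply, smul_add]
      rw [h2 σ p v hv, h2' σ p v hv]
  zero_mem' := by
    refine ⟨fun p v hv => ?_, fun σ p v hv => ?_⟩ <;> simp
  smul_mem' := by
    rintro c φ ⟨h1, h2⟩
    refine ⟨fun p v hv => ?_, fun σ p v hv => ?_⟩
    · exact Submodule.smul_mem _ _ (h1 p v hv)
    · simp only [smul_apply]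
      rw [h2 σ p v hv, smul_comm]

section Differential

variable (𝒱 : ZMod 2 → Submodule k V) [DirectSum.Decomposition 𝒱]

theorem insertMap_add_left {n a b : ℕ} (h : b + a = n) (φ φ' : Multi k (a + 1) V M)
    (ψ : Multi k b V V) : insertMap h (φ + φ') ψ = insertMap h φ ψ + insertMap h φ' ψ := by
  ext v; simp [insertMap_apply]

theorem insertMap_smul_left {n a b : ℕ} (h : b + a = n) (c : k) (φ : Multi k (a + 1) V M)
    (ψ : Multi k b V V) : insertMap h (c • φ) ψ = c • insertMap h φ ψ := by
  ext v; simp [insertMap_apply]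

theorem insertMap_add_right {n a b : ℕ} (h : b + a = n) (φ : Multi k (a + 1) V M)
    (ψ ψ' : Multi k b V V) : insertMap h φ (ψ + ψ') = insertMap h φ ψ + insertMap h φ ψ' := by
  ext v; simp [insertMap_apply, MultilinearMap.cons_add]

theorem insertMap_smul_right {n a b : ℕ} (h : b + a = n) (c : k) (φ : Multi k (a + 1) V M)
    (ψ : Multi k b V V) : insertMap h φ (c • ψ) = c • insertMap h φ ψ := by
  ext v; simp [insertMap_apply, MultilinearMap.cons_smul]

theorem extComp_apply {n a b : ℕ} (h : b + a = n) (φ : Multi k (a + 1) V M)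
    (ψ : Multi k b V V) (v : Fin n → V) :
    extComp 𝒱 h φ ψ v = ∑ p : Fin n → ZMod 2, ∑ σ ∈ unshuffles n b,
      (Equiv.Perm.sign σ * koszul p σ) •
        insertMap h φ ψ (fun i => parityProj 𝒱 (p (σ i)) (v (σ i))) := by
  simp only [extComp, sum_apply]
  rfl

theorem extComp_add_left {n a b : ℕ} (h : b + a = n) (φ φ' : Multi k (a + 1) V M)
    (ψ : Multi k b V V) : extComp 𝒱 h (φ + φ') ψ = extComp 𝒱 h φ ψ + extComp 𝒱 h φ' ψ := by
  ext v; simp [extComp_apply, insertMap_add_left, Finset.sum_add_distrib]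

theorem extComp_add_right {n a b : ℕ} (h : b + a = n) (φ : Multi k (a + 1) V M)
    (ψ ψ' : Multi k b V V) : extComp 𝒱 h φ (ψ + ψ') = extComp 𝒱 h φ ψ + extComp 𝒱 h φ ψ' := by
  ext v; simp [extComp_apply, insertMap_add_right, Finset.sum_add_distrib]

theorem extComp_smul_left {n a b : ℕ} (h : b + a = n) (c : k) (φ : Multi k (a + 1) V M)
    (ψ : Multi k b V V) : extComp 𝒱 h (c • φ) ψ = c • extComp 𝒱 h φ ψ := by
  ext v
  simp only [extComp_apply, insertMap_smul_left, smul_apply, Finset.smul_sum]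
  exact Finset.sum_congr rfl fun p _ => Finset.sum_congr rfl fun σ _ => smul_comm _ _ _

theorem extComp_smul_right {n a b : ℕ} (h : b + a = n) (c : k) (φ : Multi k (a + 1) V M)
    (ψ : Multi k b V V) : extComp 𝒱 h φ (c • ψ) = c • extComp 𝒱 h φ ψ := by
  ext v
  simp only [extComp_apply, insertMap_smul_right, smul_apply, Finset.smul_sum]
  exact Finset.sum_congr rfl fun p _ => Finset.sum_congr rfl fun σ _ => smul_comm _ _ _

/-- The Lie algebra coboundary `Cⁿ(V, k) → Cⁿ⁺¹(V, k)` with trivial coefficients, `n = a + 1`: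
`(df)(v) = ∑ (-1)^σ ε(σ) f([v_{σ 1}, v_{σ 2}], v_{σ 3}, …, v_{σ (n+1)})`. -/
def scalarDifferential (l : Multi k 2 V V) (a : ℕ) :
    Multi k (a + 1) V k →ₗ[k] Multi k (a + 2) V k where
  toFun f := extComp 𝒱 (Nat.add_comm 2 a) f l
  map_add' f g := extComp_add_left 𝒱 _ f g l
  map_smul' c f := extComp_smul_left 𝒱 _ c f l

/-- The Lie algebra coboundary `Cⁿ(V) → Cⁿ⁺¹(V)` with adjoint coefficients, `n = a + 1`:
`(dφ)(v) = ∑ (-1)^σ ε(σ) φ([v_{σ 1}, v_{σ 2}], v_{σ 3}, …, v_{σ (n+1)})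
  - (-1)^{n-1} ∑ (-1)^σ ε(σ) [φ(v_{σ 1}, …, v_{σ n}), v_{σ (n+1)}]`. -/
def lieDifferential (l : Multi k 2 V V) (a : ℕ) :
    Multi k (a + 1) V V →ₗ[k] Multi k (a + 2) V V where
  toFun φ := extComp 𝒱 (Nat.add_comm 2 a) φ l - sgn a • extComp 𝒱 (a := 1) rfl l φ
  map_add' φ ψ := by
    rw [extComp_add_left, extComp_add_right, smul_add, add_sub_add_comm]
  map_smul' c φ := by
    rw [extComp_smul_left, extComp_smul_right, RingHom.id_apply, smul_sub, smul_comm c]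

/-- The cyclic cocycles of degree `a + 1` and parity `q`. -/
def cyclicCocycles (l : Multi k 2 V V) (B : V →ₗ[k] V →ₗ[k] k) (q : ZMod 2) (a : ℕ) :
    Submodule k (Multi k (a + 1) V V) :=
  cyclicCochains 𝒱 B q (a + 1) ⊓ LinearMap.ker (lieDifferential 𝒱 l a)

/-- The cyclic coboundaries of degree `a + 1` and parity `q`. The complex of cyclic cochains
starts in degree `1`, so there are none in degree `1`. -/
def cyclicCoboundaries (l : Multi k 2 V V) (B : V →ₗ[k] V →ₗ[k] k) (q : ZMod 2) :
    (a : ℕ) → Submodule k (Multi k (a + 1) V V)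
  | 0 => ⊥
  | a + 1 => (cyclicCochains 𝒱 B q (a + 1)).map (lieDifferential 𝒱 l a)

/-- The cyclic cohomology `HCⁿ(V)_q` in degree `n = a + 1` and parity `q`. -/
abbrev CyclicCohomology (l : Multi k 2 V V) (B : V →ₗ[k] V →ₗ[k] k) (q : ZMod 2) (a : ℕ) :
    Type _ :=
  Cohomology (cyclicCocycles 𝒱 l B q a) (cyclicCoboundaries 𝒱 l B q a)

/-- The cocycles of degree `a + 1` and parity `q` with trivial coefficients. -/
def scalarCocycles (l : Multi k 2 V V) (q : ZMod 2) (a : ℕ) :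
    Submodule k (Multi k (a + 1) V k) :=
  scalarCochains 𝒱 q (a + 1) ⊓ LinearMap.ker (scalarDifferential 𝒱 l a)

/-- The coboundaries of degree `a + 1` and parity `q` with trivial coefficients. There are none
in degree `1`, because the coboundary of a cochain of degree `0` vanishes. -/
def scalarCoboundaries (l : Multi k 2 V V) (q : ZMod 2) :
    (a : ℕ) → Submodule k (Multi k (a + 1) V k)
  | 0 => ⊥
  | a + 1 => (scalarCochains 𝒱 q (a + 1)).map (scalarDifferential 𝒱 l a)

/-- The Lie algebra cohomology `Hⁿ(V, k)_q` in degree `n = a + 1` and parity `q`. -/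
abbrev ScalarCohomology (l : Multi k 2 V V) (q : ZMod 2) (a : ℕ) : Type _ :=
  Cohomology (scalarCocycles 𝒱 l q a) (scalarCoboundaries 𝒱 l q a)

end Differential

/-- The form `φ~(v₁, …, v_{n+1}) = ⟨φ(v₁, …, vₙ), v_{n+1}⟩`. -/
def tilde (B : V →ₗ[k] V →ₗ[k] k) {n : ℕ} (φ : Multi k n V V) : Multi k (n + 1) V k :=
  (B.compMultilinearMap φ).uncurryRight

/-! ### L∞ structures

The exterior coalgebra of `V` is identified with the symmetric coalgebra of `ΠV` through
`η(v₁ ∧ ⋯ ∧ vₙ) = (-1)^{(n-1) v₁ + ⋯ + v_{n-1}} πv₁ ⊙ ⋯ ⊙ πvₙ`. Coderivations and coalgebra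
endomorphisms of the symmetric coalgebra are given by their components `⊙ⁿ ΠV → ΠV`, `n ≥ 1`;
families are indexed by all `n`, with vanishing component for `n = 0`. -/

/-- The map `η₁ ∘ φ ∘ ηₙ⁻¹` on `ΠV` that corresponds to the map `φ` on `V`. -/
def suspend (𝒱 : ZMod 2 → Submodule k V) [DirectSum.Decomposition 𝒱] {n : ℕ}
    (φ : Multi k n V V) : Multi k n V V :=
  φ.compLinearMap fun i => parityInvolution 𝒱 ^ (n - 1 - (i : ℕ))

/-- The value at `w₁ ⊙ ⋯ ⊙ w_N` of the corestriction to `W` of the composite of a map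
`f : ⊙W → W` with the coderivation of `⊙W` that has components `d n : ⊙ⁿ W → W`. The `w i` are
homogeneous of parity `p i`. -/
def symComp (f d : ∀ n, Multi k n V V) {N : ℕ} (p : Fin N → ZMod 2) (w : Fin N → V) : V :=
  ∑ b : Fin (N + 1), ∑ σ ∈ unshuffles N b,
    koszul p σ • insertMap (a := N - b) (b := b) (by omega) (f (N - b + 1)) (d b)
      (fun i => w (σ i))

/-- The maps `l n : ⋀ⁿ V → V` define an `L∞` structure on `V`: `l n` has parity `n`, and the
corresponding maps on `W = ΠV` are the components of an odd coderivation of `⊙W` whose square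
is zero. -/
structure IsLInfinity (𝒱 : ZMod 2 → Submodule k V) [DirectSum.Decomposition 𝒱]
    (l : ∀ n, Multi k n V V) : Prop where
  zero : l 0 = 0
  parity : ∀ n : ℕ, HasParity 𝒱 𝒱 n (l n)
  alt : ∀ n, IsGradedAlt 𝒱 (l n)
  sq_zero : ∀ N (p : Fin N → ZMod 2) w, Homog (parityReversion 𝒱) p w →
    symComp (fun n => suspend 𝒱 (l n)) (fun n => suspend 𝒱 (l n)) p w = 0

/-- The family `l₂ = l`, `lₙ = 0` for `n ≠ 2` given by a bracket. -/
def ofBracket (l : Multi k 2 V V) : ∀ n, Multi k n V V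
  | 2 => l
  | _ => 0

/-- The Koszul sign of `w₁ ⊙ ⋯ ⊙ w_N ↦ w_{c₁} ⊙ ⋯ ⊙ w_{c_r}`, where `c₁, …, c_r` are the blocks
of the partition `c` of `{1, …, N}` and `w_{c_m}` is the product of the `wᵢ` with `i ∈ c_m`,
in increasing order of `i`. -/
def partitionSign {N : ℕ} (p : Fin N → ZMod 2) (c : OrderedFinpartition N) : ℤˣ :=
  ∏ i, ∏ j, if i < j ∧ c.index j < c.index i then sgn (p i * p j) else 1

/-- The value at `w₁ ⊙ ⋯ ⊙ w_N` of the corestriction to `W` of the composite of a map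
`d : ⊙W → W` with the coalgebra endomorphism of `⊙W` that has (even) components
`f n : ⊙ⁿ W → W`. -/
def morComp (d f : ∀ n, Multi k n V V) {N : ℕ} (p : Fin N → ZMod 2) (w : Fin N → V) : V :=
  ∑ c : OrderedFinpartition N, partitionSign p c •
    d c.length (fun m => f (c.partSize m) (fun j => w (c.emb m j)))

/-- The maps `f n` are the components of a coalgebra endomorphism `F` of `⊙(ΠV)` (even and
degree preserving) with `F ∘ d = d' ∘ F`, where `d`, `d'` are the coderivations that correspond
to `l`, `l'`. -/
structure IsLInfinityMorphism (𝒱 : ZMod 2 → Submodule k V) [DirectSum.Decomposition 𝒱]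
    (l l' f : ∀ n, Multi k n V V) : Prop where
  zero : f 0 = 0
  parity : ∀ n, HasParity (parityReversion 𝒱) (parityReversion 𝒱) 0 (f n)
  symm : ∀ n, IsGradedSymm (parityReversion 𝒱) (f n)
  intertwines : ∀ N (p : Fin N → ZMod 2) w, Homog (parityReversion 𝒱) p w →
    symComp f (fun n => suspend 𝒱 (l n)) p w = morComp (fun n => suspend 𝒱 (l' n)) f p w

/-- The Koszul sign of `w₁ ⊙ ⋯ ⊙ w_N ⊙ x ↦ w_I ⊙ x ⊙ w_J`, where `J` is the complement of `I`
and `x` has parity `a`. -/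
def subsetSign {N : ℕ} (p : Fin N → ZMod 2) (a : ZMod 2) (I : Finset (Fin N)) : ℤˣ :=
  (∏ i, ∏ j, if i < j ∧ i ∉ I ∧ j ∈ I then sgn (p i * p j) else 1) * sgn (a * ∑ j ∈ Iᶜ, p j)

/-- `f (w_I, x)`, the elements `wᵢ`, `i ∈ I`, being listed in increasing order of `i`. -/
def evalSubset (f : ∀ n, Multi k n V V) {N : ℕ} (w : Fin N → V) (I : Finset (Fin N)) (x : V) : V :=
  f (I.card + 1) (Fin.snoc (α := fun _ => V) (fun j => w (I.orderEmbOfFin rfl j)) x)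

/-- The coalgebra endomorphism of `⊙(ΠV)` with components `f n` preserves the inner product `B`.
The inner product gives a constant graded antisymmetric form `ω(πx, πy) = (-1)^x ⟨x, y⟩` on `ΠV`,
and the condition is `F^* ω = ω`, i.e.
`∑_{I ⊔ J = {1, …, N}} ± ω(f(w_I, x), f(w_J, y))` equals `ω(x, y)` if `N = 0`, and `0` if
`N ≥ 1`. If only `f₁ ≠ 0`, this says `⟨f₁ x, f₁ y⟩ = ⟨x, y⟩`. -/
def PreservesInnerProduct (𝒱 : ZMod 2 → Submodule k V) [DirectSum.Decomposition 𝒱]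
    (B : V →ₗ[k] V →ₗ[k] M) (f : ∀ n, Multi k n V V) : Prop :=
  ∀ N (p : Fin N → ZMod 2) w (a b : ZMod 2) (x y : V), Homog (parityReversion 𝒱) p w →
    x ∈ parityReversion 𝒱 a → y ∈ parityReversion 𝒱 b →
    ∑ I : Finset (Fin N), subsetSign p a I •
        B (parityInvolution 𝒱 (evalSubset f w I x)) (evalSubset f w Iᶜ y) =
      if N = 0 then B (parityInvolution 𝒱 x) y else 0

/-! ### Infinitesimal deformations

Let `t` be a parameter of parity `p`, with `t² = 0`. The module `V[t] = V ⊕ tV` is modelled on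
`V × V`, the pair `(x, y)` standing for `x + t y`. -/

/-- The grading of `V[t]`. -/
def extGrading (𝒱 : ZMod 2 → Submodule k V) (p : ZMod 2) : ZMod 2 → Submodule k (V × V) :=
  fun i => (𝒱 i).prod (𝒱 (i - p))

theorem parityProj_of_mem (𝒱 : ZMod 2 → Submodule k V) [DirectSum.Decomposition 𝒱] {i : ZMod 2}
    {x : V} (hx : x ∈ 𝒱 i) : parityProj 𝒱 i x = x :=
  DirectSum.decompose_of_mem_same 𝒱 hx

theorem parityProj_of_mem_ne (𝒱 : ZMod 2 → Submodule k V) [DirectSum.Decomposition 𝒱]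
    {i j : ZMod 2} {x : V} (hx : x ∈ 𝒱 i) (h : i ≠ j) : parityProj 𝒱 j x = 0 :=
  DirectSum.decompose_of_mem_ne 𝒱 hx h

theorem sum_parityProj (𝒱 : ZMod 2 → Submodule k V) [DirectSum.Decomposition 𝒱] (x : V) :
    ∑ i, parityProj 𝒱 i x = x := by
  classical
  induction x using DirectSum.Decomposition.inductionOn 𝒱 with
  | zero => simp
  | @homogeneous i m =>
    rw [Finset.sum_eq_single i]
    · exact parityProj_of_mem 𝒱 m.2
    · intro j _ hj
      exact parityProj_of_mem_ne 𝒱 m.2 (Ne.symm hj)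
    · intro h; exact absurd (Finset.mem_univ i) h
  | add m m' h h' => simp only [map_add, Finset.sum_add_distrib, h, h']

theorem sum_parityProj_sub (𝒱 : ZMod 2 → Submodule k V) [DirectSum.Decomposition 𝒱] (p : ZMod 2)
    (x : V) : ∑ i, parityProj 𝒱 (i - p) x = x := by
  exact (Equiv.sum_comp (Equiv.subRight p) fun i => parityProj 𝒱 i x).trans (sum_parityProj 𝒱 x)

/-- `V[t]` is the direct sum of its homogeneous components. -/
instance extDecomposition (𝒱 : ZMod 2 → Submodule k V) [DirectSum.Decomposition 𝒱] (p : ZMod 2) :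
    DirectSum.Decomposition (extGrading 𝒱 p) :=
  DirectSum.Decomposition.ofLinearMap (extGrading 𝒱 p)
    (∑ i : ZMod 2, DirectSum.lof k (ZMod 2) (fun j => extGrading 𝒱 p j) i ∘ₗ
      ((parityProj 𝒱 i).prodMap (parityProj 𝒱 (i - p))).codRestrict (extGrading 𝒱 p i)
        (fun z => ⟨Subtype.prop _, Subtype.prop _⟩))
    (by
      refine LinearMap.ext fun z => ?_
      simp only [LinearMap.comp_apply, LinearMap.sum_apply, map_sum, DirectSum.coeLinearMap_lof,
        LinearMap.id_apply]
      exact Prod.ext (by rw [Prod.fst_sum]; exact sum_parityProj 𝒱 z.1)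
        (by rw [Prod.snd_sum]; exact sum_parityProj_sub 𝒱 p z.2))
    (by
      refine DirectSum.linearMap_ext k fun i => LinearMap.ext fun z => ?_
      obtain ⟨⟨x, y⟩, hx, hy⟩ := z
      simp only [LinearMap.comp_apply, DirectSum.coeLinearMap_lof, LinearMap.sum_apply,
        LinearMap.id_apply]
      rw [Finset.sum_eq_single i]
      · congr 1
        exact Subtype.ext (Prod.ext (parityProj_of_mem 𝒱 hx) (parityProj_of_mem 𝒱 hy))
      · intro j _ hj
        refine (congrArg _ ?_).trans (map_zero (DirectSum.lof k (ZMod 2)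
          (fun j => extGrading 𝒱 p j) j))
        refine Subtype.ext (Prod.ext (parityProj_of_mem_ne 𝒱 hx (Ne.symm hj))
          (parityProj_of_mem_ne 𝒱 hy fun h => hj (sub_left_injective h).symm))
      · intro h; exact absurd (Finset.mem_univ i) h)

/-- Multiplication by `t` on `V[t]`: it sends `x + t y` to `t x`. -/
def mulT : Module.End k (V × V) := LinearMap.inr k V V ∘ₗ LinearMap.fst k V V

/-- A multilinear map `φ` of parity `q` on `V[t]` is graded linear over `k[t]`:
`φ(v₁, …, t vᵢ, …, vₙ) = (-1)^{t (φ + v₁ + ⋯ + v_{i-1})} t φ(v₁, …, vₙ)`. -/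
def IsGradedTLinear (𝒰 : ZMod 2 → Submodule k (V × V)) (p q : ZMod 2) {n : ℕ}
    (φ : Multi k n (V × V) (V × V)) : Prop :=
  ∀ (r : Fin n → ZMod 2) v, Homog 𝒰 r v → ∀ i : Fin n,
    φ (Function.update v i (mulT (k := k) (v i))) =
      sgn (p * (q + ∑ j ∈ Finset.Iio i, r j)) • mulT (k := k) (φ v)

/-- The extension of an even form `B` on `V` to a form on `V[t]` with values in `k[t]`, again
modelled on pairs:
`⟨x + t y, x' + t y'⟩ = ⟨x, x'⟩ + t (⟨y, x'⟩ + (-1)^{t x} ⟨x, y'⟩)`. -/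
def extForm (𝒱 : ZMod 2 → Submodule k V) [DirectSum.Decomposition 𝒱] (p : ZMod 2)
    (B : V →ₗ[k] V →ₗ[k] k) : (V × V) →ₗ[k] (V × V) →ₗ[k] (k × k) :=
  LinearMap.mk₂ k
    (fun z z' => (B z.1 z'.1,
      B z.2 z'.1 + B (if p = 0 then z.1 else parityInvolution 𝒱 z.1) z'.2))
    (by intro z₁ z₂ z'; ext <;> split_ifs <;> simp <;> abel)
    (by intro c z z'; ext <;> split_ifs <;> simp [mul_add])
    (by intro z z₁ z₂; ext <;> split_ifs <;> simp <;> abel)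
    (by intro c z z'; ext <;> split_ifs <;> simp [mul_add])

/-- An infinitesimal deformation `l_t = l + t λ` of the graded Lie algebra `(V, l)` into an `L∞`
algebra, with a parameter `t` of parity `p`, `t² = 0`, that preserves the inner product `B`: a
`k[t]`-linear `L∞` structure on `V[t]` that reduces to `l` modulo `t`, and for which the inner
product of `V[t]` is invariant. -/
structure Deformation (𝒱 : ZMod 2 → Submodule k V) [DirectSum.Decomposition 𝒱]
    (l : Multi k 2 V V) (B : V →ₗ[k] V →ₗ[k] k) (p : ZMod 2) where
  /-- The operations of the deformed structure. -/
  op : ∀ n, Multi k n (V × V) (V × V)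
  isLInfinity : IsLInfinity (extGrading 𝒱 p) op
  isGradedTLinear : ∀ n : ℕ, IsGradedTLinear (extGrading 𝒱 p) p n (op n)
  reduces : ∀ n (z : Fin n → V × V), (op n z).1 = ofBracket l n fun i => (z i).1
  invariant : ∀ n : ℕ, IsCyclic (extGrading 𝒱 p) (extForm 𝒱 p B) n (op n)

/-- The component `λₙ` of the deformation `l_t = l + t λ`. -/
def Deformation.cochain {𝒱 : ZMod 2 → Submodule k V} [DirectSum.Decomposition 𝒱]
    {l : Multi k 2 V V} {B : V →ₗ[k] V →ₗ[k] k} {p : ZMod 2} (m : Deformation 𝒱 l B p) (n : ℕ) :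
    Multi k n V V :=
  (LinearMap.snd k V V).compMultilinearMap ((m.op n).compLinearMap fun _ => LinearMap.inl k V V)

/-- Two deformations are equivalent if there is a `k[t]`-linear coalgebra automorphism of
`⊙(ΠV[t])` that is the identity modulo `t`, takes the one codifferential to the other, and
preserves the inner product. (An endomorphism that is the identity modulo `t` is invertible.) -/
def Deformation.IsEquivalent {𝒱 : ZMod 2 → Submodule k V} [DirectSum.Decomposition 𝒱]
    {l : Multi k 2 V V} {B : V →ₗ[k] V →ₗ[k] k} {p : ZMod 2} (m m' : Deformation 𝒱 l B p) : Prop :=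
  ∃ f : ∀ n, Multi k n (V × V) (V × V),
    IsLInfinityMorphism (extGrading 𝒱 p) m.op m'.op f ∧
    (∀ n, IsGradedTLinear (parityReversion (extGrading 𝒱 p)) p 0 (f n)) ∧
    (∀ z : Fin 1 → V × V, (f 1 z).1 = (z 0).1) ∧
    (∀ n, n ≠ 1 → ∀ z : Fin n → V × V, (f n z).1 = 0) ∧
    PreservesInnerProduct (extGrading 𝒱 p) (extForm 𝒱 p B) f

end Graded

end CyclicLInfinity

end

open CyclicLInfinity

/-!
Since `t² = 0`, the coderivation `d_l + t d_λ` that corresponds to `l + tλ` has square zero iff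
`d_l` and `d_λ` commute in the graded sense. The component of their commutator on `n + 1` arguments
is `±dλₙ`, so this means that every `λₙ` is a cocycle. Likewise an automorphism that is the identity
modulo `t` has the form `id + tφ`, and it takes `l + tλ` to `l + tλ'` iff `λ'₁ = λ₁` and
`λ'ₙ₊₁ - λₙ₊₁ = dφₙ` for all `n ≥ 1`. The condition `F*ω = ω` has no terms of second order in `φ`,
and on `n + 1` arguments it says that rotating them in `⟨φₙ(v₁, …, vₙ), vₙ₊₁⟩` only produces a sign,
that is, that `φₙ` is cyclic.

For the comparison with trivial coefficients, the symmetric group on `n + 1` letters is generated by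
the permutations that fix the last letter and one rotation. So `φ~` is alternating iff `φ` is
alternating and cyclic. In `dφ~` the summands with `[vᵢ, v_j]`, `j ≤ n + 1`, give the first sum
of `(dφ)~`, and those with `[vᵢ, vₙ₊₂]` the second sum, because the form is invariant. The two
complexes then only differ in that the scalar one has cochains in degree `1`, which
correspond to the missing `CC⁰`.
-/

noncomputable section

namespace CyclicLInfinity

/-! ### Signs -/

@[simp] theorem sgn_zero : sgn 0 = 1 := by simp [sgn]

@[simp] theorem sgn_one : sgn 1 = -1 := by simp [sgn]

theorem sgn_add (a b : ZMod 2) : sgn (a + b) = sgn a * sgn b := uzpow_add _ _ _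

theorem sgn_sum {ι : Type*} (s : Finset ι) (f : ι → ZMod 2) :
    sgn (∑ i ∈ s, f i) = ∏ i ∈ s, sgn (f i) := by
  classical
  induction s using Finset.induction_on with
  | empty => simp
  | insert i s hi ih => rw [Finset.sum_insert hi, Finset.prod_insert hi, sgn_add, ih]

theorem sgn_natCast_mul (m : ℕ) (a : ZMod 2) : sgn (m * a) = sgn a ^ m := by
  induction m with
  | zero => simp
  | succ m ih => rw [Nat.cast_succ, add_mul, sgn_add, ih, pow_succ, one_mul]

theorem sgn_smul_smul {X : Type*} [AddCommGroup X] (a b : ZMod 2) (x : X) :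
    sgn a • sgn b • x = sgn (a + b) • x := by
  rw [sgn_add, mul_smul]

theorem units_smul_self_smul {X : Type*} [AddCommGroup X] (u : ℤˣ) (x : X) : u • u • x = x := by
  rw [smul_smul, Int.units_mul_self, one_smul]

theorem prod_Ioi_comp_perm {ι G : Type*} [LinearOrder ι] [Fintype ι] [LocallyFiniteOrderTop ι]
    [LocallyFiniteOrderBot ι] [CommMonoid G] {X : ι → ι → G} (hX : ∀ i j, X i j = X j i)
    (σ : Equiv.Perm ι) :
    ∏ i, ∏ j ∈ Finset.Ioi i, X (σ i) (σ j) = ∏ i, ∏ j ∈ Finset.Ioi i, X i j := by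
  -- Each unordered pair is counted once, through the ordered pair that is increasing.
  let Y : ι → ι → G := fun i j => if i < j then X i j else 1
  have hY : ∀ i j, i ≠ j → Y j i * Y i j = X i j := by
    intro i j hij
    rcases hij.lt_or_gt with h | h <;> simp [Y, h, h.not_gt, hX i j]
  have prod_eq (τ : Equiv.Perm ι) :
      ∏ i, ∏ j ∈ Finset.Ioi i, X (τ i) (τ j) = ∏ i, ∏ j ∈ {i}ᶜ, Y (τ j) (τ i) := by
    rw [← Finset.prod_prod_Ioi_mul_eq_prod_prod_off_diag fun i j => Y (τ i) (τ j)]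
    exact Finset.prod_congr rfl fun i _ => Finset.prod_congr rfl fun j hj =>
      (hY _ _ (τ.injective.ne (Finset.mem_Ioi.1 hj).ne)).symm
  calc _ = ∏ i, ∏ j ∈ {i}ᶜ, Y (σ j) (σ i) := prod_eq σ
    _ = ∏ i, ∏ j ∈ {σ i}ᶜ, Y j (σ i) := Finset.prod_congr rfl fun i _ =>
      Finset.prod_equiv σ (fun j => by simp) fun j _ => rfl
    _ = ∏ i, ∏ j ∈ {i}ᶜ, Y j i := Equiv.prod_comp σ fun i => ∏ j ∈ {i}ᶜ, Y j i
    _ = _ := (prod_eq 1).symm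

theorem koszul_eq_prod_Ioi {n : ℕ} (p : Fin n → ZMod 2) (σ : Equiv.Perm (Fin n)) :
    koszul p σ =
      ∏ i, ∏ j ∈ Finset.Ioi i, if σ i < σ j then 1 else sgn (p (σ i) * p (σ j)) := by
  refine Finset.prod_congr rfl fun i _ => ?_
  rw [← Finset.filter_lt_eq_Ioi, Finset.prod_filter]
  refine Finset.prod_congr rfl fun j _ => ?_
  by_cases h : i < j
  · rcases (σ.injective.ne h.ne).lt_or_gt with hσ | hσ <;> simp [h, hσ, hσ.not_gt]
  · simp [h]

theorem koszul_mul {n : ℕ} (p : Fin n → ZMod 2) (σ τ : Equiv.Perm (Fin n)) :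
    koszul p (σ * τ) = koszul p σ * koszul (fun i => p (σ i)) τ := by
  let X : Fin n → Fin n → ℤˣ := fun i j =>
    if i < j ↔ σ i < σ j then 1 else sgn (p (σ i) * p (σ j))
  have hX : ∀ i j, X i j = X j i := by
    intro i j
    rcases eq_or_ne i j with rfl | hij
    · rfl
    rcases hij.lt_or_gt with h | h <;>
      rcases (σ.injective.ne hij).lt_or_gt with hσ | hσ <;>
      simp [X, h, hσ, h.not_gt, hσ.not_gt, mul_comm]
  have hσ : koszul p σ = ∏ i, ∏ j ∈ Finset.Ioi i, X i j := by
    rw [koszul_eq_prod_Ioi]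
    refine Finset.prod_congr rfl fun i _ => Finset.prod_congr rfl fun j hj => ?_
    simp only [X, Finset.mem_Ioi.1 hj, true_iff]
  rw [hσ, ← prod_Ioi_comp_perm hX τ, koszul_eq_prod_Ioi, koszul_eq_prod_Ioi]
  simp only [← Finset.prod_mul_distrib, Equiv.Perm.mul_apply]
  refine Finset.prod_congr rfl fun i _ => Finset.prod_congr rfl fun j _ => ?_
  by_cases h : τ i < τ j <;> by_cases h' : σ (τ i) < σ (τ j) <;> simp [X, h, h']

@[simp] theorem koszul_refl {n : ℕ} (p : Fin n → ZMod 2) : koszul p 1 = 1 := by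
  rw [koszul_eq_prod_Ioi]
  exact Finset.prod_eq_one fun i _ => Finset.prod_eq_one fun j hj => if_pos (Finset.mem_Ioi.1 hj)

theorem koszul_one_eq_sign {n : ℕ} (σ : Equiv.Perm (Fin n)) :
    koszul (fun _ => 1) σ = Equiv.Perm.sign σ := by
  rw [koszul_eq_prod_Ioi, Equiv.Perm.sign_eq_prod_prod_Ioi]
  simp only [mul_one, sgn_one]

/-- The sign of the identification `η` of `v₁ ∧ ⋯ ∧ vₙ` with `πv₁ ⊙ ⋯ ⊙ πvₙ`, for `vᵢ` of
parity `p i`. -/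
def suspSign {n : ℕ} (p : Fin n → ZMod 2) : ℤˣ :=
  sgn (∑ i : Fin n, ((n - 1 - (i : ℕ) : ℕ) : ZMod 2) * p i)

theorem suspSign_eq_prod_Ioi {n : ℕ} (p : Fin n → ZMod 2) :
    suspSign p = ∏ i, ∏ _j ∈ Finset.Ioi i, sgn (p i) := by
  simp only [suspSign, sgn_sum, sgn_natCast_mul, Finset.prod_const, Fin.card_Ioi]

theorem suspSign_mul_suspSign_comp {n : ℕ} (p : Fin n → ZMod 2) (σ : Equiv.Perm (Fin n)) :
    suspSign p * suspSign (fun i => p (σ i)) =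
      ∏ i, ∏ j ∈ Finset.Ioi i, if σ i < σ j then 1 else sgn (p (σ i) + p (σ j)) := by
  have hp : suspSign p = ∏ i, ∏ j ∈ Finset.Ioi i, sgn (p (min i j)) := by
    rw [suspSign_eq_prod_Ioi]
    refine Finset.prod_congr rfl fun i _ => Finset.prod_congr rfl fun j hj => ?_
    rw [min_eq_left (Finset.mem_Ioi.1 hj).le]
  rw [hp, ← prod_Ioi_comp_perm (fun i j => by rw [min_comm]) σ, suspSign_eq_prod_Ioi]
  simp only [← Finset.prod_mul_distrib]
  refine Finset.prod_congr rfl fun i _ => Finset.prod_congr rfl fun j _ => ?_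
  split_ifs with h
  · rw [min_eq_left h.le, Int.units_mul_self]
  · rw [min_eq_right (not_lt.1 h), sgn_add, mul_comm]

theorem koszul_add_one {n : ℕ} (p : Fin n → ZMod 2) (σ : Equiv.Perm (Fin n)) :
    koszul (fun i => p i + 1) σ =
      Equiv.Perm.sign σ * koszul p σ * (suspSign p * suspSign fun i => p (σ i)) := by
  simp only [suspSign_mul_suspSign_comp, ← koszul_one_eq_sign, koszul_eq_prod_Ioi,
    ← Finset.prod_mul_distrib]
  refine Finset.prod_congr rfl fun i _ => Finset.prod_congr rfl fun j _ => ?_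
  split_ifs
  · simp
  · rw [← sgn_add, ← sgn_add]
    ring_nf

theorem suspSign_append_mul {n a b : ℕ} (h : b + a = n) (s : ZMod 2) (p : Fin n → ZMod 2) :
    (suspSign (fun i : Fin b => p (Fin.cast h (Fin.castAdd a i)))) *
      suspSign (Fin.cons (s + ∑ i, p (Fin.cast h (Fin.castAdd a i)))
        (fun j => p (Fin.cast h (Fin.natAdd b j))) : Fin (a + 1) → ZMod 2) =
      sgn (a * s) * suspSign p := by
  subst h
  have weight_castAdd : ∀ i : Fin b,
      ((b + a - 1 - (i : ℕ) : ℕ) : ZMod 2) = a + (b - 1 - (i : ℕ) : ℕ) := by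
    intro i
    rw [← Nat.cast_add]
    congr 1
    omega
  have weight_natAdd : ∀ j : Fin a, b + a - 1 - (b + (j : ℕ)) = a + 1 - 1 - (j + 1) := by
    intro j
    omega
  simp only [suspSign, ← sgn_add, Fin.sum_univ_add, Fin.sum_univ_succ, Fin.cons_zero, Fin.cons_succ,
    Fin.cast_refl, Fin.val_zero, Fin.val_succ, Fin.val_castAdd, Fin.val_natAdd, id,
    weight_castAdd, weight_natAdd, add_mul, Finset.sum_add_distrib, mul_add, Finset.mul_sum,
    add_tsub_cancel_right, tsub_zero]
  ring_nf

section Graded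

variable {k V M : Type*} [Field k] [AddCommGroup V] [Module k V] [AddCommGroup M] [Module k M]

/-! ### Graded multilinear maps -/

theorem units_smul_mem_iff (W : Submodule k V) (u : ℤˣ) {x : V} : u • x ∈ W ↔ x ∈ W :=
  ⟨fun h => by simpa only [units_smul_self_smul] using W.smul_of_tower_mem u h,
    W.smul_of_tower_mem u⟩

theorem units_smul_eq_intCast_smul (u : ℤˣ) (x : V) : u • x = ((u : ℤ) : k) • x := by
  rw [Units.smul_def, Int.cast_smul_eq_zsmul]

theorem Multi.map_units_smul {n : ℕ} (φ : Multi k n V M) (u : Fin n → ℤˣ) (v : Fin n → V) :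
    φ (fun i => u i • v i) = (∏ i, u i) • φ v := by
  simp only [units_smul_eq_intCast_smul (k := k), Units.coe_prod, Int.cast_prod]
  exact φ.map_smul_univ _ v

theorem Multi.cons_units_smul {n : ℕ} (φ : Multi k (n + 1) V M) (u : ℤˣ) (x : V) (v : Fin n → V) :
    φ (Fin.cons (u • x) v) = u • φ (Fin.cons x v) :=
  DFunLike.congr_fun (φ.curryLeft.map_smul_of_tower u x) v

variable {𝒱 : ZMod 2 → Submodule k V}

theorem Homog.comp {n m : ℕ} {p : Fin n → ZMod 2} {v : Fin n → V} (hv : Homog 𝒱 p v)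
    (σ : Fin m → Fin n) : Homog 𝒱 (fun i => p (σ i)) (fun i => v (σ i)) := fun i => hv (σ i)

theorem Homog.cons {n : ℕ} {p : Fin n → ZMod 2} {v : Fin n → V} (hv : Homog 𝒱 p v)
    {a : ZMod 2} {x : V} (hx : x ∈ 𝒱 a) :
    Homog 𝒱 (Fin.cons a p : Fin (n + 1) → ZMod 2) (Fin.cons x v : Fin (n + 1) → V) :=
  Fin.cases hx hv

theorem Homog.snoc {n : ℕ} {p : Fin n → ZMod 2} {v : Fin n → V} (hv : Homog 𝒱 p v)
    {a : ZMod 2} {x : V} (hx : x ∈ 𝒱 a) :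
    Homog 𝒱 (Fin.snoc (α := fun _ => ZMod 2) p a) (Fin.snoc (α := fun _ => V) v x) := by
  intro i
  induction i using Fin.lastCases with
  | last => simpa using hx
  | cast i => simpa using hv i

theorem mem_parityReversion_add_one {i : ZMod 2} {x : V} :
    x ∈ parityReversion 𝒱 (i + 1) ↔ x ∈ 𝒱 i := by
  rw [parityReversion, add_assoc, CharTwo.add_self_eq_zero, add_zero]

theorem forall_homog_parityReversion {n : ℕ} {P : (Fin n → ZMod 2) → (Fin n → V) → Prop} :
    (∀ p v, Homog (parityReversion 𝒱) p v → P p v) ↔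
      ∀ p v, Homog 𝒱 p v → P (fun i => p i + 1) v := by
  refine ⟨fun h p v hv => h _ v fun i => mem_parityReversion_add_one.2 (hv i), fun h p v hv => ?_⟩
  simpa only [add_assoc, CharTwo.add_self_eq_zero, add_zero] using h _ v hv

theorem hasParity_parityReversion_iff {ℳ : ZMod 2 → Submodule k M} {n : ℕ} {q : ZMod 2}
    {φ : Multi k n V M} :
    HasParity (parityReversion 𝒱) (parityReversion ℳ) q φ ↔ HasParity 𝒱 ℳ (q + n + 1) φ := by
  have shift : ∀ p : Fin n → ZMod 2, q + ∑ i, (p i + 1) + 1 = q + n + 1 + ∑ i, p i := by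
    intro p
    simp only [Finset.sum_add_distrib, Finset.sum_const, Finset.card_univ, Fintype.card_fin,
      nsmul_eq_mul, mul_one]
    ring
  refine forall_homog_parityReversion.trans ?_
  simp only [parityReversion, shift]
  rfl

variable (𝒱) [DirectSum.Decomposition 𝒱]

theorem parityProj_mem (i : ZMod 2) (x : V) : parityProj 𝒱 i x ∈ 𝒱 i := Subtype.prop _

theorem Multi.ext_homog {n : ℕ} {φ ψ : Multi k n V M}
    (h : ∀ p v, Homog 𝒱 p v → φ v = ψ v) : φ = ψ := by
  classical
  ext v
  have hv : v = fun i => ∑ j, parityProj 𝒱 j (v i) := by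
    funext i
    rw [sum_parityProj]
  rw [hv, φ.map_sum, ψ.map_sum]
  exact Finset.sum_congr rfl fun p _ => h p _ fun i => parityProj_mem 𝒱 (p i) (v i)

theorem parityInvolution_apply (x : V) :
    parityInvolution 𝒱 x = parityProj 𝒱 0 x - parityProj 𝒱 1 x := rfl

theorem parityInvolution_of_mem {i : ZMod 2} {x : V} (hx : x ∈ 𝒱 i) :
    parityInvolution 𝒱 x = sgn i • x := by
  rw [parityInvolution_apply]
  have hi : ∀ i : ZMod 2, i = 0 ∨ i = 1 := by decide
  rcases hi i with rfl | rfl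
  · simp [parityProj_of_mem 𝒱 hx, parityProj_of_mem_ne 𝒱 hx zero_ne_one]
  · simp [parityProj_of_mem 𝒱 hx, parityProj_of_mem_ne 𝒱 hx one_ne_zero]

theorem parityInvolution_pow_of_mem {i : ZMod 2} {x : V} (hx : x ∈ 𝒱 i) (m : ℕ) :
    (parityInvolution 𝒱 ^ m) x = sgn (m * i) • x := by
  rw [sgn_natCast_mul]
  induction m with
  | zero => simp
  | succ m ih =>
    rw [pow_succ', Module.End.mul_apply, ih, LinearMap.map_smul_of_tower,
      parityInvolution_of_mem 𝒱 hx, smul_smul, pow_succ]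

theorem suspend_apply_homog {n : ℕ} (φ : Multi k n V V) {p : Fin n → ZMod 2} {v : Fin n → V}
    (hv : Homog 𝒱 p v) : suspend 𝒱 φ v = suspSign p • φ v := by
  rw [suspend, MultilinearMap.compLinearMap_apply]
  simp only [parityInvolution_pow_of_mem 𝒱 (hv _)]
  rw [Multi.map_units_smul, suspSign, sgn_sum]

theorem suspend_suspend {n : ℕ} (φ : Multi k n V V) : suspend 𝒱 (suspend 𝒱 φ) = φ := by
  refine Multi.ext_homog 𝒱 fun p v hv => ?_
  rw [suspend_apply_homog 𝒱 _ hv, suspend_apply_homog 𝒱 _ hv, units_smul_self_smul]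

theorem suspend_add {n : ℕ} (φ ψ : Multi k n V V) :
    suspend 𝒱 (φ + ψ) = suspend 𝒱 φ + suspend 𝒱 ψ := rfl

@[simp] theorem suspend_zero {n : ℕ} : suspend 𝒱 (0 : Multi k n V V) = 0 := rfl

theorem isGradedSymm_suspend_iff {n : ℕ} {φ : Multi k n V V} :
    IsGradedSymm (parityReversion 𝒱) (suspend 𝒱 φ) ↔ IsGradedAlt 𝒱 φ := by
  refine forall_congr' fun σ => forall_homog_parityReversion.trans ?_
  refine forall_congr' fun p => forall_congr' fun v => forall_congr' fun hv => ?_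
  rw [suspend_apply_homog 𝒱 _ hv, suspend_apply_homog 𝒱 _ (hv.comp σ), koszul_add_one, smul_smul,
    mul_assoc, mul_assoc (suspSign p), Int.units_mul_self, mul_one, mul_comm _ (suspSign p),
    mul_smul]
  exact smul_left_cancel_iff _

theorem hasParity_suspend_iff {ℳ : ZMod 2 → Submodule k V} {n : ℕ} {q : ZMod 2}
    {φ : Multi k n V V} : HasParity 𝒱 ℳ q (suspend 𝒱 φ) ↔ HasParity 𝒱 ℳ q φ := by
  refine forall_congr' fun p => forall_congr' fun v => forall_congr' fun hv => ?_
  rw [suspend_apply_homog 𝒱 _ hv, units_smul_mem_iff]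

/-! ### Compositions -/

theorem extComp_apply_homog {n a b : ℕ} (h : b + a = n) (φ : Multi k (a + 1) V M)
    (ψ : Multi k b V V) {p : Fin n → ZMod 2} {v : Fin n → V} (hv : Homog 𝒱 p v) :
    extComp 𝒱 h φ ψ v = ∑ σ ∈ unshuffles n b,
      (Equiv.Perm.sign σ * koszul p σ) • insertMap h φ ψ (fun i => v (σ i)) := by
  rw [extComp_apply, Finset.sum_eq_single p]
  · simp only [parityProj_of_mem 𝒱 (hv _)]
  · intro p' _ hp'
    obtain ⟨i, hi⟩ := Function.ne_iff.1 hp'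
    refine Finset.sum_eq_zero fun σ _ => smul_eq_zero_of_right _ ?_
    change (insertMap h φ ψ).domDomCongr σ (fun i => parityProj 𝒱 (p' i) (v i)) = 0
    exact MultilinearMap.map_coord_zero _ i (parityProj_of_mem_ne 𝒱 (hv i) hi.symm)
  · exact fun hp => absurd (Finset.mem_univ p) hp

theorem insertMap_suspend {n a b : ℕ} (h : b + a = n) (φ : Multi k (a + 1) V V)
    {ψ : Multi k b V V} {s : ZMod 2} (hψ : HasParity 𝒱 𝒱 s ψ) {p : Fin n → ZMod 2} {v : Fin n → V}
    (hv : Homog 𝒱 p v) :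
    insertMap h (suspend 𝒱 φ) (suspend 𝒱 ψ) v =
      (sgn (a * s) * suspSign p) • insertMap h φ ψ v := by
  rw [insertMap_apply, insertMap_apply, suspend_apply_homog 𝒱 ψ (hv.comp _),
    Multi.cons_units_smul, suspend_apply_homog 𝒱 φ ((hv.comp _).cons (hψ _ _ (hv.comp _))),
    smul_smul, suspSign_append_mul h]

theorem sum_unshuffles_suspend {n a b : ℕ} (h : b + a = n) (φ : Multi k (a + 1) V V)
    {ψ : Multi k b V V} {s : ZMod 2} (hψ : HasParity 𝒱 𝒱 s ψ) {p : Fin n → ZMod 2} {v : Fin n → V}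
    (hv : Homog 𝒱 p v) :
    ∑ σ ∈ unshuffles n b, koszul (fun i => p i + 1) σ •
        insertMap h (suspend 𝒱 φ) (suspend 𝒱 ψ) (fun i => v (σ i)) =
      (sgn (a * s) * suspSign p) • extComp 𝒱 h φ ψ v := by
  rw [extComp_apply_homog 𝒱 h φ ψ hv, Finset.smul_sum]
  refine Finset.sum_congr rfl fun σ _ => ?_
  rw [insertMap_suspend 𝒱 h φ hψ (hv.comp σ), koszul_add_one, smul_smul, smul_smul]
  congr 1
  calc _ = sgn (a * s) * suspSign p * (Equiv.Perm.sign σ * koszul p σ) *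
      ((suspSign fun i => p (σ i)) * suspSign fun i => p (σ i)) := by ac_rfl
    _ = _ := by rw [Int.units_mul_self, mul_one]

end Graded

/-! ### Unshuffles of type `(n, 1)` -/

/-- The permutation `(0, …, i - 1, i + 1, …, n, i)`; these are the unshuffles of type `(n, 1)`. -/
def skipPerm {n : ℕ} (i : Fin (n + 1)) : Equiv.Perm (Fin (n + 1)) :=
  finSuccEquivLast.trans (finSuccEquiv' i).symm

@[simp] theorem skipPerm_last {n : ℕ} (i : Fin (n + 1)) : skipPerm i (Fin.last n) = i := by
  simp [skipPerm]

@[simp] theorem skipPerm_castSucc {n : ℕ} (i : Fin (n + 1)) (j : Fin n) :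
    skipPerm i j.castSucc = i.succAbove j := by
  simp [skipPerm]

theorem koszul_skipPerm {n : ℕ} (p : Fin (n + 1) → ZMod 2) (i : Fin (n + 1)) :
    koszul p (skipPerm i) = sgn (p i * ∑ j ∈ Finset.Ioi i, p j) := by
  have no_inversion : ∀ a b : Fin n, ¬ (a < b ∧ i.succAbove b < i.succAbove a) := fun a b h =>
    h.2.not_gt (Fin.strictMono_succAbove i h.1)
  rw [koszul, Fin.prod_univ_castSucc]
  simp only [Fin.prod_univ_castSucc, skipPerm_last, skipPerm_castSucc, Fin.castSucc_lt_castSucc_iff,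
    no_inversion, if_false, Finset.prod_const_one, one_mul, Fin.castSucc_lt_last, true_and,
    lt_irrefl, false_and, (Fin.castSucc_lt_last _).not_gt, mul_one]
  rw [Finset.mul_sum, sgn_sum, ← Finset.filter_lt_eq_Ioi, Finset.prod_filter,
    Fin.prod_univ_succAbove _ i]
  simp [mul_comm]

theorem sign_skipPerm {n : ℕ} (i : Fin (n + 1)) :
    Equiv.Perm.sign (skipPerm i) = sgn ((n - i : ℕ) : ZMod 2) := by
  rw [← koszul_one_eq_sign, koszul_skipPerm, Finset.sum_const, Fin.card_Ioi]
  simp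

theorem mem_unshuffles {n b : ℕ} {σ : Equiv.Perm (Fin n)} :
    σ ∈ unshuffles n b ↔
      ∀ i j : Fin n, i < j → ((j : ℕ) < b ∨ b ≤ (i : ℕ)) → σ i < σ j := by
  simp [unshuffles]

theorem strictMono_eq_succAbove {n : ℕ} {f : Fin n → Fin (n + 1)} (hf : StrictMono f)
    {i : Fin (n + 1)} (hi : ∀ j, f j ≠ i) : f = i.succAbove := by
  refine (hf.range_inj (Fin.strictMono_succAbove i)).1 ?_
  rw [Fin.range_succAbove]
  refine Set.eq_of_subset_of_ncard_le (Set.range_subset_iff.2 hi) ?_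
  rw [Set.ncard_compl, Set.ncard_singleton, Set.ncard_range_of_injective hf.injective]
  simp

theorem skipPerm_mem_unshuffles {n : ℕ} (i : Fin (n + 1)) :
    skipPerm i ∈ unshuffles (n + 1) n := by
  refine mem_unshuffles.2 fun a b hab h => ?_
  have hb : b ≠ Fin.last n := by
    rintro rfl
    exact h.elim (lt_irrefl n) hab.not_ge
  obtain ⟨b, rfl⟩ := Fin.eq_castSucc_of_ne_last hb
  obtain ⟨a, rfl⟩ := Fin.eq_castSucc_of_ne_last (Fin.ne_last_of_lt hab)
  rw [skipPerm_castSucc, skipPerm_castSucc]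
  exact Fin.strictMono_succAbove i (Fin.castSucc_lt_castSucc_iff.1 hab)

theorem eq_skipPerm_of_mem_unshuffles {n : ℕ} {σ : Equiv.Perm (Fin (n + 1))}
    (hσ : σ ∈ unshuffles (n + 1) n) : σ = skipPerm (σ (Fin.last n)) := by
  have h : (fun j : Fin n => σ j.castSucc) = (σ (Fin.last n)).succAbove :=
    strictMono_eq_succAbove (fun a b hab => mem_unshuffles.1 hσ _ _ hab (Or.inl b.2)) fun j h =>
      (Fin.castSucc_lt_last j).ne (σ.injective h)
  refine Equiv.ext fun j => ?_
  induction j using Fin.lastCases with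
  | last => simp
  | cast j => rw [skipPerm_castSucc, ← h]

theorem sum_unshuffles_last {X : Type*} [AddCommMonoid X] {n : ℕ}
    (F : Equiv.Perm (Fin (n + 1)) → X) :
    ∑ σ ∈ unshuffles (n + 1) n, F σ = ∑ i, F (skipPerm i) := by
  refine Finset.sum_bij' (fun σ _ => σ (Fin.last n)) (fun i _ => skipPerm i)
    (fun _ _ => Finset.mem_univ _) (fun i _ => skipPerm_mem_unshuffles i)
    (fun σ hσ => (eq_skipPerm_of_mem_unshuffles hσ).symm) (fun i _ => skipPerm_last i)
    fun σ hσ => ?_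
  rw [← eq_skipPerm_of_mem_unshuffles hσ]

/-! ### Bilinear maps as multilinear maps of two variables -/

section Bilinear

variable {k V M : Type*} [Field k] [AddCommGroup V] [Module k V] [AddCommGroup M] [Module k M]

theorem eq_pair {X : Type*} (v : Fin 2 → X) : v = ![v 0, v 1] :=
  funext (Fin.forall_fin_two.2 ⟨rfl, rfl⟩)

theorem update_pair_one {X : Type*} (x y z : X) : Function.update ![x, y] 1 z = ![x, z] :=
  funext (Fin.forall_fin_two.2 ⟨rfl, rfl⟩)

theorem pair_add_left (l : Multi k 2 V M) (x x' y : V) :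
    l ![x + x', y] = l ![x, y] + l ![x', y] := l.cons_add ![y] x x'

theorem pair_add_right (l : Multi k 2 V M) (x y y' : V) :
    l ![x, y + y'] = l ![x, y] + l ![x, y'] := by
  simpa only [update_pair_one] using l.map_update_add ![x, 0] 1 y y'

theorem pair_units_smul_left (l : Multi k 2 V M) (u : ℤˣ) (x y : V) :
    l ![u • x, y] = u • l ![x, y] := Multi.cons_units_smul l u x ![y]

theorem pair_units_smul_right (l : Multi k 2 V M) (u : ℤˣ) (x y : V) :
    l ![x, u • y] = u • l ![x, y] := by
  simpa only [MultilinearMap.toLinearMap_apply, update_pair_one] using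
    (l.toLinearMap ![x, 0] 1).map_smul_of_tower u y

@[simp] theorem pair_zero_left (l : Multi k 2 V M) (y : V) : l ![0, y] = 0 :=
  l.map_coord_zero 0 rfl

@[simp] theorem pair_zero_right (l : Multi k 2 V M) (x : V) : l ![x, 0] = 0 :=
  l.map_coord_zero 1 rfl

theorem insertMap_pair {n : ℕ} (h : n + 1 = n + 1) (l : Multi k 2 V M) (ψ : Multi k n V V)
    (v : Fin (n + 1) → V) :
    insertMap h l ψ v = l ![ψ fun i => v i.castSucc, v (Fin.last n)] := by
  rw [insertMap_apply, eq_pair (Fin.cons _ _)]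
  rfl

variable {𝒱 : ZMod 2 → Submodule k V} {l : Multi k 2 V V}

theorem extComp_pair_apply_homog [DirectSum.Decomposition 𝒱] {n : ℕ} (h : n + 1 = n + 1)
    (l : Multi k 2 V M) (ψ : Multi k n V V) {p : Fin (n + 1) → ZMod 2} {v : Fin (n + 1) → V}
    (hv : Homog 𝒱 p v) :
    extComp 𝒱 h l ψ v = ∑ i : Fin (n + 1),
      sgn ((n - i : ℕ) + p i * ∑ j ∈ Finset.Ioi i, p j) •
        l ![ψ fun j => v (i.succAbove j), v i] := by
  rw [extComp_apply_homog 𝒱 h l ψ hv, sum_unshuffles_last]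
  simp only [insertMap_pair, koszul_skipPerm, sign_skipPerm, skipPerm_castSucc, skipPerm_last,
    sgn_add]

theorem isGradedAlt_of_antisymm {φ : Multi k 2 V M}
    (h : ∀ i j : ZMod 2, ∀ x ∈ 𝒱 i, ∀ y ∈ 𝒱 j, φ ![x, y] = -(sgn (i * j) • φ ![y, x])) :
    IsGradedAlt 𝒱 φ := by
  intro σ p v hv
  have perm_cases : ∀ σ : Equiv.Perm (Fin 2), σ = 1 ∨ σ = Equiv.swap 0 1 := by decide
  obtain rfl | rfl := perm_cases σ
  · simp
  · rw [eq_pair v, eq_pair fun i => ![v 0, v 1] _, h _ _ _ (hv 0) _ (hv 1)]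
    simp [koszul, Fin.prod_univ_two, mul_comm]

theorem IsLieBracket.map_mem (hl : IsLieBracket 𝒱 l) {i j : ZMod 2} {x y : V} (hx : x ∈ 𝒱 i)
    (hy : y ∈ 𝒱 j) : l ![x, y] ∈ 𝒱 (i + j) := by
  simpa using hl.even ![i, j] ![x, y] (Fin.forall_fin_two.2 ⟨hx, hy⟩)

theorem IsLieBracket.isGradedAlt (hl : IsLieBracket 𝒱 l) : IsGradedAlt 𝒱 l :=
  isGradedAlt_of_antisymm hl.antisymm

theorem IsLieBracket.extComp_self [DirectSum.Decomposition 𝒱] (hl : IsLieBracket 𝒱 l)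
    (h : 2 + 1 = 3) : extComp 𝒱 h l l = 0 := by
  refine Multi.ext_homog 𝒱 fun p v hv => ?_
  have Ioi_zero : Finset.Ioi (0 : Fin 3) = {1, 2} := by decide
  have Ioi_one : Finset.Ioi (1 : Fin 3) = {2} := by decide
  have Ioi_two : Finset.Ioi (2 : Fin 3) = ∅ := by decide
  have omit_zero : (fun j => v (Fin.succAbove 0 j)) = ![v 1, v 2] := eq_pair _
  have omit_one : (fun j => v (Fin.succAbove 1 j)) = ![v 0, v 2] := eq_pair _
  have omit_two : (fun j => v (Fin.succAbove 2 j)) = ![v 0, v 1] := eq_pair _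
  have swap_zero := hl.antisymm _ _ _ (hl.map_mem (hv 1) (hv 2)) _ (hv 0)
  have swap_one := hl.antisymm _ _ _ (hl.map_mem (hv 0) (hv 2)) _ (hv 1)
  rw [extComp_pair_apply_homog h l l hv, Fin.sum_univ_three]
  rw [omit_zero, omit_one, omit_two, Ioi_zero, Ioi_one, Ioi_two, swap_zero, swap_one,
    hl.jacobi _ _ _ (hv 0) _ (hv 1), Finset.sum_pair (by decide), Finset.sum_singleton,
    Finset.sum_empty]
  have weight_zero : ((2 - ((0 : Fin 3) : ℕ) : ℕ) : ZMod 2) = 0 := by decide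
  have weight_one : ((2 - ((1 : Fin 3) : ℕ) : ℕ) : ZMod 2) = 1 := by decide
  have weight_two : ((2 - ((2 : Fin 3) : ℕ) : ℕ) : ZMod 2) = 0 := by decide
  have sgn_one_two : sgn (p 1 * p 2) * sgn ((p 0 + p 2) * p 1) = sgn (p 0 * p 1) := by
    rw [← sgn_add]
    congr 1
    linear_combination CharTwo.add_self_eq_zero (p 1 * p 2)
  simp only [weight_zero, weight_one, weight_two, mul_zero, add_zero, zero_add, sgn_zero, sgn_one,
    sgn_add 1, neg_mul, one_mul, one_smul, smul_neg, Units.neg_smul, neg_neg, smul_smul,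
    sgn_one_two, mul_comm (p 1 + p 2) (p 0), Int.units_mul_self, zero_apply]
  abel

end Bilinear

/-! ### The extension of scalars `V[t]` -/

section Extension

variable {k V M : Type*} [Field k] [AddCommGroup V] [Module k V] [AddCommGroup M] [Module k M]

/-- The map `(x₁ + t y₁, …, xₙ + t yₙ) ↦ t φ(x₁, …, xₙ)` on `V[t]`, whose elements `x + t y` are
pairs `(x, y)`. -/
def tPart {n : ℕ} (φ : Multi k n V V) : Multi k n (V × V) (V × V) :=
  (LinearMap.inr k V V).compMultilinearMap (φ.compLinearMap fun _ => LinearMap.fst k V V)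

theorem tPart_apply {n : ℕ} (φ : Multi k n V V) (z : Fin n → V × V) :
    tPart φ z = (0, φ fun i => (z i).1) := rfl

theorem tPart_zero {n : ℕ} : tPart (0 : Multi k n V V) = 0 := rfl

theorem tPart_add {n : ℕ} (φ ψ : Multi k n V V) : tPart (φ + ψ) = tPart φ + tPart ψ :=
  MultilinearMap.ext fun _ => Prod.ext (add_zero (0 : V)).symm rfl

theorem tPart_units_smul {n : ℕ} (u : ℤˣ) (φ : Multi k n V V) : tPart (u • φ) = u • tPart φ :=
  MultilinearMap.ext fun _ => Prod.ext (smul_zero u).symm rfl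

theorem tPart_injective {n : ℕ} :
    Function.Injective (tPart : Multi k n V V → Multi k n (V × V) (V × V)) := fun _ _ h =>
  MultilinearMap.ext fun v => congrArg (fun F => (F fun i => (v i, (0 : V))).2) h

theorem mulT_apply (z : V × V) : mulT (k := k) z = (0, z.1) := rfl

section Grading

variable (𝒱 : ZMod 2 → Submodule k V)

theorem mem_extGrading {p i : ZMod 2} {z : V × V} :
    z ∈ extGrading 𝒱 p i ↔ z.1 ∈ 𝒱 i ∧ z.2 ∈ 𝒱 (i + p) := by
  rw [extGrading, Submodule.mem_prod, CharTwo.sub_eq_add]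

variable {𝒱} in
theorem Homog.fst {p : ZMod 2} {n : ℕ} {r : Fin n → ZMod 2} {z : Fin n → V × V}
    (hz : Homog (extGrading 𝒱 p) r z) : Homog 𝒱 r fun i => (z i).1 :=
  fun i => ((mem_extGrading 𝒱).1 (hz i)).1

variable {𝒱} in
theorem Homog.inl (p : ZMod 2) {n : ℕ} {r : Fin n → ZMod 2} {v : Fin n → V} (hv : Homog 𝒱 r v) :
    Homog (extGrading 𝒱 p) r fun i => (v i, (0 : V)) :=
  fun i => (mem_extGrading 𝒱).2 ⟨hv i, zero_mem _⟩

variable [DirectSum.Decomposition 𝒱]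

theorem parityInvolution_extGrading (p : ZMod 2) (z : V × V) :
    parityInvolution (extGrading 𝒱 p) z =
      (parityInvolution 𝒱 z.1, sgn p • parityInvolution 𝒱 z.2) := by
  induction z using DirectSum.Decomposition.inductionOn (extGrading 𝒱 p) with
  | zero => simp only [map_zero, Prod.fst_zero, Prod.snd_zero, smul_zero, Prod.mk_zero_zero]
  | @homogeneous i m =>
    obtain ⟨h_fst, h_snd⟩ := (mem_extGrading 𝒱).1 m.2
    rw [parityInvolution_of_mem _ m.2, parityInvolution_of_mem _ h_fst,
      parityInvolution_of_mem _ h_snd, sgn_smul_smul, add_left_comm,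
      CharTwo.add_self_eq_zero, add_zero]
    rfl
  | add m m' h h' => rw [map_add, h, h']; simp

theorem parityInvolution_pow_extGrading_fst (p : ZMod 2) (m : ℕ) (z : V × V) :
    ((parityInvolution (extGrading 𝒱 p) ^ m) z).1 = (parityInvolution 𝒱 ^ m) z.1 := by
  induction m with
  | zero => rfl
  | succ m ih =>
    rw [pow_succ', pow_succ', Module.End.mul_apply, Module.End.mul_apply,
      parityInvolution_extGrading, ih]

theorem suspend_tPart (p : ZMod 2) {n : ℕ} (φ : Multi k n V V) :
    suspend (extGrading 𝒱 p) (tPart φ) = tPart (suspend 𝒱 φ) := by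
  ext z
  · rfl
  · simp only [suspend, MultilinearMap.compLinearMap_apply, tPart_apply,
      parityInvolution_pow_extGrading_fst]

/-- The sign `v ↦ (-1)^{t v} v` of moving the parameter `t` of parity `p` past `v`. -/
def parityTwist (p : ZMod 2) : Module.End k V := if p = 0 then LinearMap.id else parityInvolution 𝒱

theorem parityTwist_of_mem (p : ZMod 2) {i : ZMod 2} {x : V} (hx : x ∈ 𝒱 i) :
    parityTwist 𝒱 p x = sgn (p * i) • x := by
  have hp : ∀ p : ZMod 2, p = 0 ∨ p = 1 := by decide
  rcases hp p with rfl | rfl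
  · simp [parityTwist]
  · simp [parityTwist, parityInvolution_of_mem 𝒱 hx]

theorem extForm_apply (p : ZMod 2) (B : V →ₗ[k] V →ₗ[k] k) (z z' : V × V) :
    extForm 𝒱 p B z z' = (B z.1 z'.1, B z.2 z'.1 + B (parityTwist 𝒱 p z.1) z'.2) := by
  rw [extForm, LinearMap.mk₂_apply, parityTwist]
  split_ifs <;> rfl

end Grading

/-! ### The bracket of `V[t]` -/

section Bracket

variable (𝒱 : ZMod 2 → Submodule k V) [DirectSum.Decomposition 𝒱]

/-- The `k[t]`-bilinear extension of the bracket `l` to `V[t]`: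
`[x + t y, x' + t y'] = [x, x'] + t ([y, x'] + (-1)^{t x} [x, y'])`. -/
def extBracket (p : ZMod 2) (l : Multi k 2 V V) : Multi k 2 (V × V) (V × V) :=
  (LinearMap.inl k V V).compMultilinearMap (l.compLinearMap fun _ => LinearMap.fst k V V) +
  ((LinearMap.inr k V V).compMultilinearMap
      (l.compLinearMap ![LinearMap.snd k V V, LinearMap.fst k V V]) +
    (LinearMap.inr k V V).compMultilinearMap
      (l.compLinearMap ![parityTwist 𝒱 p ∘ₗ LinearMap.fst k V V, LinearMap.snd k V V]))

theorem extBracket_apply (p : ZMod 2) (l : Multi k 2 V V) (z z' : V × V) :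
    extBracket 𝒱 p l ![z, z'] =
      (l ![z.1, z'.1], l ![z.2, z'.1] + l ![parityTwist 𝒱 p z.1, z'.2]) := by
  simp only [extBracket, add_apply, LinearMap.compMultilinearMap_apply,
    MultilinearMap.compLinearMap_apply]
  rw [eq_pair fun i => (LinearMap.fst k V V) (![z, z'] i),
    eq_pair fun i => (![LinearMap.snd k V V, LinearMap.fst k V V] i) (![z, z'] i),
    eq_pair fun i => (![parityTwist 𝒱 p ∘ₗ LinearMap.fst k V V, LinearMap.snd k V V] i)
      (![z, z'] i)]
  simp

theorem extBracket_fst (p : ZMod 2) (l : Multi k 2 V V) (z : Fin 2 → V × V) :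
    (extBracket 𝒱 p l z).1 = l fun i => (z i).1 := by
  rw [eq_pair z, extBracket_apply, eq_pair fun i => (![z 0, z 1] i).1]
  rfl

variable {𝒱} {l : Multi k 2 V V}

theorem IsLieBracket.extBracket_mem (hl : IsLieBracket 𝒱 l) {p i j : ZMod 2} {x y : V × V}
    (hx : x ∈ extGrading 𝒱 p i) (hy : y ∈ extGrading 𝒱 p j) :
    extBracket 𝒱 p l ![x, y] ∈ extGrading 𝒱 p (i + j) := by
  rw [mem_extGrading] at hx hy
  rw [mem_extGrading, extBracket_apply, parityTwist_of_mem 𝒱 p hx.1, pair_units_smul_left]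
  refine ⟨hl.map_mem hx.1 hy.1, add_mem ?_ ((units_smul_mem_iff _ _).2 ?_)⟩
  · simpa only [add_right_comm] using hl.map_mem hx.2 hy.1
  · simpa only [add_assoc] using hl.map_mem hx.1 hy.2

theorem IsLieBracket.extBracket_antisymm (hl : IsLieBracket 𝒱 l) {p i j : ZMod 2} {x y : V × V}
    (hx : x ∈ extGrading 𝒱 p i) (hy : y ∈ extGrading 𝒱 p j) :
    extBracket 𝒱 p l ![x, y] = -(sgn (i * j) • extBracket 𝒱 p l ![y, x]) := by
  rw [mem_extGrading] at hx hy
  rw [extBracket_apply, extBracket_apply, parityTwist_of_mem 𝒱 p hx.1,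
    parityTwist_of_mem 𝒱 p hy.1, pair_units_smul_left, pair_units_smul_left,
    hl.antisymm _ _ _ hx.1 _ hy.1, hl.antisymm _ _ _ hx.2 _ hy.1, hl.antisymm _ _ _ hx.1 _ hy.2]
  refine Prod.ext rfl ?_
  simp only [Prod.snd_neg, Prod.smul_snd, smul_add, smul_neg, sgn_smul_smul]
  rw [add_comm, neg_add]
  congr 4
  · linear_combination p * i * CharTwo.two_eq_zero (R := ZMod 2)
  · ring

theorem IsLieBracket.extBracket_jacobi (hl : IsLieBracket 𝒱 l) {p i j : ZMod 2} {x y : V × V}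
    (hx : x ∈ extGrading 𝒱 p i) (hy : y ∈ extGrading 𝒱 p j) (z : V × V) :
    extBracket 𝒱 p l ![x, extBracket 𝒱 p l ![y, z]] =
      extBracket 𝒱 p l ![extBracket 𝒱 p l ![x, y], z] +
        sgn (i * j) • extBracket 𝒱 p l ![y, extBracket 𝒱 p l ![x, z]] := by
  rw [mem_extGrading] at hx hy
  simp only [extBracket_apply]
  refine Prod.ext (hl.jacobi _ _ _ hx.1 _ hy.1 _) ?_
  simp only [Prod.snd_add, Prod.smul_snd]
  rw [parityTwist_of_mem 𝒱 p hx.1, parityTwist_of_mem 𝒱 p hy.1,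
    parityTwist_of_mem 𝒱 p (hl.map_mem hx.1 hy.1)]
  simp only [pair_units_smul_left, pair_units_smul_right, pair_add_left, pair_add_right, smul_add,
    sgn_smul_smul]
  rw [hl.jacobi _ _ _ hx.2 _ hy.1, hl.jacobi _ _ _ hx.1 _ hy.2, hl.jacobi _ _ _ hx.1 _ hy.1]
  simp only [smul_add, sgn_smul_smul]
  rw [show (i + p) * j = i * j + p * j by ring,
    show p * i + i * (j + p) = i * j + p * i * 2 by ring, CharTwo.two_eq_zero (R := ZMod 2),
    mul_zero, add_zero,
    show p * j + p * i + i * j = i * j + (p * i + p * j) by ring,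
    show p * j + p * i = p * (i + j) by ring]
  abel

theorem IsLieBracket.extBracket (hl : IsLieBracket 𝒱 l) (p : ZMod 2) :
    IsLieBracket (extGrading 𝒱 p) (extBracket 𝒱 p l) where
  even r z hz := by
    rw [zero_add, Fin.sum_univ_two, eq_pair z]
    exact hl.extBracket_mem (hz 0) (hz 1)
  antisymm _ _ _ hx _ hy := hl.extBracket_antisymm hx hy
  jacobi _ _ _ hx _ hy := hl.extBracket_jacobi hx hy

end Bracket

/-! ### Maps that are linear over `k[t]` -/

theorem Multi.eq_of_sub_mem (K : Submodule k V) {n : ℕ} {φ : Multi k n V M}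
    (hφ : ∀ z i, z i ∈ K → φ z = 0) {x y : Fin n → V} (h : ∀ i, x i - y i ∈ K) : φ x = φ y := by
  have piecewise_eq (S : Finset (Fin n)) : φ (S.piecewise y x) = φ x := by
    induction S using Finset.induction_on with
    | empty => simp
    | insert i S hi ih =>
      rw [← ih, Finset.piecewise_insert, ← sub_eq_zero,
        ← Function.update_eq_self i (S.piecewise y x), Function.update_idem, ← φ.map_update_sub]
      refine hφ _ i ?_
      rw [Function.update_self, Finset.piecewise_eq_of_notMem _ _ _ hi]
      exact sub_mem_comm_iff.1 (h i)
  simpa using (piecewise_eq Finset.univ).symm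

variable {𝒱 : ZMod 2 → Submodule k V} {𝒰 : ZMod 2 → Submodule k (V × V)}

theorem IsGradedTLinear.map_mulT_eq_zero {p q : ZMod 2} {n : ℕ} {φ : Multi k n (V × V) (V × V)}
    (hφ : IsGradedTLinear 𝒰 p q φ) (hfst : ∀ z, (φ z).1 = 0) (r : Fin n → ZMod 2)
    (z : Fin n → V × V) (hz : Homog 𝒰 r z) (i : Fin n) :
    φ (Function.update z i (mulT (k := k) (z i))) = 0 := by
  rw [hφ r z hz i, mulT_apply, hfst, Prod.mk_zero_zero, smul_zero]

theorem eq_tPart_of_map_mulT_eq_zero [DirectSum.Decomposition 𝒰] {n : ℕ}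
    {φ : Multi k n (V × V) (V × V)} (hfst : ∀ z, (φ z).1 = 0)
    (hφ : ∀ r z, Homog 𝒰 r z → ∀ i, φ (Function.update z i (mulT (k := k) (z i))) = 0) :
    φ = tPart ((LinearMap.snd k V V).compMultilinearMap
      (φ.compLinearMap fun _ => LinearMap.inl k V V)) := by
  have map_eq_zero (z : Fin n → V × V) (i : Fin n)
      (hz : z i ∈ LinearMap.ker (LinearMap.fst k V V)) : φ z = 0 := by
    have hcomp : φ.compLinearMap (Function.update (fun _ => LinearMap.id) i mulT) = 0 := by
      refine Multi.ext_homog 𝒰 fun r w hw => (congrArg φ ?_).trans (hφ r w hw i)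
      funext j
      rcases eq_or_ne j i with rfl | hj <;> simp [*]
    have h := DFunLike.congr_fun hcomp (Function.update z i ((z i).2, 0))
    rw [MultilinearMap.compLinearMap_apply] at h
    refine (congrArg φ (funext fun j => ?_)).trans h
    rcases eq_or_ne j i with rfl | hj
    · simpa [mulT_apply, Prod.ext_iff] using hz
    · simp [hj]
  ext z
  · exact hfst z
  · change (φ z).2 = (φ fun i => ((z i).1, 0)).2
    rw [Multi.eq_of_sub_mem _ map_eq_zero (y := fun i => ((z i).1, (0 : V))) fun i => by simp]

theorem isGradedTLinear_tPart (p q : ZMod 2) {n : ℕ} (φ : Multi k n V V) :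
    IsGradedTLinear 𝒰 p q (tPart φ) := by
  intro r z _ i
  rw [mulT_apply, mulT_apply, tPart_apply, tPart_apply, φ.map_coord_zero i (by simp)]
  exact (smul_zero _).symm

theorem IsGradedTLinear.add {p q : ZMod 2} {n : ℕ} {φ ψ : Multi k n (V × V) (V × V)}
    (hφ : IsGradedTLinear 𝒰 p q φ) (hψ : IsGradedTLinear 𝒰 p q ψ) :
    IsGradedTLinear 𝒰 p q (φ + ψ) := by
  intro r z hz i
  rw [add_apply, add_apply, hφ r z hz, hψ r z hz, map_add, smul_add]

theorem IsGradedTLinear.sub {p q : ZMod 2} {n : ℕ} {φ ψ : Multi k n (V × V) (V × V)}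
    (hφ : IsGradedTLinear 𝒰 p q φ) (hψ : IsGradedTLinear 𝒰 p q ψ) :
    IsGradedTLinear 𝒰 p q (φ - ψ) := by
  intro r z hz i
  rw [sub_apply, sub_apply, hφ r z hz, hψ r z hz, map_sub, smul_sub]

theorem isGradedTLinear_extBracket [DirectSum.Decomposition 𝒱] (p : ZMod 2) (l : Multi k 2 V V) :
    IsGradedTLinear (extGrading 𝒱 p) p 0 (extBracket 𝒱 p l) := by
  intro r z hz i
  rw [eq_pair (Function.update z i _), eq_pair z, extBracket_apply, extBracket_apply]
  fin_cases i
  · have Iio_zero : Finset.Iio (0 : Fin 2) = ∅ := by decide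
    simp [mulT_apply, Iio_zero]
  · have Iio_one : Finset.Iio (1 : Fin 2) = {0} := by decide
    simp [mulT_apply, parityTwist_of_mem 𝒱 p ((mem_extGrading 𝒱).1 (hz 0)).1,
      pair_units_smul_left, Iio_one]

end Extension

section Compatibility

variable {k V M : Type*} [Field k] [AddCommGroup V] [Module k V] [AddCommGroup M] [Module k M]

/-! ### Compatibility of conditions on maps on `V` and on `V[t]` -/

section TPart

variable {𝒱 : ZMod 2 → Submodule k V}

theorem hasParity_tPart_iff {p q : ZMod 2} {n : ℕ} {φ : Multi k n V V} :
    HasParity (extGrading 𝒱 p) (extGrading 𝒱 p) q (tPart φ) ↔ HasParity 𝒱 𝒱 (p + q) φ := by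
  have parity_eq : ∀ r : Fin n → ZMod 2, q + ∑ i, r i + p = p + q + ∑ i, r i := fun r => by ring
  constructor
  · intro h r v hv
    have h_snd := ((mem_extGrading 𝒱).1 (h r _ (hv.inl p))).2
    rwa [parity_eq] at h_snd
  · intro h r z hz
    refine (mem_extGrading 𝒱).2 ⟨zero_mem _, ?_⟩
    rw [parity_eq]
    exact h r _ hz.fst

theorem isGradedAlt_tPart_iff {p : ZMod 2} {n : ℕ} {φ : Multi k n V V} :
    IsGradedAlt (extGrading 𝒱 p) (tPart φ) ↔ IsGradedAlt 𝒱 φ := by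
  constructor
  · intro h σ r v hv
    exact congrArg Prod.snd (h σ r _ (hv.inl p))
  · intro h σ r z hz
    exact Prod.ext (by simp [tPart_apply]) (h σ r _ hz.fst)

theorem isCyclic_tPart_iff [DirectSum.Decomposition 𝒱] {p q : ZMod 2}
    {B : V →ₗ[k] V →ₗ[k] k} {n : ℕ} {φ : Multi k n V V} :
    IsCyclic (extGrading 𝒱 p) (extForm 𝒱 p B) q (tPart φ) ↔ IsCyclic 𝒱 B (p + q) φ := by
  have cyclic_iff : ∀ (r : Fin (n + 1) → ZMod 2) z, Homog (extGrading 𝒱 p) r z →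
      (extForm 𝒱 p B (tPart φ fun i => z i.castSucc) (z (Fin.last n)) =
        sgn ((n : ZMod 2) + r 0 * q) • extForm 𝒱 p B (z 0) (tPart φ fun i => z i.succ) ↔
      B (φ fun i => (z i.castSucc).1) (z (Fin.last n)).1 =
        sgn ((n : ZMod 2) + r 0 * (p + q)) • B (z 0).1 (φ fun i => (z i.succ).1)) := by
    intro r z hz
    rw [extForm_apply, extForm_apply, tPart_apply, tPart_apply, Prod.ext_iff,
      parityTwist_of_mem 𝒱 p (hz.fst 0)]
    simp only [map_zero, LinearMap.zero_apply, Prod.smul_fst, Prod.smul_snd, smul_zero, true_and,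
      add_zero, zero_add]
    rw [LinearMap.map_smul_of_tower, LinearMap.smul_apply, sgn_smul_smul,
      show (n : ZMod 2) + r 0 * q + p * r 0 = n + r 0 * (p + q) by ring]
  constructor
  · intro h r v hv
    exact (cyclic_iff r _ (hv.inl p)).1 (h r _ (hv.inl p))
  · intro h r z hz
    exact (cyclic_iff r z hz).2 (h r _ hz.fst)

end TPart

section Add

variable {𝒱 : ZMod 2 → Submodule k V} {ℳ : ZMod 2 → Submodule k M}

theorem HasParity.add {q : ZMod 2} {n : ℕ} {φ ψ : Multi k n V M} (hφ : HasParity 𝒱 ℳ q φ)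
    (hψ : HasParity 𝒱 ℳ q ψ) : HasParity 𝒱 ℳ q (φ + ψ) :=
  fun p v hv => add_mem (hφ p v hv) (hψ p v hv)

theorem HasParity.sub {q : ZMod 2} {n : ℕ} {φ ψ : Multi k n V M} (hφ : HasParity 𝒱 ℳ q φ)
    (hψ : HasParity 𝒱 ℳ q ψ) : HasParity 𝒱 ℳ q (φ - ψ) :=
  fun p v hv => sub_mem (hφ p v hv) (hψ p v hv)

theorem hasParity_zero {q : ZMod 2} {n : ℕ} : HasParity 𝒱 ℳ q (0 : Multi k n V M) :=
  fun _ _ _ => zero_mem _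

theorem IsGradedAlt.add {n : ℕ} {φ ψ : Multi k n V M} (hφ : IsGradedAlt 𝒱 φ)
    (hψ : IsGradedAlt 𝒱 ψ) : IsGradedAlt 𝒱 (φ + ψ) := by
  intro σ p v hv
  rw [add_apply, add_apply, hφ σ p v hv, hψ σ p v hv, smul_add]

theorem IsGradedAlt.sub {n : ℕ} {φ ψ : Multi k n V M} (hφ : IsGradedAlt 𝒱 φ)
    (hψ : IsGradedAlt 𝒱 ψ) : IsGradedAlt 𝒱 (φ - ψ) := by
  intro σ p v hv
  rw [sub_apply, sub_apply, hφ σ p v hv, hψ σ p v hv, smul_sub]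

theorem isGradedAlt_zero {n : ℕ} : IsGradedAlt 𝒱 (0 : Multi k n V M) :=
  fun _ _ _ _ => (smul_zero _).symm

theorem IsGradedSymm.add {n : ℕ} {φ ψ : Multi k n V M} (hφ : IsGradedSymm 𝒱 φ)
    (hψ : IsGradedSymm 𝒱 ψ) : IsGradedSymm 𝒱 (φ + ψ) := by
  intro σ p v hv
  rw [add_apply, add_apply, hφ σ p v hv, hψ σ p v hv, smul_add]

theorem IsGradedSymm.sub {n : ℕ} {φ ψ : Multi k n V M} (hφ : IsGradedSymm 𝒱 φ)
    (hψ : IsGradedSymm 𝒱 ψ) : IsGradedSymm 𝒱 (φ - ψ) := by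
  intro σ p v hv
  rw [sub_apply, sub_apply, hφ σ p v hv, hψ σ p v hv, smul_sub]

theorem IsCyclic.add {B : V →ₗ[k] V →ₗ[k] M} {q : ZMod 2} {n : ℕ} {φ ψ : Multi k n V V}
    (hφ : IsCyclic 𝒱 B q φ) (hψ : IsCyclic 𝒱 B q ψ) : IsCyclic 𝒱 B q (φ + ψ) := by
  intro p v hv
  rw [add_apply, add_apply, map_add, map_add, LinearMap.add_apply, hφ p v hv, hψ p v hv, smul_add]

theorem IsCyclic.sub {B : V →ₗ[k] V →ₗ[k] M} {q : ZMod 2} {n : ℕ} {φ ψ : Multi k n V V}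
    (hφ : IsCyclic 𝒱 B q φ) (hψ : IsCyclic 𝒱 B q ψ) : IsCyclic 𝒱 B q (φ - ψ) := by
  intro p v hv
  rw [sub_apply, sub_apply, map_sub, map_sub, LinearMap.sub_apply, hφ p v hv, hψ p v hv, smul_sub]

theorem isCyclic_zero {B : V →ₗ[k] V →ₗ[k] M} {q : ZMod 2} {n : ℕ} :
    IsCyclic 𝒱 B q (0 : Multi k n V V) := by
  intro p v _
  simp

end Add

/-! ### The family of operations given by a bracket -/

section OfBracket

variable {𝒱 : ZMod 2 → Submodule k V} {l : Multi k 2 V V}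

theorem ofBracket_of_ne {n : ℕ} (hn : n ≠ 2) : ofBracket l n = 0 := by
  match n, hn with
  | 0, _ => rfl
  | 1, _ => rfl
  | n + 3, _ => rfl

theorem hasParity_ofBracket (hl : IsLieBracket 𝒱 l) (n : ℕ) :
    HasParity 𝒱 𝒱 (n : ZMod 2) (ofBracket l n) := by
  rcases eq_or_ne n 2 with rfl | hn
  · exact hl.even
  · rw [ofBracket_of_ne hn]
    exact hasParity_zero

theorem isGradedAlt_ofBracket (hl : IsLieBracket 𝒱 l) (n : ℕ) :
    IsGradedAlt 𝒱 (ofBracket l n) := by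
  rcases eq_or_ne n 2 with rfl | hn
  · exact hl.isGradedAlt
  · rw [ofBracket_of_ne hn]
    exact isGradedAlt_zero

variable [DirectSum.Decomposition 𝒱]

theorem isGradedTLinear_ofBracket (p : ZMod 2) (n : ℕ) :
    IsGradedTLinear (extGrading 𝒱 p) p n (ofBracket (extBracket 𝒱 p l) n) := by
  rcases eq_or_ne n 2 with rfl | hn
  · exact isGradedTLinear_extBracket p l
  · rw [ofBracket_of_ne hn]
    exact isGradedTLinear_tPart _ _ (0 : Multi k n V V)

theorem ofBracket_extBracket_fst (p : ZMod 2) (n : ℕ) (z : Fin n → V × V) :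
    (ofBracket (extBracket 𝒱 p l) n z).1 = ofBracket l n fun i => (z i).1 := by
  rcases eq_or_ne n 2 with rfl | hn
  · exact extBracket_fst 𝒱 p l z
  · rw [ofBracket_of_ne hn, ofBracket_of_ne hn]
    rfl

theorem IsInvariantForm.extForm_extBracket (hl : IsLieBracket 𝒱 l) {B : V →ₗ[k] V →ₗ[k] k}
    (hinv : IsInvariantForm l B) {p i j : ZMod 2} {x y : V × V} (hx : x ∈ extGrading 𝒱 p i)
    (hy : y ∈ extGrading 𝒱 p j) (z : V × V) :
    extForm 𝒱 p B (extBracket 𝒱 p l ![x, y]) z = extForm 𝒱 p B x (extBracket 𝒱 p l ![y, z]) := by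
  replace hx := ((mem_extGrading 𝒱).1 hx).1
  replace hy := ((mem_extGrading 𝒱).1 hy).1
  have hinv' : ∀ x y z : V, B (l ![x, y]) z = B x (l ![y, z]) := hinv
  simp only [extForm_apply, extBracket_apply, parityTwist_of_mem 𝒱 p hx,
    parityTwist_of_mem 𝒱 p hy, parityTwist_of_mem 𝒱 p (hl.map_mem hx hy), map_add,
    LinearMap.map_smul_of_tower, LinearMap.add_apply, LinearMap.smul_apply, pair_units_smul_left,
    hinv', mul_add, sgn_add, mul_smul, add_assoc]

theorem isCyclic_ofBracket_extBracket (hl : IsLieBracket 𝒱 l) {B : V →ₗ[k] V →ₗ[k] k}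
    (hinv : IsInvariantForm l B) (p : ZMod 2) (n : ℕ) :
    IsCyclic (extGrading 𝒱 p) (extForm 𝒱 p B) n (ofBracket (extBracket 𝒱 p l) n) := by
  rcases eq_or_ne n 2 with rfl | hn
  · intro r z hz
    rw [Nat.cast_ofNat, CharTwo.two_eq_zero (R := ZMod 2), mul_zero, add_zero, sgn_zero, one_smul]
    change extForm 𝒱 p B (extBracket 𝒱 p l fun i => z i.castSucc) (z 2) =
      extForm 𝒱 p B (z 0) (extBracket 𝒱 p l fun i => z i.succ)
    rw [eq_pair fun i : Fin 2 => z i.castSucc, eq_pair fun i : Fin 2 => z i.succ]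
    exact hinv.extForm_extBracket hl (hz 0) (hz 1) (z 2)
  · rw [ofBracket_of_ne hn]
    exact isCyclic_zero

end OfBracket

/-! ### Composites of families of operations -/

section TotalComp

variable (𝒱 : ZMod 2 → Submodule k V) [DirectSum.Decomposition 𝒱]

/-- The component with `N` inputs of the composite of the family `F` with the coderivation with
components `G`, where `G n` has parity `s n`. It is written on the graded exterior algebra of `V`,
whence the sign `(-1)^{(N - b) s b}`, the trace of the décalage `V → ΠV`. -/
def totalComp (s : ℕ → ZMod 2) (F G : ∀ n, Multi k n V V) (N : ℕ) : Multi k N V V :=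
  ∑ b : Fin (N + 1), sgn ((N - b : ℕ) * s b) •
    extComp 𝒱 (a := N - b) (b := b) (by omega) (F (N - b + 1)) (G b)

theorem symComp_suspend (F : ∀ n, Multi k n V V) {G : ∀ n, Multi k n V V} {s : ℕ → ZMod 2}
    (hG : ∀ n, HasParity 𝒱 𝒱 (s n) (G n)) {N : ℕ} {p : Fin N → ZMod 2} {w : Fin N → V}
    (hw : Homog 𝒱 p w) :
    symComp (fun n => suspend 𝒱 (F n)) (fun n => suspend 𝒱 (G n)) (fun i => p i + 1) w =
      suspSign p • totalComp 𝒱 s F G N w := by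
  rw [symComp, totalComp, sum_apply, Finset.smul_sum]
  refine Finset.sum_congr rfl fun b _ => ?_
  rw [sum_unshuffles_suspend 𝒱 _ _ (hG b) hw, smul_apply, smul_smul, mul_comm]

theorem totalComp_add_left (s : ℕ → ZMod 2) (F F' G : ∀ n, Multi k n V V) (N : ℕ) :
    totalComp 𝒱 s (fun n => F n + F' n) G N = totalComp 𝒱 s F G N + totalComp 𝒱 s F' G N := by
  simp only [totalComp, extComp_add_left, smul_add, Finset.sum_add_distrib]

theorem totalComp_add_right (s : ℕ → ZMod 2) (F G G' : ∀ n, Multi k n V V) (N : ℕ) :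
    totalComp 𝒱 s F (fun n => G n + G' n) N = totalComp 𝒱 s F G N + totalComp 𝒱 s F G' N := by
  simp only [totalComp, extComp_add_right, smul_add, Finset.sum_add_distrib]

theorem extComp_zero_left {n a b : ℕ} (h : b + a = n) (ψ : Multi k b V V) :
    extComp 𝒱 h (0 : Multi k (a + 1) V M) ψ = 0 := by
  simpa using extComp_smul_left 𝒱 h (0 : k) (0 : Multi k (a + 1) V M) ψ

theorem extComp_zero_right {n a b : ℕ} (h : b + a = n) (φ : Multi k (a + 1) V M) :
    extComp 𝒱 h φ (0 : Multi k b V V) = 0 := by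
  simpa using extComp_smul_right 𝒱 h (0 : k) φ (0 : Multi k b V V)

theorem totalComp_ofBracket_right (s : ℕ → ZMod 2) (F : ∀ n, Multi k n V V) (l : Multi k 2 V V)
    (a : ℕ) : totalComp 𝒱 s F (ofBracket l) (a + 2) =
      sgn (a * s 2) • extComp 𝒱 (Nat.add_comm 2 a) (F (a + 1)) l := by
  rw [totalComp, Finset.sum_eq_single (⟨2, by omega⟩ : Fin (a + 2 + 1))]
  · rfl
  · intro b _ hb
    rw [ofBracket_of_ne fun h => hb (Fin.ext h), extComp_zero_right, smul_zero]
  · intro h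
    exact absurd (Finset.mem_univ _) h

theorem totalComp_ofBracket_right_of_lt (s : ℕ → ZMod 2) (F : ∀ n, Multi k n V V)
    (l : Multi k 2 V V) {N : ℕ} (hN : N < 2) : totalComp 𝒱 s F (ofBracket l) N = 0 := by
  refine Finset.sum_eq_zero fun b _ => ?_
  rw [ofBracket_of_ne (by omega), extComp_zero_right, smul_zero]

theorem totalComp_ofBracket_left (s : ℕ → ZMod 2) (G : ∀ n, Multi k n V V) (l : Multi k 2 V V)
    (b : ℕ) : totalComp 𝒱 s (ofBracket l) G (b + 1) =
      sgn (s b) • extComp 𝒱 (a := 1) rfl l (G b) := by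
  have summand_eq : ∀ (a : ℕ) (h : b + a = b + 1), a = 1 →
      sgn (a * s b) • extComp 𝒱 h (ofBracket l (a + 1)) (G b) =
        sgn (s b) • extComp 𝒱 (a := 1) rfl l (G b) := by
    rintro a h rfl
    rw [Nat.cast_one, one_mul]
    rfl
  rw [totalComp, Finset.sum_eq_single (⟨b, by omega⟩ : Fin (b + 1 + 1))]
  · exact summand_eq (b + 1 - b) (by omega) (by omega)
  · intro b' _ hb
    have h : (b' : ℕ) ≠ b := fun h => hb (Fin.ext h)
    rw [ofBracket_of_ne (by omega), extComp_zero_left, smul_zero]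
  · intro h
    exact absurd (Finset.mem_univ _) h

theorem totalComp_ofBracket_left_zero (s : ℕ → ZMod 2) (G : ∀ n, Multi k n V V)
    (l : Multi k 2 V V) : totalComp 𝒱 s (ofBracket l) G 0 = 0 := by
  refine Finset.sum_eq_zero fun b _ => ?_
  rw [ofBracket_of_ne (by omega), extComp_zero_left, smul_zero]

theorem totalComp_of_zero (s : ℕ → ZMod 2) (F : ∀ n, Multi k n V V) {G : ∀ n, Multi k n V V}
    (hG : G 0 = 0) : totalComp 𝒱 s F G 0 = 0 := by
  refine Finset.sum_eq_zero fun b _ => ?_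
  obtain rfl : b = 0 := Fin.fin_one_eq_zero b
  change _ • extComp 𝒱 _ _ (G 0) = 0
  rw [hG, extComp_zero_right, smul_zero]

theorem totalComp_ofBracket_self {l : Multi k 2 V V} (hl : IsLieBracket 𝒱 l) (s : ℕ → ZMod 2)
    (N : ℕ) : totalComp 𝒱 s (ofBracket l) (ofBracket l) N = 0 := by
  cases N with
  | zero => exact totalComp_of_zero 𝒱 s _ rfl
  | succ b =>
    rw [totalComp_ofBracket_left]
    rcases eq_or_ne b 2 with rfl | hb
    · exact (congrArg _ (hl.extComp_self rfl)).trans (smul_zero _)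
    · rw [ofBracket_of_ne hb, extComp_zero_right, smul_zero]

/-! ### Composites on `V[t]` -/

theorem extComp_tPart_left (p : ZMod 2) {n a b : ℕ} (h : b + a = n) (φ : Multi k (a + 1) V V)
    {ψ : Multi k b (V × V) (V × V)} {ψ' : Multi k b V V}
    (hψ : ∀ z, (ψ z).1 = ψ' fun i => (z i).1) :
    extComp (extGrading 𝒱 p) h (tPart φ) ψ = tPart (extComp 𝒱 h φ ψ') := by
  refine Multi.ext_homog (extGrading 𝒱 p) fun r z hz => ?_
  rw [extComp_apply_homog _ h _ _ hz, tPart_apply, extComp_apply_homog _ h _ _ hz.fst]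
  have insertMap_eq : ∀ σ : Equiv.Perm (Fin n), insertMap h (tPart φ) ψ (fun i => z (σ i)) =
      (0, insertMap h φ ψ' fun i => (z (σ i)).1) := by
    intro σ
    rw [insertMap_apply, insertMap_apply, tPart_apply, ← hψ]
    refine Prod.ext rfl (congrArg φ (funext fun i => ?_))
    cases i using Fin.cases <;> rfl
  simp only [insertMap_eq]
  refine Prod.ext ?_ ?_
  · rw [Prod.fst_sum]
    exact Finset.sum_eq_zero fun σ _ => by simp
  · rw [Prod.snd_sum]
    rfl

theorem extComp_extBracket_tPart (p : ZMod 2) (l : Multi k 2 V V) {n : ℕ} (φ : Multi k n V V) :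
    extComp (extGrading 𝒱 p) (a := 1) rfl (extBracket 𝒱 p l) (tPart φ) =
      tPart (extComp 𝒱 (a := 1) rfl l φ) := by
  refine Multi.ext_homog (extGrading 𝒱 p) fun r z hz => ?_
  rw [extComp_apply_homog _ _ _ _ hz, tPart_apply, extComp_apply_homog _ _ _ _ hz.fst]
  simp only [insertMap_pair, extBracket_apply, tPart_apply, map_zero, pair_zero_left, add_zero]
  refine Prod.ext ?_ ?_
  · rw [Prod.fst_sum]
    exact Finset.sum_eq_zero fun σ _ => by simp
  · rw [Prod.snd_sum]
    rfl

theorem totalComp_tPart_left (p : ZMod 2) (s : ℕ → ZMod 2) (φ : ∀ n, Multi k n V V)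
    {G : ∀ n, Multi k n (V × V) (V × V)} {G' : ∀ n, Multi k n V V}
    (hG : ∀ n z, (G n z).1 = G' n fun i => (z i).1) (N : ℕ) :
    totalComp (extGrading 𝒱 p) s (fun n => tPart (φ n)) G N = tPart (totalComp 𝒱 s φ G' N) := by
  simp only [totalComp, extComp_tPart_left 𝒱 p _ _ (hG _)]
  ext z
  · simp [tPart_apply, Prod.fst_sum]
  · simp [tPart_apply, Prod.snd_sum]

end TotalComp

end Compatibility

section Deformations

variable {k V : Type*} [Field k] [AddCommGroup V] [Module k V]

/-! ### Deformations and cyclic cocycles -/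

variable {𝒱 : ZMod 2 → Submodule k V} [DirectSum.Decomposition 𝒱] {l : Multi k 2 V V}
  {B : V →ₗ[k] V →ₗ[k] k} {p : ZMod 2}

theorem isLInfinity_iff_totalComp {F : ∀ n, Multi k n V V} :
    IsLInfinity 𝒱 F ↔ F 0 = 0 ∧ (∀ n : ℕ, HasParity 𝒱 𝒱 n (F n)) ∧ (∀ n, IsGradedAlt 𝒱 (F n)) ∧
      ∀ N, totalComp 𝒱 (fun n => n) F F N = 0 := by
  have sq_zero_iff (hF : ∀ n : ℕ, HasParity 𝒱 𝒱 n (F n)) {N : ℕ} {r : Fin N → ZMod 2}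
      {v : Fin N → V} (hv : Homog 𝒱 r v) :
      symComp (fun n => suspend 𝒱 (F n)) (fun n => suspend 𝒱 (F n)) (fun i => r i + 1) v = 0 ↔
        totalComp 𝒱 (fun n => n) F F N v = 0 := by
    rw [symComp_suspend 𝒱 F hF hv, smul_eq_zero_iff_eq]
  constructor
  · rintro ⟨zero, parity, alt, sq_zero⟩
    exact ⟨zero, parity, alt, fun N => Multi.ext_homog 𝒱 fun r v hv =>
      (sq_zero_iff parity hv).1 (forall_homog_parityReversion.1 (sq_zero N) r v hv)⟩
  · rintro ⟨zero, parity, alt, totalComp_eq_zero⟩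
    exact ⟨zero, parity, alt, fun N => forall_homog_parityReversion.2 fun r v hv =>
      (sq_zero_iff parity hv).2 (by rw [totalComp_eq_zero, zero_apply])⟩

/-- The operations `l + t φₙ` on `V[t]`, for a parameter `t` of parity `p`. -/
def deformOp (𝒱 : ZMod 2 → Submodule k V) [DirectSum.Decomposition 𝒱] (l : Multi k 2 V V)
    (p : ZMod 2) (φ : ∀ n, Multi k n V V) (n : ℕ) : Multi k n (V × V) (V × V) :=
  ofBracket (extBracket 𝒱 p l) n + tPart (φ n)

theorem deformOp_fst (φ : ∀ n, Multi k n V V) (n : ℕ) (z : Fin n → V × V) :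
    (deformOp 𝒱 l p φ n z).1 = ofBracket l n fun i => (z i).1 := by
  rw [deformOp, add_apply, Prod.fst_add, ofBracket_extBracket_fst, tPart_apply, add_zero]

theorem ofBracket_extBracket_inl_snd (n : ℕ) (v : Fin n → V) :
    (ofBracket (extBracket 𝒱 p l) n fun i => (v i, (0 : V))).2 = 0 := by
  rcases eq_or_ne n 2 with rfl | hn
  · change (extBracket 𝒱 p l fun i => (v i, (0 : V))).2 = 0
    rw [eq_pair fun i => (v i, (0 : V)), extBracket_apply]
    simp
  · rw [ofBracket_of_ne hn]
    rfl

theorem deformOp_inl_snd (φ : ∀ n, Multi k n V V) (n : ℕ) (v : Fin n → V) :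
    (deformOp 𝒱 l p φ n fun i => (v i, (0 : V))).2 = φ n v := by
  rw [deformOp, add_apply, Prod.snd_add, ofBracket_extBracket_inl_snd, tPart_apply, zero_add]

theorem deformOp_zero {φ : ∀ n, Multi k n V V} (hφ : φ 0 = 0) : deformOp 𝒱 l p φ 0 = 0 := by
  rw [deformOp, hφ, tPart_zero, add_zero]
  rfl

theorem totalComp_deformOp_left (φ : ∀ n, Multi k n V V) (N : ℕ) :
    totalComp (extGrading 𝒱 p) (fun n => n) (deformOp 𝒱 l p φ) (deformOp 𝒱 l p φ) N =
      totalComp (extGrading 𝒱 p) (fun n => n) (ofBracket (extBracket 𝒱 p l))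
        (deformOp 𝒱 l p φ) N +
      tPart (totalComp 𝒱 (fun n => n) φ (ofBracket l) N) :=
  (totalComp_add_left _ _ _ _ _ _).trans
    (congrArg _ (totalComp_tPart_left 𝒱 p _ φ (deformOp_fst φ) N))

-- Since `t² = 0` and `l` satisfies the Jacobi identity, only the terms linear in `t` survive.
theorem totalComp_deformOp (hl : IsLieBracket 𝒱 l) (φ : ∀ n, Multi k n V V) (a : ℕ) :
    totalComp (extGrading 𝒱 p) (fun n => n) (deformOp 𝒱 l p φ) (deformOp 𝒱 l p φ) (a + 2) =
      tPart (lieDifferential 𝒱 l a (φ (a + 1))) := by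
  have totalComp_bracket : totalComp (extGrading 𝒱 p) (fun n => n)
      (ofBracket (extBracket 𝒱 p l)) (deformOp 𝒱 l p φ) (a + 2) =
        sgn (a + 1 : ℕ) • tPart (extComp 𝒱 (a := 1) rfl l (φ (a + 1))) := by
    refine (totalComp_add_right _ _ _ _ _ _).trans ?_
    rw [totalComp_ofBracket_self _ (hl.extBracket p), zero_add,
      totalComp_ofBracket_left _ _ _ _ (a + 1), extComp_extBracket_tPart]
  rw [totalComp_deformOp_left, totalComp_bracket, totalComp_ofBracket_right, Nat.cast_ofNat,
    CharTwo.two_eq_zero (R := ZMod 2), mul_zero, sgn_zero, one_smul, Nat.cast_add, sgn_add,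
    Nat.cast_one, sgn_one, mul_neg, mul_one, Units.neg_smul, neg_add_eq_sub]
  ext z <;> simp [tPart_apply, lieDifferential]

theorem totalComp_deformOp_of_lt {φ : ∀ n, Multi k n V V} (hφ : φ 0 = 0) {N : ℕ} (hN : N < 2) :
    totalComp (extGrading 𝒱 p) (fun n => n) (deformOp 𝒱 l p φ) (deformOp 𝒱 l p φ) N = 0 := by
  match N, hN with
  | 0, _ => exact totalComp_of_zero _ _ _ (deformOp_zero hφ)
  | 1, hN =>
    rw [totalComp_deformOp_left, totalComp_ofBracket_left _ _ _ _ 0, deformOp_zero hφ,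
      extComp_zero_right, smul_zero, zero_add, totalComp_ofBracket_right_of_lt _ _ _ _ hN,
      tPart_zero]

theorem Deformation.op_eq (m : Deformation 𝒱 l B p) :
    m.op = deformOp 𝒱 l p m.cochain := by
  funext n
  have fst_eq_zero (z : Fin n → V × V) :
      ((m.op n - ofBracket (extBracket 𝒱 p l) n) z).1 = 0 := by
    rw [sub_apply, Prod.fst_sub, m.reduces, ofBracket_extBracket_fst, sub_self]
  have h := (m.isGradedTLinear n).sub (isGradedTLinear_ofBracket (l := l) p n)
  replace h := eq_tPart_of_map_mulT_eq_zero fst_eq_zero (h.map_mulT_eq_zero fst_eq_zero)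
  rw [sub_eq_iff_eq_add'] at h
  rw [h, deformOp]
  congr 2
  ext v
  change (m.op n (fun i => (v i, (0 : V))) - ofBracket (extBracket 𝒱 p l) n
    (fun i => (v i, (0 : V)))).2 = (m.op n (fun i => (v i, (0 : V)))).2
  rw [Prod.snd_sub, ofBracket_extBracket_inl_snd, sub_zero]

theorem Deformation.cochain_zero (m : Deformation 𝒱 l B p) : m.cochain 0 = 0 := by
  ext v
  change (m.op 0 _).2 = 0
  rw [m.isLInfinity.zero]
  rfl

theorem Deformation.tPart_cochain (m : Deformation 𝒱 l B p) (n : ℕ) :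
    tPart (m.cochain n) = m.op n - ofBracket (extBracket 𝒱 p l) n := by
  rw [m.op_eq, deformOp, add_sub_cancel_left]

theorem Deformation.cochain_mem_cyclicCochains (hl : IsLieBracket 𝒱 l) (hinv : IsInvariantForm l B)
    (m : Deformation 𝒱 l B p) (n : ℕ) : m.cochain n ∈ cyclicCochains 𝒱 B (p + n) n := by
  refine ⟨?_, ?_, ?_⟩
  · rw [← hasParity_tPart_iff, m.tPart_cochain]
    exact (m.isLInfinity.parity n).sub (hasParity_ofBracket (hl.extBracket p) n)
  · rw [← isGradedAlt_tPart_iff (p := p), m.tPart_cochain]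
    exact (m.isLInfinity.alt n).sub (isGradedAlt_ofBracket (hl.extBracket p) n)
  · rw [← isCyclic_tPart_iff, m.tPart_cochain]
    exact (m.invariant n).sub (isCyclic_ofBracket_extBracket hl hinv p n)

theorem Deformation.lieDifferential_cochain (hl : IsLieBracket 𝒱 l) (m : Deformation 𝒱 l B p)
    (a : ℕ) : lieDifferential 𝒱 l a (m.cochain (a + 1)) = 0 := by
  have h := (isLInfinity_iff_totalComp.1 m.isLInfinity).2.2.2 (a + 2)
  rw [m.op_eq, totalComp_deformOp hl] at h
  ext v
  exact congrArg Prod.snd (DFunLike.congr_fun h fun i => (v i, (0 : V)))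

theorem Deformation.cochain_mem_cyclicCocycles (hl : IsLieBracket 𝒱 l) (hinv : IsInvariantForm l B)
    (m : Deformation 𝒱 l B p) (a : ℕ) :
    m.cochain (a + 1) ∈ cyclicCocycles 𝒱 l B (p + (a + 1 : ℕ)) a :=
  ⟨m.cochain_mem_cyclicCochains hl hinv (a + 1), m.lieDifferential_cochain hl a⟩

/-- A sequence indexed by degrees `n ≥ 1`, extended by `0` to degree `0`. -/
def extendZero (φ : ∀ a : ℕ, Multi k (a + 1) V V) : ∀ n, Multi k n V V
  | 0 => 0
  | a + 1 => φ a

omit [DirectSum.Decomposition 𝒱] in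
theorem extendZero_mem_cyclicCochains {φ : ∀ a : ℕ, Multi k (a + 1) V V}
    (hφ : ∀ a : ℕ, φ a ∈ cyclicCochains 𝒱 B (p + (a + 1 : ℕ)) (a + 1)) :
    ∀ n : ℕ, extendZero φ n ∈ cyclicCochains 𝒱 B (p + n) n
  | 0 => zero_mem _
  | a + 1 => hφ a

theorem isLInfinity_deformOp (hl : IsLieBracket 𝒱 l) {φ : ∀ n, Multi k n V V} (hφ₀ : φ 0 = 0)
    (hφ : ∀ n : ℕ, φ n ∈ cyclicCochains 𝒱 B (p + n) n)
    (hd : ∀ a, lieDifferential 𝒱 l a (φ (a + 1)) = 0) :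
    IsLInfinity (extGrading 𝒱 p) (deformOp 𝒱 l p φ) := by
  refine isLInfinity_iff_totalComp.2 ⟨deformOp_zero hφ₀, fun n => ?_, fun n => ?_, fun N => ?_⟩
  · exact (hasParity_ofBracket (hl.extBracket p) n).add (hasParity_tPart_iff.2 (hφ n).1)
  · exact (isGradedAlt_ofBracket (hl.extBracket p) n).add (isGradedAlt_tPart_iff.2 (hφ n).2.1)
  · match N with
    | 0 => exact totalComp_deformOp_of_lt hφ₀ zero_lt_two
    | 1 => exact totalComp_deformOp_of_lt hφ₀ one_lt_two
    | a + 2 => rw [totalComp_deformOp hl, hd, tPart_zero]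

/-- The deformation `l + t φ` given by a sequence of cyclic cocycles. -/
def Deformation.ofCocycles (hl : IsLieBracket 𝒱 l) (hinv : IsInvariantForm l B)
    (φ : ∀ a : ℕ, cyclicCocycles 𝒱 l B (p + (a + 1 : ℕ)) a) : Deformation 𝒱 l B p where
  op := deformOp 𝒱 l p (extendZero fun a => φ a)
  isLInfinity := isLInfinity_deformOp hl rfl (extendZero_mem_cyclicCochains fun a => (φ a).2.1)
    fun a => (φ a).2.2
  isGradedTLinear n := (isGradedTLinear_ofBracket p n).add (isGradedTLinear_tPart _ _ _)
  reduces := deformOp_fst _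
  invariant n := (isCyclic_ofBracket_extBracket hl hinv p n).add
    (isCyclic_tPart_iff.2 (extendZero_mem_cyclicCochains (fun a => (φ a).2.1) n).2.2)

theorem Deformation.ext_op {m m' : Deformation 𝒱 l B p} (h : m.op = m'.op) : m = m' := by
  cases m
  cases m'
  cases h
  rfl

/-- The correspondence `l + t λ ↦ λ` between the deformations and the sequences of cyclic cocycles;
the component `λ₀` vanishes and is omitted. -/
def deformationEquiv (hl : IsLieBracket 𝒱 l) (hinv : IsInvariantForm l B) :
    Deformation 𝒱 l B p ≃ ∀ a : ℕ, cyclicCocycles 𝒱 l B (p + (a + 1 : ℕ)) a where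
  toFun m a := ⟨m.cochain (a + 1), m.cochain_mem_cyclicCocycles hl hinv a⟩
  invFun := Deformation.ofCocycles hl hinv
  left_inv m := by
    refine Deformation.ext_op ?_
    rw [m.op_eq]
    change deformOp 𝒱 l p _ = _
    refine congrArg (deformOp 𝒱 l p) (funext fun n => ?_)
    cases n with
    | zero => exact m.cochain_zero.symm
    | succ a => rfl
  right_inv φ := by
    funext a
    refine Subtype.ext (MultilinearMap.ext fun v => ?_)
    exact deformOp_inl_snd (extendZero fun a => (φ a : Multi k (a + 1) V V)) (a + 1) v

end Deformations

/-! ### Partitions into two blocks, one of which is a singleton -/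

theorem index_emb {N : ℕ} (c : OrderedFinpartition N) (m : Fin c.length) (r : Fin (c.partSize m)) :
    c.index (c.emb m r) = m := by
  by_contra h
  exact c.emb_ne_emb_of_ne h (c.emb_invEmbedding (c.emb m r))

/-- The ordered partition with two given blocks, the images of `e` and `e'`. As the blocks of an
ordered partition are ordered by their largest elements, `e'` has the larger one. -/
def twoBlocks {N a b : ℕ} (e : Fin (a + 1) → Fin N) (e' : Fin (b + 1) → Fin N) (he : StrictMono e)
    (he' : StrictMono e') (hlt : e (Fin.last a) < e' (Fin.last b)) (hdisj : ∀ i j, e i ≠ e' j)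
    (hcover : ∀ x, (∃ i, e i = x) ∨ ∃ j, e' j = x) : OrderedFinpartition N where
  length := 2
  partSize := fun
    | 0 => a + 1
    | 1 => b + 1
  partSize_pos := fun
    | 0 => Nat.succ_pos a
    | 1 => Nat.succ_pos b
  emb := fun
    | 0 => e
    | 1 => e'
  emb_strictMono := fun
    | 0 => he
    | 1 => he'
  parts_strictMono := by
    intro i j hij
    have hi : i = 0 := by omega
    have hj : j = 1 := by omega
    subst hi hj
    exact hlt
  disjoint := by
    have h_range : Disjoint (Set.range e) (Set.range e') := by
      rw [Set.disjoint_iff_forall_ne]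
      rintro _ ⟨x, rfl⟩ _ ⟨y, rfl⟩
      exact hdisj x y
    intro i _ j _ hij
    match i, j, hij with
    | 0, 0, hij => exact absurd rfl hij
    | 0, 1, _ => exact h_range
    | 1, 0, _ => exact h_range.symm
    | 1, 1, hij => exact absurd rfl hij
  cover := by
    intro x
    rcases hcover x with ⟨i, hi⟩ | ⟨j, hj⟩
    · exact ⟨0, i, hi⟩
    · exact ⟨1, j, hj⟩

theorem exists_eq_twoBlocks {N : ℕ} (c : OrderedFinpartition N) (hc : c.length = 2) :
    ∃ (a b : ℕ) (e : Fin (a + 1) → Fin N) (e' : Fin (b + 1) → Fin N) (he : StrictMono e)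
      (he' : StrictMono e') (hlt : e (Fin.last a) < e' (Fin.last b)) (hdisj : ∀ i j, e i ≠ e' j)
      (hcover : ∀ x, (∃ i, e i = x) ∨ ∃ j, e' j = x),
      c = twoBlocks e e' he he' hlt hdisj hcover := by
  obtain ⟨len, size, pos, emb, mono, parts, disj, cover⟩ := c
  dsimp only at hc
  subst hc
  obtain ⟨a, b, rfl⟩ : ∃ a b : ℕ, size = fun
      | 0 => a + 1
      | 1 => b + 1 := by
    refine ⟨size 0 - 1, size 1 - 1, funext fun i => ?_⟩
    have h := pos i
    match i with
    | 0 => exact (Nat.sub_add_cancel h).symm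
    | 1 => exact (Nat.sub_add_cancel h).symm
  refine ⟨a, b, emb 0, emb 1, mono 0, mono 1, parts (show (0 : Fin 2) < 1 by decide), ?_, ?_, ?_⟩
  · intro i j
    exact Set.disjoint_iff_forall_ne.1
      (disj (Set.mem_univ 0) (Set.mem_univ 1) zero_ne_one) ⟨i, rfl⟩ ⟨j, rfl⟩
  · intro x
    obtain ⟨m, i, hi⟩ := cover x
    match m, i, hi with
    | 0, i, hi => exact Or.inl ⟨i, hi⟩
    | 1, i, hi => exact Or.inr ⟨i, hi⟩
  · have h_emb : emb = fun
        | 0 => emb 0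
        | 1 => emb 1 := funext fun i => match i with
      | 0 => rfl
      | 1 => rfl
    simp only [twoBlocks]
    congr

theorem strictMono_fin_one {X : Type*} [Preorder X] (f : Fin (0 + 1) → X) : StrictMono f :=
  @Subsingleton.strictMono (Fin 1) X _ _ _ f

/-- The partition of `{0, …, n + 1}` into `{0, …, n}` and `{n + 1}`. -/
def splitLast (n : ℕ) : OrderedFinpartition (n + 2) :=
  twoBlocks (a := n) (b := 0) (Fin.last (n + 1)).succAbove (fun _ => Fin.last (n + 1))
    (Fin.strictMono_succAbove _) (strictMono_fin_one _)
    (by rw [Fin.succAbove_last]; exact Fin.castSucc_lt_last _)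
    (fun i _ => Fin.succAbove_ne _ i)
    (fun x => by
      rcases eq_or_ne x (Fin.last (n + 1)) with rfl | hx
      · exact Or.inr ⟨0, rfl⟩
      · exact Or.inl (Fin.exists_succAbove_eq hx))

/-- The partition of `{0, …, n + 1}` into `{i}` and its complement, for `i ≠ n + 1`. -/
def splitOff {n : ℕ} (i : Fin (n + 2)) (hi : i ≠ Fin.last (n + 1)) : OrderedFinpartition (n + 2) :=
  twoBlocks (a := 0) (b := n) (fun _ => i) i.succAbove (strictMono_fin_one _)
    (Fin.strictMono_succAbove i)
    (by rw [Fin.succAbove_ne_last_last hi]; exact Fin.lt_last_iff_ne_last.2 hi)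
    (fun _ j => (Fin.succAbove_ne i j).symm)
    (fun x => by
      rcases eq_or_ne x i with rfl | hx
      · exact Or.inl ⟨0, rfl⟩
      · exact Or.inr (Fin.exists_succAbove_eq hx))

/-- The partition of `{0, …, n + 1}` into `{i}` and its complement, together with the index of the
complement among its blocks: the largest element `n + 1` lies in the last block. -/
def splitPair {n : ℕ} (i : Fin (n + 2)) : Σ c : OrderedFinpartition (n + 2), Fin c.length :=
  if hi : i = Fin.last (n + 1) then ⟨splitLast n, (0 : Fin 2)⟩ else ⟨splitOff i hi, (1 : Fin 2)⟩

theorem range_splitPair {n : ℕ} (i : Fin (n + 2)) :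
    Set.range ((splitPair i).1.emb (splitPair i).2) = {i}ᶜ := by
  by_cases hi : i = Fin.last (n + 1)
  · subst hi
    rw [splitPair, dif_pos rfl]
    exact Fin.range_succAbove _
  · rw [splitPair, dif_neg hi]
    exact Fin.range_succAbove i

theorem splitPair_injective {n : ℕ} :
    Function.Injective (splitPair (n := n)) := by
  intro i j h
  have h_range := congrArg (fun x : Σ c : OrderedFinpartition (n + 2), Fin c.length =>
    Set.range (x.1.emb x.2)) h
  simp only [range_splitPair] at h_range
  exact Set.singleton_injective (compl_injective h_range)

theorem eq_of_range_eq_compl_singleton {n a : ℕ} {e : Fin (a + 1) → Fin (n + 2)}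
    (he : Function.Injective e) {i : Fin (n + 2)} (h : Set.range e = {i}ᶜ) : a = n := by
  have hcard := congrArg Set.ncard h
  rw [Set.ncard_range_of_injective he, Set.ncard_compl, Set.ncard_singleton] at hcard
  simpa using hcard

theorem range_eq_compl_singleton {ι X : Type*} {e : ι → X} {i : X} (hne : ∀ j, e j ≠ i)
    (hcover : ∀ x, (∃ j, e j = x) ∨ i = x) : Set.range e = {i}ᶜ := by
  ext x
  refine ⟨?_, fun hx => (hcover x).resolve_right (Ne.symm hx)⟩
  rintro ⟨j, rfl⟩
  exact hne j

theorem twoBlocks_fst_mem_range_splitPair {n a : ℕ} (e : Fin (a + 1) → Fin (n + 2))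
    (e' : Fin (0 + 1) → Fin (n + 2)) (he : StrictMono e) (he' : StrictMono e')
    (hlt : e (Fin.last a) < e' (Fin.last 0)) (hdisj : ∀ i j, e i ≠ e' j)
    (hcover : ∀ x, (∃ i, e i = x) ∨ ∃ j, e' j = x) :
    (⟨twoBlocks e e' he he' hlt hdisj hcover, (0 : Fin 2)⟩ :
      Σ c : OrderedFinpartition (n + 2), Fin c.length) ∈ Set.range splitPair := by
  obtain ⟨i, rfl⟩ : ∃ i, e' = fun _ => i := ⟨e' 0, funext fun j => by rw [Fin.fin_one_eq_zero j]⟩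
  have h_range : Set.range e = {i}ᶜ := range_eq_compl_singleton (fun j => hdisj j 0)
    fun x => (hcover x).imp_right fun ⟨_, h⟩ => h
  obtain rfl := eq_of_range_eq_compl_singleton he.injective h_range
  obtain rfl := strictMono_eq_succAbove he fun j => hdisj j 0
  have hi : i = Fin.last (a + 1) := by
    by_contra hi
    rw [Fin.succAbove_ne_last_last hi] at hlt
    exact hlt.not_ge (Fin.le_last _)
  subst hi
  refine ⟨Fin.last _, ?_⟩
  rw [splitPair, dif_pos rfl]
  rfl

theorem twoBlocks_snd_mem_range_splitPair {n b : ℕ} (e : Fin (0 + 1) → Fin (n + 2))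
    (e' : Fin (b + 1) → Fin (n + 2)) (he : StrictMono e) (he' : StrictMono e')
    (hlt : e (Fin.last 0) < e' (Fin.last b)) (hdisj : ∀ i j, e i ≠ e' j)
    (hcover : ∀ x, (∃ i, e i = x) ∨ ∃ j, e' j = x) :
    (⟨twoBlocks e e' he he' hlt hdisj hcover, (1 : Fin 2)⟩ :
      Σ c : OrderedFinpartition (n + 2), Fin c.length) ∈ Set.range splitPair := by
  obtain ⟨i, rfl⟩ : ∃ i, e = fun _ => i := ⟨e 0, funext fun j => by rw [Fin.fin_one_eq_zero j]⟩
  have h_range : Set.range e' = {i}ᶜ := range_eq_compl_singleton (fun j => (hdisj 0 j).symm)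
    fun x => (hcover x).symm.imp_right fun ⟨_, h⟩ => h
  obtain rfl := eq_of_range_eq_compl_singleton he'.injective h_range
  obtain rfl := strictMono_eq_succAbove he' fun j => (hdisj 0 j).symm
  refine ⟨i, ?_⟩
  rw [splitPair, dif_neg (hlt.trans_le (Fin.le_last _)).ne]
  rfl

theorem mem_range_splitPair {n : ℕ} (c : OrderedFinpartition (n + 2)) (hc : c.length = 2)
    (m : Fin c.length) (hm : ∀ m', m' ≠ m → c.partSize m' = 1) :
    (⟨c, m⟩ : Σ c : OrderedFinpartition (n + 2), Fin c.length) ∈ Set.range splitPair := by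
  obtain ⟨a, b, e, e', he, he', hlt, hdisj, hcover, rfl⟩ := exists_eq_twoBlocks c hc
  change Fin 2 at m
  match m with
  | 0 =>
    obtain rfl : b = 0 := Nat.succ.inj (hm (1 : Fin 2) (show (1 : Fin 2) ≠ 0 by decide))
    exact twoBlocks_fst_mem_range_splitPair e e' he he' hlt hdisj hcover
  | 1 =>
    obtain rfl : a = 0 := Nat.succ.inj (hm (0 : Fin 2) (show (0 : Fin 2) ≠ 1 by decide))
    exact twoBlocks_snd_mem_range_splitPair e e' he he' hlt hdisj hcover

theorem partitionSign_splitLast {n : ℕ} (p : Fin (n + 2) → ZMod 2) :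
    partitionSign p (splitLast n) = 1 := by
  refine Finset.prod_eq_one fun i _ => Finset.prod_eq_one fun j _ => if_neg ?_
  rintro ⟨hij, h⟩
  obtain ⟨i, rfl⟩ := Fin.exists_succAbove_eq (hij.trans_le (Fin.le_last _)).ne
  have hi : (splitLast n).index ((Fin.last (n + 1)).succAbove i) = (0 : Fin 2) :=
    index_emb (splitLast n) (0 : Fin 2) i
  rw [hi] at h
  exact absurd h (Fin.not_lt_zero (n := 2) _)

theorem index_splitOff_self {n : ℕ} {i : Fin (n + 2)} (hi : i ≠ Fin.last (n + 1)) :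
    (splitOff i hi).index i = (0 : Fin 2) :=
  index_emb (splitOff i hi) (0 : Fin 2) (0 : Fin 1)

theorem index_splitOff_of_ne {n : ℕ} {i j : Fin (n + 2)} (hi : i ≠ Fin.last (n + 1))
    (hj : j ≠ i) : (splitOff i hi).index j = (1 : Fin 2) := by
  obtain ⟨j, rfl⟩ := Fin.exists_succAbove_eq hj
  exact index_emb (splitOff i hi) (1 : Fin 2) j

theorem index_splitOff_lt_iff {n : ℕ} {i : Fin (n + 2)} (hi : i ≠ Fin.last (n + 1))
    (a b : Fin (n + 2)) :
    (splitOff i hi).index b < (splitOff i hi).index a ↔ a ≠ i ∧ b = i := by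
  by_cases hb : b = i
  · subst hb
    by_cases ha : a = b
    · simp [ha]
    · rw [index_splitOff_self, index_splitOff_of_ne hi ha]
      exact iff_of_true (Fin.zero_lt_one : (0 : Fin 2) < 1) ⟨ha, rfl⟩
  · rw [index_splitOff_of_ne hi hb]
    refine iff_of_false (fun h => ?_) fun h => hb h.2
    exact h.not_ge (Fin.le_last (n := 1) _)

theorem partitionSign_splitOff {n : ℕ} (p : Fin (n + 2) → ZMod 2) (i : Fin (n + 2))
    (hi : i ≠ Fin.last (n + 1)) :
    partitionSign p (splitOff i hi) = sgn (p i * ∑ j ∈ Finset.Iio i, p j) := by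
  have h_inv : ∀ a b : Fin (n + 2),
      (a < b ∧ (splitOff i hi).index b < (splitOff i hi).index a) ↔ (a < i ∧ b = i) := by
    intro a b
    rw [index_splitOff_lt_iff]
    constructor
    · rintro ⟨hab, -, rfl⟩
      exact ⟨hab, rfl⟩
    · rintro ⟨hab, rfl⟩
      exact ⟨hab, hab.ne, rfl⟩
  simp only [partitionSign, h_inv]
  rw [Finset.mul_sum, sgn_sum, ← Finset.filter_gt_eq_Iio, Finset.prod_filter]
  refine Finset.prod_congr rfl fun a _ => ?_
  by_cases ha : a < i
  · simp [ha, mul_comm]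
  · simp [ha]

theorem partitionSign_atomic {N : ℕ} (p : Fin N → ZMod 2) :
    partitionSign p (OrderedFinpartition.atomic N) = 1 := by
  refine Finset.prod_eq_one fun i _ => Finset.prod_eq_one fun j _ => if_neg ?_
  rintro ⟨hij, h⟩
  have h_index : ∀ i : Fin N, (OrderedFinpartition.atomic N).index i = i :=
    fun i => index_emb (OrderedFinpartition.atomic N) i (0 : Fin 1)
  rw [h_index, h_index] at h
  exact hij.not_gt h

theorem eq_atomic {N : ℕ} (c : OrderedFinpartition N) (hc : ∀ m, c.partSize m = 1) :
    c = OrderedFinpartition.atomic N := by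
  have hlen : c.length = N := by
    simpa [hc] using c.sum_sigma_eq_sum (fun _ : Fin N => (1 : ℕ))
  obtain ⟨len, size, pos, emb, mono, parts, disj, cover⟩ := c
  dsimp only at hlen hc
  subst hlen
  obtain rfl : size = fun _ => 1 := funext hc
  have h_zero : (fun m => emb m 0) = id := by
    refine (StrictMono.range_inj (fun i j hij => parts hij) strictMono_id).1 ?_
    rw [Set.range_id, Set.eq_univ_iff_forall]
    intro x
    obtain ⟨m, r, hr⟩ := cover x
    exact ⟨m, by rw [← hr, Fin.fin_one_eq_zero r]; rfl⟩
  obtain rfl : emb = fun m _ => m := by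
    funext m r
    rw [Fin.fin_one_eq_zero r]
    exact congrFun h_zero m
  rfl

section Composites

theorem sum_eq_Iio_add_Ioi {X : Type*} [AddCommMonoid X] {n : ℕ} (f : Fin n → X) (i : Fin n) :
    ∑ j, f j = f i + (∑ j ∈ Finset.Iio i, f j + ∑ j ∈ Finset.Ioi i, f j) := by
  rw [← Finset.filter_gt_eq_Iio, ← Finset.filter_lt_eq_Ioi, Finset.sum_filter, Finset.sum_filter,
    ← Finset.sum_add_distrib]
  have h_diag : f i = ∑ j, if j = i then f j else 0 := by simp
  rw [h_diag, ← Finset.sum_add_distrib]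
  refine Finset.sum_congr rfl fun j _ => ?_
  rcases lt_trichotomy j i with hj | rfl | hj
  · simp [hj, hj.ne, hj.not_gt]
  · simp
  · simp [hj, hj.ne', hj.not_gt]

variable {k V U : Type*} [Field k] [AddCommGroup V] [Module k V] [AddCommGroup U] [Module k U]

/-! ### The identity of the symmetric coalgebra and composites with it -/

/-- The components of the identity of the symmetric coalgebra of `U`: the identity of `U` in degree
`1`, and `0` in the other degrees. -/
def idFam (k U : Type*) [Field k] [AddCommGroup U] [Module k U] : ∀ n, Multi k n U U
  | 1 => MultilinearMap.ofSubsingleton k U U (0 : Fin 1) LinearMap.id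
  | _ => 0

theorem idFam_one (w : Fin 1 → U) : idFam k U 1 w = w 0 := rfl

theorem idFam_of_ne {n : ℕ} (hn : n ≠ 1) : idFam k U n = 0 := by
  match n, hn with
  | 0, _ => rfl
  | n + 2, _ => rfl

theorem morComp_add_left (d d' f : ∀ n, Multi k n U U) {N : ℕ} (p : Fin N → ZMod 2)
    (w : Fin N → U) :
    morComp (fun n => d n + d' n) f p w = morComp d f p w + morComp d' f p w := by
  simp only [morComp, add_apply, smul_add, Finset.sum_add_distrib]

theorem symComp_add_left (f f' d : ∀ n, Multi k n U U) {N : ℕ} (p : Fin N → ZMod 2)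
    (w : Fin N → U) :
    symComp (fun n => f n + f' n) d p w = symComp f d p w + symComp f' d p w := by
  simp only [symComp, insertMap_add_left, add_apply, smul_add, Finset.sum_add_distrib]

theorem morComp_idFam (d : ∀ n, Multi k n U U) {N : ℕ} (p : Fin N → ZMod 2) (w : Fin N → U) :
    morComp d (idFam k U) p w = d N w := by
  rw [morComp, Finset.sum_eq_single (OrderedFinpartition.atomic N)]
  · rw [partitionSign_atomic, one_smul]
    rfl
  · intro c _ hc
    obtain ⟨m, hm⟩ : ∃ m, c.partSize m ≠ 1 := by
      by_contra! h
      exact hc (eq_atomic c h)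
    rw [(d c.length).map_coord_zero m (by rw [idFam_of_ne hm, zero_apply]), smul_zero]
  · intro h
    exact absurd (Finset.mem_univ _) h

theorem unshuffles_self (n : ℕ) : unshuffles n n = {1} := by
  ext σ
  rw [mem_unshuffles, Finset.mem_singleton]
  constructor
  · intro h
    have hmono : StrictMono σ := fun i j hij => h i j hij (Or.inl j.2)
    exact DFunLike.coe_injective <|
      (hmono.range_inj strictMono_id).1 (by simp [σ.surjective.range_eq])
  · rintro rfl i j hij _
    exact hij

theorem symComp_idFam (d : ∀ n, Multi k n U U) {N : ℕ} (p : Fin N → ZMod 2) (w : Fin N → U) :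
    symComp (idFam k U) d p w = d N w := by
  have insertMap_idFam : ∀ (a : ℕ) (h : N + a = N), a = 0 → ∀ v : Fin N → U,
      insertMap h (idFam k U (a + 1)) (d N) v = d N v := by
    rintro a h rfl v
    rw [insertMap_apply]
    rfl
  rw [symComp, Finset.sum_eq_single (Fin.last N)]
  · change ∑ σ ∈ unshuffles N N, _ = _
    rw [unshuffles_self, Finset.sum_singleton, koszul_refl, one_smul]
    exact insertMap_idFam (N - N) (by omega) (by omega) w
  · intro b _ hb
    have hb : (b : ℕ) ≠ N := fun h => hb (Fin.ext h)
    refine Finset.sum_eq_zero fun σ _ => ?_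
    rw [idFam_of_ne (by omega)]
    exact smul_zero _
  · intro h
    exact absurd (Finset.mem_univ _) h

variable {𝒱 : ZMod 2 → Submodule k V}

theorem koszul_swap (p : Fin 2 → ZMod 2) : koszul p (Equiv.swap 0 1) = sgn (p 0 * p 1) := by
  simp [koszul, Fin.prod_univ_two, mul_comm]

theorem IsGradedSymm.pair_comm {φ : Multi k 2 V U} (hφ : IsGradedSymm 𝒱 φ) {i j : ZMod 2}
    {x y : V} (hx : x ∈ 𝒱 i) (hy : y ∈ 𝒱 j) : φ ![x, y] = sgn (i * j) • φ ![y, x] := by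
  have h := hφ (Equiv.swap 0 1) ![i, j] ![x, y] (by intro m; fin_cases m <;> assumption)
  rw [koszul_swap, eq_pair fun m => ![x, y] (Equiv.swap 0 1 m)] at h
  simpa using h

/-- The linear part in `g` of the composite of `d` with the endomorphism of the symmetric coalgebra
that has components `id + g`: in each summand of `morComp`, the components on all blocks but one are
those of the identity, and the remaining one belongs to `g`. -/
def morCompLinear (d g : ∀ n, Multi k n U U) {N : ℕ} (p : Fin N → ZMod 2) (w : Fin N → U) : U :=
  ∑ x : Σ c : OrderedFinpartition N, Fin c.length, partitionSign p x.1 •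
    d x.1.length (Function.update
      (fun m => idFam k U (x.1.partSize m) fun j => w (x.1.emb m j)) x.2
      (g (x.1.partSize x.2) fun j => w (x.1.emb x.2 j)))

theorem morComp_idFam_add {d g : ∀ n, Multi k n U U} {N : ℕ} (p : Fin N → ZMod 2) (w : Fin N → U)
    (hdg : ∀ (c : OrderedFinpartition N) (I : Fin c.length → U),
      d c.length (fun m => I m + g (c.partSize m) fun j => w (c.emb m j)) =
        d c.length I +
          ∑ m, d c.length (Function.update I m (g (c.partSize m) fun j => w (c.emb m j)))) :
    morComp d (fun n => idFam k U n + g n) p w = d N w + morCompLinear d g p w := by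
  rw [← morComp_idFam d p w, morCompLinear, Fintype.sum_sigma, morComp, morComp,
    ← Finset.sum_add_distrib]
  refine Finset.sum_congr rfl fun c _ => ?_
  dsimp only
  rw [← Finset.smul_sum, ← smul_add]
  exact congrArg _ (hdg c _)

section Bilinear

variable {d g : ∀ n, Multi k n U U}

theorem morCompLinear_of_lt_two (hd : ∀ n, n ≠ 2 → d n = 0) {N : ℕ} (hN : N < 2)
    (p : Fin N → ZMod 2) (w : Fin N → U) : morCompLinear d g p w = 0 := by
  refine Finset.sum_eq_zero fun x _ => ?_
  rw [hd _ (x.1.length_le.trans_lt hN).ne, zero_apply, smul_zero]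

theorem morCompLinear_eq_sum_splitPair (hd : ∀ n, n ≠ 2 → d n = 0) {n : ℕ}
    (p : Fin (n + 2) → ZMod 2) (w : Fin (n + 2) → U) :
    morCompLinear d g p w = ∑ i : Fin (n + 2), partitionSign p (splitPair i).1 •
      d (splitPair i).1.length (Function.update
        (fun m => idFam k U ((splitPair i).1.partSize m) fun j => w ((splitPair i).1.emb m j))
        (splitPair i).2
        (g ((splitPair i).1.partSize (splitPair i).2)
          fun j => w ((splitPair i).1.emb (splitPair i).2 j))) := by
  refine (Fintype.sum_of_injective splitPair splitPair_injective _ _ ?_ fun _ => rfl).symm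
  rintro ⟨c, m⟩ hc
  dsimp only
  by_cases hlen : c.length = 2
  · obtain ⟨m', hm', hsize⟩ : ∃ m', m' ≠ m ∧ c.partSize m' ≠ 1 := by
      by_contra! hm
      exact hc (mem_range_splitPair c hlen m hm)
    rw [MultilinearMap.map_coord_zero _ m', smul_zero]
    rw [Function.update_of_ne hm', idFam_of_ne hsize, zero_apply]
  · rw [hd _ hlen, zero_apply, smul_zero]

theorem morCompLinear_of_bilinear {𝒰 : ZMod 2 → Submodule k U} (hd : ∀ n, n ≠ 2 → d n = 0)
    (hsymm : IsGradedSymm 𝒰 (d 2)) {n : ℕ} (hg : HasParity 𝒰 𝒰 0 (g (n + 1)))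
    {p : Fin (n + 2) → ZMod 2} {w : Fin (n + 2) → U} (hw : Homog 𝒰 p w) :
    morCompLinear d g p w = ∑ i : Fin (n + 2), koszul p (skipPerm i) •
      d 2 ![g (n + 1) fun j => w (i.succAbove j), w i] := by
  rw [morCompLinear_eq_sum_splitPair hd]
  refine Finset.sum_congr rfl fun i _ => ?_
  rw [koszul_skipPerm]
  by_cases hi : i = Fin.last (n + 1)
  · subst hi
    rw [splitPair, dif_pos rfl]
    dsimp only
    rw [partitionSign_splitLast, ← Fin.top_eq_last, Finset.Ioi_top, Finset.sum_empty, mul_zero,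
      sgn_zero]
    congr 2
    exact eq_pair _
  · rw [splitPair, dif_neg hi]
    dsimp only
    have h_parity : ∑ j ∈ Finset.Ioi i, p j + ∑ j, p (i.succAbove j) =
        ∑ j ∈ Finset.Iio i, p j := by
      have h := sum_eq_Iio_add_Ioi p i
      rw [Fin.sum_univ_succAbove _ i, add_right_inj] at h
      rw [h, add_left_comm, CharTwo.add_self_eq_zero, add_zero]
    have h_mem := hg _ _ (hw.comp i.succAbove)
    rw [zero_add] at h_mem
    rw [partitionSign_splitOff, hsymm.pair_comm h_mem (hw i), smul_smul, ← sgn_add,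
      mul_comm (∑ j, _) (p i), ← mul_add, h_parity]
    congr 2
    exact eq_pair _

theorem eq_add_sum_update_of_eq_zero (φ : Multi k 2 V U) (I S : Fin 2 → V) (hS : φ S = 0) :
    φ (fun m => I m + S m) = φ I + ∑ m, φ (Function.update I m (S m)) := by
  rw [eq_pair S] at hS
  rw [eq_pair fun m => I m + S m, Fin.sum_univ_two, eq_pair (Function.update I 0 (S 0)),
    eq_pair (Function.update I 1 (S 1)), pair_add_left, pair_add_right, pair_add_right, hS,
    eq_pair I]
  simp only [Matrix.cons_val_zero, Matrix.cons_val_one, Function.update_self, ne_eq, one_ne_zero,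
    zero_ne_one, not_false_eq_true, Function.update_of_ne, add_zero]
  abel

end Bilinear

/-! ### Composites with the automorphisms `id + t φ` -/

variable [DirectSum.Decomposition 𝒱] {l : Multi k 2 V V} {p : ZMod 2}

/-- The components of the coalgebra endomorphism `id + t φ` of `⊙(ΠV[t])`, where the maps `φ n` on
`V` are transported to `ΠV`. -/
def equivMap (𝒱 : ZMod 2 → Submodule k V) [DirectSum.Decomposition 𝒱] (φ : ∀ n, Multi k n V V)
    (n : ℕ) : Multi k n (V × V) (V × V) :=
  idFam k (V × V) n + tPart (suspend 𝒱 (φ n))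

theorem morComp_tPart (ψ φ : ∀ n, Multi k n V V) {N : ℕ} (r : Fin N → ZMod 2)
    (z : Fin N → V × V) :
    morComp (fun n => tPart (ψ n)) (equivMap 𝒱 φ) r z = tPart (ψ N) z := by
  rw [← morComp_idFam (fun n => tPart (ψ n)) r z]
  refine Finset.sum_congr rfl fun c _ => ?_
  simp only [tPart_apply, equivMap, add_apply, Prod.fst_add, add_zero]

theorem suspend_extBracket_eq_zero {z : Fin 2 → V × V} (hz : ∀ i, (z i).1 = 0) :
    suspend (extGrading 𝒱 p) (extBracket 𝒱 p l) z = 0 := by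
  rw [suspend, MultilinearMap.compLinearMap_apply]
  refine (congrArg (extBracket 𝒱 p l) (eq_pair _)).trans ?_
  rw [extBracket_apply]
  simp only [parityInvolution_pow_extGrading_fst, hz, map_zero, pair_zero_left, pair_zero_right,
    add_zero, Prod.mk_zero_zero]

theorem suspend_ofBracket_extBracket_add {n : ℕ} (I S : Fin n → V × V) (hS : ∀ m, (S m).1 = 0) :
    suspend (extGrading 𝒱 p) (ofBracket (extBracket 𝒱 p l) n) (fun m => I m + S m) =
      suspend (extGrading 𝒱 p) (ofBracket (extBracket 𝒱 p l) n) I +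
        ∑ m, suspend (extGrading 𝒱 p) (ofBracket (extBracket 𝒱 p l) n)
          (Function.update I m (S m)) := by
  rcases eq_or_ne n 2 with rfl | hn
  · exact eq_add_sum_update_of_eq_zero _ I S (suspend_extBracket_eq_zero hS)
  · simp only [ofBracket_of_ne hn, suspend_zero, zero_apply, Finset.sum_const_zero, add_zero]

theorem totalComp_ofBracket_extBracket_tPart (s : ℕ → ZMod 2) (φ : ∀ n, Multi k n V V) (N : ℕ) :
    totalComp (extGrading 𝒱 p) s (ofBracket (extBracket 𝒱 p l)) (fun n => tPart (φ n)) N =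
      tPart (totalComp 𝒱 s (ofBracket l) φ N) := by
  cases N with
  | zero => rw [totalComp_ofBracket_left_zero, totalComp_ofBracket_left_zero, tPart_zero]
  | succ b =>
    rw [totalComp_ofBracket_left, totalComp_ofBracket_left, extComp_extBracket_tPart,
      tPart_units_smul]

theorem morCompLinear_ofBracket (hl : IsLieBracket 𝒱 l) {φ : ∀ n, Multi k n V V} (hφ₀ : φ 0 = 0)
    (hφ : ∀ n : ℕ, HasParity 𝒱 𝒱 (p + (n + 1)) (φ n)) {N : ℕ} {r : Fin N → ZMod 2}
    {z : Fin N → V × V} (hz : Homog (extGrading 𝒱 p) r z) :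
    morCompLinear (fun n => suspend (extGrading 𝒱 p) (ofBracket (extBracket 𝒱 p l) n))
        (fun n => tPart (suspend 𝒱 (φ n))) (fun i => r i + 1) z =
      suspSign r • tPart (totalComp 𝒱 (fun n => n + 1) (ofBracket l) φ N) z := by
  have h_bilinear : ∀ n, n ≠ 2 →
      suspend (extGrading 𝒱 p) (ofBracket (extBracket 𝒱 p l) n) = 0 := fun n hn => by
    rw [ofBracket_of_ne hn, suspend_zero]
  match N with
  | 0 =>
    rw [morCompLinear_of_lt_two h_bilinear zero_lt_two, totalComp_ofBracket_left_zero, tPart_zero,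
      zero_apply, smul_zero]
  | 1 =>
    rw [morCompLinear_of_lt_two h_bilinear one_lt_two, totalComp_ofBracket_left _ _ _ _ 0, hφ₀,
      extComp_zero_right, smul_zero, tPart_zero, zero_apply, smul_zero]
  | n + 2 =>
    have h_parity : HasParity (extGrading 𝒱 p) (extGrading 𝒱 p) (((n + 1 : ℕ) : ZMod 2) + 1)
        (tPart (φ (n + 1))) := hasParity_tPart_iff.2 (hφ (n + 1))
    have h_even : HasParity (parityReversion (extGrading 𝒱 p)) (parityReversion (extGrading 𝒱 p)) 0
        (tPart (suspend 𝒱 (φ (n + 1)))) := by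
      rw [← suspend_tPart 𝒱 p, hasParity_parityReversion_iff, hasParity_suspend_iff, zero_add]
      exact h_parity
    have h_sum := sum_unshuffles_suspend (extGrading 𝒱 p) (a := 1) (b := n + 1) rfl
      (extBracket 𝒱 p l) h_parity hz
    rw [sum_unshuffles_last, Nat.cast_one, one_mul, suspend_tPart, mul_comm, mul_smul] at h_sum
    rw [← totalComp_ofBracket_extBracket_tPart, totalComp_ofBracket_left _ _ _ _ (n + 1),
      smul_apply, ← h_sum, morCompLinear_of_bilinear h_bilinear
        ((isGradedSymm_suspend_iff (extGrading 𝒱 p)).2 (hl.extBracket p).isGradedAlt) h_even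
        fun i => mem_parityReversion_add_one.2 (hz i)]
    simp only [insertMap_pair, skipPerm_last, skipPerm_castSucc]
    rfl

theorem morComp_deformOp_equivMap (hl : IsLieBracket 𝒱 l) {φ : ∀ n, Multi k n V V}
    (hφ₀ : φ 0 = 0) (hφ : ∀ n : ℕ, HasParity 𝒱 𝒱 (p + (n + 1)) (φ n)) (lam : ∀ n, Multi k n V V)
    {N : ℕ} {r : Fin N → ZMod 2} {z : Fin N → V × V} (hz : Homog (extGrading 𝒱 p) r z) :
    morComp (fun n => suspend (extGrading 𝒱 p) (deformOp 𝒱 l p lam n)) (equivMap 𝒱 φ)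
        (fun i => r i + 1) z =
      suspSign r • (ofBracket (extBracket 𝒱 p l) N z +
        tPart (lam N + totalComp 𝒱 (fun n => n + 1) (ofBracket l) φ N) z) := by
  have h_suspend : (fun n => suspend (extGrading 𝒱 p) (deformOp 𝒱 l p lam n)) = fun n =>
      suspend (extGrading 𝒱 p) (ofBracket (extBracket 𝒱 p l) n) + tPart (suspend 𝒱 (lam n)) := by
    funext n
    rw [deformOp, suspend_add, suspend_tPart]
  have h_bracket :
      morComp (fun n => suspend (extGrading 𝒱 p) (ofBracket (extBracket 𝒱 p l) n)) (equivMap 𝒱 φ)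
          (fun i => r i + 1) z = _ :=
    morComp_idFam_add _ _ fun c I => suspend_ofBracket_extBracket_add I _ fun _ => rfl
  rw [h_suspend, morComp_add_left, h_bracket, morCompLinear_ofBracket hl hφ₀ hφ hz, morComp_tPart,
    ← suspend_tPart 𝒱 p, suspend_apply_homog _ _ hz, suspend_apply_homog _ _ hz, tPart_add,
    add_apply, smul_add, smul_add, add_assoc, add_comm (_ • tPart (totalComp _ _ _ _ _) z)]

theorem symComp_equivMap_deformOp (hl : IsLieBracket 𝒱 l) (φ : ∀ n, Multi k n V V)
    {lam : ∀ n, Multi k n V V} (hlam : ∀ n : ℕ, HasParity 𝒱 𝒱 (p + n) (lam n))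
    {N : ℕ} {r : Fin N → ZMod 2} {z : Fin N → V × V} (hz : Homog (extGrading 𝒱 p) r z) :
    symComp (equivMap 𝒱 φ) (fun n => suspend (extGrading 𝒱 p) (deformOp 𝒱 l p lam n))
        (fun i => r i + 1) z =
      suspSign r • (ofBracket (extBracket 𝒱 p l) N z +
        tPart (lam N + totalComp 𝒱 (fun n => n) φ (ofBracket l) N) z) := by
  have h_parity : ∀ n : ℕ, HasParity (extGrading 𝒱 p) (extGrading 𝒱 p) n (deformOp 𝒱 l p lam n) :=
    fun n => (hasParity_ofBracket (hl.extBracket p) n).add (hasParity_tPart_iff.2 (hlam n))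
  have h_equivMap : equivMap 𝒱 φ = fun n =>
      idFam k (V × V) n + suspend (extGrading 𝒱 p) (tPart (φ n)) :=
    funext fun n => by rw [equivMap, suspend_tPart]
  rw [h_equivMap, symComp_add_left, symComp_idFam, symComp_suspend _ _ h_parity hz,
    suspend_apply_homog _ _ hz, totalComp_tPart_left 𝒱 p _ φ (deformOp_fst lam), ← smul_add,
    deformOp, tPart_add, add_apply, add_apply, add_assoc]

theorem totalComp_sub_totalComp_eq_lieDifferential (φ : ∀ n, Multi k n V V) (a : ℕ) :
    totalComp 𝒱 (fun n => n) φ (ofBracket l) (a + 2) -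
        totalComp 𝒱 (fun n => n + 1) (ofBracket l) φ (a + 2) =
      lieDifferential 𝒱 l a (φ (a + 1)) := by
  have h_sign : ((a + 1 : ℕ) : ZMod 2) + 1 = a := by
    rw [Nat.cast_add, Nat.cast_one, add_assoc, CharTwo.add_self_eq_zero, add_zero]
  rw [totalComp_ofBracket_right, totalComp_ofBracket_left _ _ _ _ (a + 1), h_sign, Nat.cast_ofNat,
    CharTwo.two_eq_zero (R := ZMod 2), mul_zero, sgn_zero, one_smul]
  rfl

theorem symComp_eq_morComp_iff (hl : IsLieBracket 𝒱 l) {φ lam lam' : ∀ n, Multi k n V V}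
    (hφ₀ : φ 0 = 0) (hφ : ∀ n : ℕ, HasParity 𝒱 𝒱 (p + (n + 1)) (φ n))
    (hlam : ∀ n : ℕ, HasParity 𝒱 𝒱 (p + n) (lam n)) (N : ℕ) :
    (∀ (r : Fin N → ZMod 2) w, Homog (parityReversion (extGrading 𝒱 p)) r w →
      symComp (equivMap 𝒱 φ) (fun n => suspend (extGrading 𝒱 p) (deformOp 𝒱 l p lam n)) r w =
        morComp (fun n => suspend (extGrading 𝒱 p) (deformOp 𝒱 l p lam' n)) (equivMap 𝒱 φ) r w) ↔
    lam N + totalComp 𝒱 (fun n => n) φ (ofBracket l) N =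
      lam' N + totalComp 𝒱 (fun n => n + 1) (ofBracket l) φ N := by
  rw [forall_homog_parityReversion, ← tPart_injective.eq_iff]
  have h_iff (r : Fin N → ZMod 2) (z : Fin N → V × V) (hz : Homog (extGrading 𝒱 p) r z) :
      symComp (equivMap 𝒱 φ) (fun n => suspend (extGrading 𝒱 p) (deformOp 𝒱 l p lam n))
          (fun i => r i + 1) z =
        morComp (fun n => suspend (extGrading 𝒱 p) (deformOp 𝒱 l p lam' n)) (equivMap 𝒱 φ)
          (fun i => r i + 1) z ↔
      tPart (lam N + totalComp 𝒱 (fun n => n) φ (ofBracket l) N) z =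
        tPart (lam' N + totalComp 𝒱 (fun n => n + 1) (ofBracket l) φ N) z := by
    rw [symComp_equivMap_deformOp hl φ hlam hz, morComp_deformOp_equivMap hl hφ₀ hφ lam' hz,
      smul_left_cancel_iff, add_right_inj]
  exact ⟨fun h => Multi.ext_homog (extGrading 𝒱 p) fun r z hz => (h_iff r z hz).1 (h r z hz),
    fun h r z hz => (h_iff r z hz).2 (by rw [h])⟩

theorem intertwines_iff (hl : IsLieBracket 𝒱 l) {φ lam lam' : ∀ n, Multi k n V V} (hφ₀ : φ 0 = 0)
    (hφ : ∀ n : ℕ, HasParity 𝒱 𝒱 (p + (n + 1)) (φ n))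
    (hlam : ∀ n : ℕ, HasParity 𝒱 𝒱 (p + n) (lam n)) (hz : lam 0 = 0) (hz' : lam' 0 = 0) :
    (∀ N (r : Fin N → ZMod 2) w, Homog (parityReversion (extGrading 𝒱 p)) r w →
      symComp (equivMap 𝒱 φ) (fun n => suspend (extGrading 𝒱 p) (deformOp 𝒱 l p lam n)) r w =
        morComp (fun n => suspend (extGrading 𝒱 p) (deformOp 𝒱 l p lam' n)) (equivMap 𝒱 φ) r w) ↔
    lam' 1 = lam 1 ∧ ∀ a, lam' (a + 2) - lam (a + 2) = lieDifferential 𝒱 l a (φ (a + 1)) := by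
  simp only [symComp_eq_morComp_iff hl hφ₀ hφ hlam]
  have degree_zero : lam 0 + totalComp 𝒱 (fun n => n) φ (ofBracket l) 0 =
      lam' 0 + totalComp 𝒱 (fun n => n + 1) (ofBracket l) φ 0 := by
    rw [totalComp_of_zero 𝒱 _ _ rfl, totalComp_ofBracket_left_zero, hz, hz']
  have degree_one : lam 1 + totalComp 𝒱 (fun n => n) φ (ofBracket l) 1 =
      lam' 1 + totalComp 𝒱 (fun n => n + 1) (ofBracket l) φ 1 ↔ lam' 1 = lam 1 := by
    rw [totalComp_ofBracket_right_of_lt _ _ _ _ one_lt_two, totalComp_ofBracket_left _ _ _ _ 0, hφ₀,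
      extComp_zero_right, smul_zero, add_zero, add_zero, eq_comm]
  have degree_add_two (a : ℕ) : lam (a + 2) + totalComp 𝒱 (fun n => n) φ (ofBracket l) (a + 2) =
        lam' (a + 2) + totalComp 𝒱 (fun n => n + 1) (ofBracket l) φ (a + 2) ↔
      lam' (a + 2) - lam (a + 2) = lieDifferential 𝒱 l a (φ (a + 1)) := by
    rw [← totalComp_sub_totalComp_eq_lieDifferential, sub_eq_sub_iff_add_eq_add, eq_comm,
      add_comm (totalComp _ _ _ _ _)]
  constructor
  · exact fun h => ⟨degree_one.1 (h 1), fun a => (degree_add_two a).1 (h (a + 2))⟩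
  · rintro ⟨h_one, h_add_two⟩ N
    match N with
    | 0 => exact degree_zero
    | 1 => exact degree_one.2 h_one
    | a + 2 => exact (degree_add_two a).2 (h_add_two a)

end Composites

section Rotations

variable {k V M : Type*} [Field k] [AddCommGroup V] [Module k V] [AddCommGroup M] [Module k M]

theorem koszul_skipPerm_zero {n : ℕ} (p : Fin (n + 1) → ZMod 2) :
    koszul p (skipPerm 0) = sgn (p 0 * ∑ i : Fin n, p i.succ) := by
  have h_sum := sum_eq_Iio_add_Ioi p 0
  rw [show Finset.Iio (0 : Fin (n + 1)) = ∅ from Finset.Iio_bot, Finset.sum_empty, zero_add,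
    Fin.sum_univ_succ, add_right_inj] at h_sum
  rw [koszul_skipPerm, ← h_sum]

theorem cons_skipPerm_zero {X : Type*} {N : ℕ} (x : X) (w : Fin N → X) :
    (fun i => (Fin.cons x w : Fin (N + 1) → X) (skipPerm 0 i)) =
      (Fin.snoc (α := fun _ => X) w x) := by
  funext i
  induction i using Fin.lastCases with
  | last => simp
  | cast i => simp

theorem IsGradedAlt.cons_eq_snoc {𝒱 : ZMod 2 → Submodule k V} {N : ℕ} {φ : Multi k (N + 1) V M}
    (hφ : IsGradedAlt 𝒱 φ) {P : Fin N → ZMod 2} {w : Fin N → V} (hw : Homog 𝒱 P w)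
    {a : ZMod 2} {x : V} (hx : x ∈ 𝒱 a) :
    φ (Fin.cons x w) = sgn (N + a * ∑ i, P i) • φ (Fin.snoc (α := fun _ => V) w x) := by
  have h_skip := hφ (skipPerm 0) _ _ (hw.cons hx)
  rw [cons_skipPerm_zero, sign_skipPerm, koszul_skipPerm_zero, Fin.cons_zero, ← sgn_add] at h_skip
  simpa only [Fin.cons_succ, Fin.val_zero, Nat.sub_zero] using h_skip

theorem suspSign_snoc {N : ℕ} (P : Fin N → ZMod 2) (a b : ZMod 2) :
    suspSign (Fin.snoc (α := fun _ => ZMod 2) P a) =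
      suspSign (Fin.snoc (α := fun _ => ZMod 2) P b) := by
  simp [suspSign, Fin.sum_univ_castSucc]

theorem cons_snoc_castSucc {X : Type*} {N : ℕ} (x y : X) (w : Fin N → X) :
    (fun i : Fin (N + 1) => (Fin.cons x (Fin.snoc (α := fun _ => X) w y) : Fin (N + 2) → X)
      i.castSucc) = Fin.cons x w := by
  funext i
  induction i using Fin.cases with
  | zero => rfl
  | succ i => simp

theorem eq_cons_snoc {X : Type*} {N : ℕ} (v : Fin (N + 2) → X) :
    v = Fin.cons (v 0) (Fin.snoc (α := fun _ => X) (fun j : Fin N => v j.castSucc.succ)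
      (v (Fin.last (N + 1)))) := by
  rw [← Fin.succ_last]
  exact (Fin.cons_self_tail v).symm.trans (congrArg _ (Fin.snoc_init_self (Fin.tail v)).symm)

theorem isCyclic_iff_cons_snoc {𝒱 : ZMod 2 → Submodule k V} {B : V →ₗ[k] V →ₗ[k] M} {q : ZMod 2}
    {N : ℕ} {φ : Multi k (N + 1) V V} :
    IsCyclic 𝒱 B q φ ↔ ∀ (P : Fin N → ZMod 2) (w : Fin N → V) (a b : ZMod 2) (x y : V),
      Homog 𝒱 P w → x ∈ 𝒱 a → y ∈ 𝒱 b → B (φ (Fin.cons x w)) y =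
        sgn ((N + 1 : ℕ) + a * q) • B x (φ (Fin.snoc (α := fun _ => V) w y)) := by
  constructor
  · intro h P w a b x y hw hx hy
    have h_cyclic := h _ _ ((hw.snoc hy).cons hx)
    rw [cons_snoc_castSucc, ← Fin.succ_last] at h_cyclic
    simpa using h_cyclic
  · intro h P v hv
    have h_cyclic := h (fun j => P j.castSucc.succ) (fun j => v j.castSucc.succ) _ _ _ _
      (fun j => hv _) (hv 0) (hv (Fin.last (N + 1)))
    rw [eq_cons_snoc v, cons_snoc_castSucc]
    simpa [← Fin.succ_last] using h_cyclic

end Rotations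

section Isometries

variable {k V M U : Type*} [Field k] [AddCommGroup V] [Module k V] [AddCommGroup M] [Module k M]
  [AddCommGroup U] [Module k U]

/-! ### Isometries -/

theorem evalSubset_univ (f : ∀ n, Multi k n U U) {N : ℕ} (w : Fin N → U) (x : U) :
    evalSubset f w Finset.univ x = f (N + 1) (Fin.snoc (α := fun _ => U) w x) := by
  have apply_snoc_cast : ∀ (m : ℕ) (g : Fin m → U) (h : m = N), (∀ j, g j = w (Fin.cast h j)) →
      f (m + 1) (Fin.snoc (α := fun _ => U) g x) =
        f (N + 1) (Fin.snoc (α := fun _ => U) w x) := by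
    rintro m g rfl hg
    obtain rfl : g = w := funext hg
    rfl
  refine apply_snoc_cast _ _ (Finset.card_fin N) fun j => congrArg w ?_
  have h_emb := Finset.orderEmbOfFin_unique (s := (Finset.univ : Finset (Fin N))) rfl
    (f := Fin.cast (Finset.card_fin N)) (fun _ => Finset.mem_univ _) (fun _ _ h => h)
  exact (congrFun h_emb j).symm

theorem evalSubset_idFam_empty {N : ℕ} (w : Fin N → U) (x : U) :
    evalSubset (idFam k U) w ∅ x = x := rfl

theorem evalSubset_idFam_of_ne {N : ℕ} (w : Fin N → U) (x : U) {I : Finset (Fin N)} (hI : I ≠ ∅) :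
    evalSubset (idFam k U) w I x = 0 := by
  rw [evalSubset, idFam_of_ne (by simpa using hI)]
  rfl

theorem subsetSign_univ {N : ℕ} (p : Fin N → ZMod 2) (a : ZMod 2) :
    subsetSign p a Finset.univ = 1 := by
  simp [subsetSign]

theorem subsetSign_empty {N : ℕ} (p : Fin N → ZMod 2) (a : ZMod 2) :
    subsetSign p a ∅ = sgn (a * ∑ j, p j) := by
  simp [subsetSign]

section SubsetSums

variable (β : U →ₗ[k] U →ₗ[k] M) (T : ∀ n, Multi k n U U) {N : ℕ} (r : Fin N → ZMod 2)
  (w : Fin N → U) (a : ZMod 2) (x y : U)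

theorem sum_subsetSign_idFam_right :
    ∑ I : Finset (Fin N), subsetSign r a I •
        β (evalSubset T w I x) (evalSubset (idFam k U) w Iᶜ y) =
      β (T (N + 1) (Fin.snoc (α := fun _ => U) w x)) y := by
  rw [Finset.sum_eq_single Finset.univ]
  · rw [subsetSign_univ, one_smul, evalSubset_univ, Finset.compl_univ, evalSubset_idFam_empty]
  · intro I _ hI
    rw [evalSubset_idFam_of_ne w y fun h => hI ((Finset.compl_eq_empty_iff I).1 h), map_zero,
      smul_zero]
  · exact fun h => absurd (Finset.mem_univ _) h

theorem sum_subsetSign_idFam_left :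
    ∑ I : Finset (Fin N), subsetSign r a I •
        β (evalSubset (idFam k U) w I x) (evalSubset T w Iᶜ y) =
      sgn (a * ∑ j, r j) • β x (T (N + 1) (Fin.snoc (α := fun _ => U) w y)) := by
  rw [Finset.sum_eq_single ∅]
  · rw [subsetSign_empty, evalSubset_idFam_empty, Finset.compl_empty, evalSubset_univ]
  · intro I _ hI
    rw [evalSubset_idFam_of_ne w x hI, map_zero, LinearMap.zero_apply, smul_zero]
  · exact fun h => absurd (Finset.mem_univ _) h

theorem sum_subsetSign_idFam :
    ∑ I : Finset (Fin N), subsetSign r a I •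
        β (evalSubset (idFam k U) w I x) (evalSubset (idFam k U) w Iᶜ y) =
      if N = 0 then β x y else 0 := by
  rw [sum_subsetSign_idFam_right]
  split_ifs with hN
  · subst hN
    rfl
  · rw [idFam_of_ne (by omega), zero_apply, map_zero, LinearMap.zero_apply]

variable {β T} in
theorem sum_subsetSign_idFam_add
    (hT : ∀ (m n : ℕ) (u : Fin m → U) (v : Fin n → U), β (T m u) (T n v) = 0) :
    ∑ I : Finset (Fin N), subsetSign r a I •
        β (evalSubset (fun n => idFam k U n + T n) w I x)
          (evalSubset (fun n => idFam k U n + T n) w Iᶜ y) =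
      (if N = 0 then β x y else 0) + (β (T (N + 1) (Fin.snoc (α := fun _ => U) w x)) y +
        sgn (a * ∑ j, r j) • β x (T (N + 1) (Fin.snoc (α := fun _ => U) w y))) := by
  rw [← sum_subsetSign_idFam β r w a x y, ← sum_subsetSign_idFam_right β T r w a x y,
    ← sum_subsetSign_idFam_left β T r w a x y, ← Finset.sum_add_distrib, ← Finset.sum_add_distrib]
  refine Finset.sum_congr rfl fun I _ => ?_
  have h_add : ∀ (I : Finset (Fin N)) x, evalSubset (fun n => idFam k U n + T n) w I x =
      evalSubset (idFam k U) w I x + evalSubset T w I x := fun _ _ => rfl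
  have h_cross : β (evalSubset T w I x) (evalSubset T w Iᶜ y) = 0 := hT _ _ _ _
  simp only [h_add, map_add, LinearMap.add_apply, h_cross, add_zero, smul_add]
  abel

end SubsetSums

theorem sgn_smul_add_eq_zero_iff {X Y : M} {α β γ δ : ZMod 2} (h : β = α + γ + δ + 1) :
    sgn α • X + sgn β • Y = 0 ↔ sgn γ • X = sgn δ • Y := by
  have h_mul : sgn (α + γ) • (sgn α • X + sgn β • Y) = sgn γ • X - sgn δ • Y := by
    rw [smul_add, sgn_smul_smul, sgn_smul_smul, h, show α + γ + α = γ + α * 2 by ring,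
      show α + γ + (α + γ + δ + 1) = δ + 1 + (α + γ) * 2 by ring,
      CharTwo.two_eq_zero (R := ZMod 2), mul_zero, mul_zero,
      add_zero, add_zero, sgn_add δ, sgn_one, mul_neg_one, Units.neg_smul, sub_eq_add_neg]
  rw [← smul_eq_zero_iff_eq (sgn (α + γ)), h_mul, sub_eq_zero]

variable {𝒱 : ZMod 2 → Submodule k V} [DirectSum.Decomposition 𝒱] {B : V →ₗ[k] V →ₗ[k] k}
  {p : ZMod 2}

theorem preservesInnerProduct_equivMap_iff_forall (φ : ∀ n, Multi k n V V) :
    PreservesInnerProduct (extGrading 𝒱 p) (extForm 𝒱 p B) (equivMap 𝒱 φ) ↔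
      ∀ (N : ℕ) (P : Fin N → ZMod 2) (w : Fin N → V × V) (a b : ZMod 2) (x y : V × V),
      Homog (extGrading 𝒱 p) P w → x ∈ extGrading 𝒱 p a → y ∈ extGrading 𝒱 p b →
      extForm 𝒱 p B (parityInvolution (extGrading 𝒱 p)
          (tPart (suspend 𝒱 (φ (N + 1))) (Fin.snoc (α := fun _ => V × V) w x))) y +
        sgn ((a + 1) * ∑ j, (P j + 1)) • extForm 𝒱 p B (parityInvolution (extGrading 𝒱 p) x)
          (tPart (suspend 𝒱 (φ (N + 1))) (Fin.snoc (α := fun _ => V × V) w y)) = 0 := by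
  have h_tt : ∀ (m n : ℕ) (u : Fin m → V × V) (v : Fin n → V × V),
      (extForm 𝒱 p B).comp (parityInvolution (extGrading 𝒱 p))
        (tPart (suspend 𝒱 (φ m)) u) (tPart (suspend 𝒱 (φ n)) v) = 0 := by
    intro m n u v
    rw [LinearMap.comp_apply, parityInvolution_extGrading, extForm_apply]
    simp [tPart_apply]
  have h_sum := fun (N : ℕ) (r : Fin N → ZMod 2) w a x y =>
    sum_subsetSign_idFam_add (N := N) r w a x y h_tt
  simp only [LinearMap.comp_apply] at h_sum
  constructor
  · intro h N P w a b x y hw hx hy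
    exact left_eq_add.1 ((h N _ w (a + 1) (b + 1) x y
      (fun i => mem_parityReversion_add_one.2 (hw i)) (mem_parityReversion_add_one.2 hx)
      (mem_parityReversion_add_one.2 hy)).symm.trans (h_sum ..))
  · intro h N r w a b x y hw hx hy
    have h_zero := h N (fun i => r i + 1) w (a + 1) (b + 1) x y hw hx hy
    simp only [add_assoc, CharTwo.add_self_eq_zero, add_zero] at h_zero
    exact (h_sum ..).trans (by rw [h_zero, add_zero])

theorem extForm_tPart_snoc_add_eq_zero_iff {N : ℕ} {φ : Multi k (N + 1) V V}
    (hφ : HasParity 𝒱 𝒱 (p + ((N + 1 : ℕ) + 1)) φ) (halt : IsGradedAlt 𝒱 φ)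
    {P : Fin N → ZMod 2} {w : Fin N → V × V} {a b : ZMod 2} {x y : V × V}
    (hw : Homog (extGrading 𝒱 p) P w) (hx : x ∈ extGrading 𝒱 p a) (hy : y ∈ extGrading 𝒱 p b) :
    extForm 𝒱 p B (parityInvolution (extGrading 𝒱 p)
        (tPart (suspend 𝒱 φ) (Fin.snoc (α := fun _ => V × V) w x))) y +
      sgn ((a + 1) * ∑ j, (P j + 1)) • extForm 𝒱 p B (parityInvolution (extGrading 𝒱 p) x)
        (tPart (suspend 𝒱 φ) (Fin.snoc (α := fun _ => V × V) w y)) = 0 ↔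
    B (φ (Fin.cons x.1 fun j => (w j).1)) y.1 = sgn ((N + 1 : ℕ) + a * (p + (N + 1 + 1))) •
      B x.1 (φ (Fin.snoc (α := fun _ => V) (fun j => (w j).1) y.1)) := by
  have hx' := ((mem_extGrading 𝒱).1 hx).1
  have hy' := ((mem_extGrading 𝒱).1 hy).1
  have snoc_fst : ∀ z : V × V, (fun i => (Fin.snoc (α := fun _ => V × V) w z i).1) =
      Fin.snoc (α := fun _ => V) (fun j => (w j).1) z.1 :=
    fun z => Fin.comp_snoc (Prod.fst : V × V → V) w z
  have hX := hφ _ _ (hw.fst.snoc hx')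
  rw [Fin.sum_univ_castSucc] at hX
  simp only [Fin.snoc_castSucc, Fin.snoc_last] at hX
  simp only [halt.cons_eq_snoc hw.fst hx', tPart_apply, snoc_fst,
    suspend_apply_homog 𝒱 _ (hw.fst.snoc hx'), suspend_apply_homog 𝒱 _ (hw.fst.snoc hy')]
  rw [suspSign_snoc P a 0, suspSign_snoc P b 0, parityInvolution_extGrading,
    parityInvolution_of_mem _ hx, extForm_apply, extForm_apply,
    parityInvolution_of_mem 𝒱 ((units_smul_mem_iff _ _).2 hX), Prod.ext_iff]
  simp only [Prod.smul_fst, Prod.smul_snd, Prod.fst_add, Prod.snd_add, map_zero, smul_zero,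
    LinearMap.zero_apply, add_zero, zero_add, Prod.fst_zero, Prod.snd_zero, true_and]
  rw [parityTwist_of_mem 𝒱 p ((units_smul_mem_iff _ _).2 hx')]
  set κ := suspSign (Fin.snoc (α := fun _ => ZMod 2) P 0)
  simp only [LinearMap.map_smul_of_tower, LinearMap.smul_apply]
  rw [smul_comm _ κ, smul_comm _ κ, smul_comm _ κ, smul_comm _ κ, smul_comm _ κ, ← smul_add,
    smul_eq_zero_iff_eq]
  simp only [sgn_smul_smul]
  refine sgn_smul_add_eq_zero_iff ?_
  simp only [Finset.sum_add_distrib, Finset.sum_const, Finset.card_univ, Fintype.card_fin,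
    nsmul_eq_mul, mul_one]
  push_cast
  linear_combination -(p + N + 2 + a) * CharTwo.two_eq_zero (R := ZMod 2)

theorem preservesInnerProduct_equivMap_iff {φ : ∀ n, Multi k n V V}
    (hφ : ∀ n : ℕ, HasParity 𝒱 𝒱 (p + (n + 1)) (φ n)) (halt : ∀ n, IsGradedAlt 𝒱 (φ n)) :
    PreservesInnerProduct (extGrading 𝒱 p) (extForm 𝒱 p B) (equivMap 𝒱 φ) ↔
      ∀ n : ℕ, IsCyclic 𝒱 B (p + (n + 1 + 1)) (φ (n + 1)) := by
  rw [preservesInnerProduct_equivMap_iff_forall]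
  refine forall_congr' fun N => ?_
  rw [isCyclic_iff_cons_snoc]
  constructor
  · intro h P w a b x y hw hx hy
    have hx' : (x, (0 : V)) ∈ extGrading 𝒱 p a := (mem_extGrading 𝒱).2 ⟨hx, zero_mem _⟩
    have hy' : (y, (0 : V)) ∈ extGrading 𝒱 p b := (mem_extGrading 𝒱).2 ⟨hy, zero_mem _⟩
    exact (extForm_tPart_snoc_add_eq_zero_iff (hφ _) (halt _) (hw.inl p) hx' hy').1
      (h _ _ _ _ _ _ (hw.inl p) hx' hy')
  · intro h P w a b x y hw hx hy
    exact (extForm_tPart_snoc_add_eq_zero_iff (hφ _) (halt _) hw hx hy).2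
      (h _ _ _ _ _ _ hw.fst ((mem_extGrading 𝒱).1 hx).1 ((mem_extGrading 𝒱).1 hy).1)

end Isometries

section Equivalence

variable {k V U : Type*} [Field k] [AddCommGroup V] [Module k V] [AddCommGroup U] [Module k U]

/-! ### Equivalence of deformations -/

theorem hasParity_idFam (𝒰 : ZMod 2 → Submodule k U) (n : ℕ) :
    HasParity 𝒰 𝒰 0 (idFam k U n) := by
  rcases eq_or_ne n 1 with rfl | hn
  · intro p v hv
    rw [idFam_one, zero_add, Fin.sum_univ_one]
    exact hv 0
  · rw [idFam_of_ne hn]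
    exact hasParity_zero

theorem isGradedSymm_idFam (𝒰 : ZMod 2 → Submodule k U) (n : ℕ) :
    IsGradedSymm 𝒰 (idFam k U n) := by
  rcases eq_or_ne n 1 with rfl | hn
  · intro σ p v _
    obtain rfl : σ = 1 := Subsingleton.elim _ _
    rw [koszul_refl, one_smul]
    rfl
  · rw [idFam_of_ne hn]
    exact fun _ _ _ _ => (smul_zero _).symm

theorem isGradedTLinear_idFam (𝒰 : ZMod 2 → Submodule k (V × V)) (p : ZMod 2) (n : ℕ) :
    IsGradedTLinear 𝒰 p 0 (idFam k (V × V) n) := by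
  rcases eq_or_ne n 1 with rfl | hn
  · intro r z _ i
    obtain rfl : i = 0 := Subsingleton.elim _ _
    have h_Iio : Finset.Iio (0 : Fin 1) = ∅ := Finset.Iio_bot
    rw [idFam_one, idFam_one, h_Iio, Function.update_self]
    simp
  · rw [idFam_of_ne hn]
    exact isGradedTLinear_tPart _ _ (0 : Multi k n V V)

theorem idFam_inl_snd {n : ℕ} (v : Fin n → V) :
    (idFam k (V × V) n fun i => (v i, (0 : V))).2 = 0 := by
  rcases eq_or_ne n 1 with rfl | hn
  · rfl
  · rw [idFam_of_ne hn]
    rfl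

variable {𝒱 : ZMod 2 → Submodule k V} [DirectSum.Decomposition 𝒱] {l : Multi k 2 V V}
  {B : V →ₗ[k] V →ₗ[k] k} {p : ZMod 2}

theorem eq_equivMap {f : ∀ n, Multi k n (V × V) (V × V)}
    (hf : ∀ n, IsGradedTLinear (parityReversion (extGrading 𝒱 p)) p 0 (f n))
    (h_one : ∀ z : Fin 1 → V × V, (f 1 z).1 = (z 0).1)
    (hn : ∀ n, n ≠ 1 → ∀ z : Fin n → V × V, (f n z).1 = 0) :
    f = equivMap 𝒱 fun n => suspend 𝒱 ((LinearMap.snd k V V).compMultilinearMap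
      ((f n).compLinearMap fun _ => LinearMap.inl k V V)) := by
  funext n
  have h_fst : ∀ z, ((f n - idFam k (V × V) n) z).1 = 0 := by
    intro z
    rw [sub_apply, Prod.fst_sub, sub_eq_zero]
    rcases eq_or_ne n 1 with rfl | hn'
    · exact h_one z
    · rw [hn n hn', idFam_of_ne hn']
      rfl
  have h_sub := eq_tPart_of_map_mulT_eq_zero h_fst (forall_homog_parityReversion.1
    (((hf n).sub (isGradedTLinear_idFam _ p n)).map_mulT_eq_zero h_fst))
  rw [equivMap, suspend_suspend, ← sub_eq_iff_eq_add', h_sub]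
  congr 1
  ext v
  change (f n (fun i => (v i, (0 : V))) - idFam k (V × V) n (fun i => (v i, (0 : V)))).2 =
    (f n (fun i => (v i, (0 : V)))).2
  rw [Prod.snd_sub, idFam_inl_snd, sub_zero]

theorem hasParity_equivMap_iff {φ : ∀ n, Multi k n V V} {n : ℕ} :
    HasParity (parityReversion (extGrading 𝒱 p)) (parityReversion (extGrading 𝒱 p)) 0
      (equivMap 𝒱 φ n) ↔ HasParity 𝒱 𝒱 (p + (n + 1)) (φ n) := by
  rw [← hasParity_suspend_iff 𝒱, ← hasParity_tPart_iff, ← zero_add (n : ZMod 2),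
    ← hasParity_parityReversion_iff]
  refine ⟨fun h => ?_, (hasParity_idFam _ n).add⟩
  simpa only [equivMap, add_sub_cancel_left] using h.sub (hasParity_idFam _ n)

theorem isGradedSymm_equivMap_iff {φ : ∀ n, Multi k n V V} {n : ℕ} :
    IsGradedSymm (parityReversion (extGrading 𝒱 p)) (equivMap 𝒱 φ n) ↔ IsGradedAlt 𝒱 (φ n) := by
  rw [← isGradedAlt_tPart_iff (p := p), ← isGradedSymm_suspend_iff, suspend_tPart]
  refine ⟨fun h => ?_, (isGradedSymm_idFam _ n).add⟩
  simpa only [equivMap, add_sub_cancel_left] using h.sub (isGradedSymm_idFam _ n)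

theorem equivMap_zero_eq_zero_iff {φ : ∀ n, Multi k n V V} : equivMap 𝒱 φ 0 = 0 ↔ φ 0 = 0 := by
  rw [equivMap, idFam_of_ne zero_ne_one, zero_add, ← tPart_zero, tPart_injective.eq_iff]
  exact ⟨fun h => by rw [← suspend_suspend 𝒱 (φ 0), h, suspend_zero],
    fun h => by rw [h, suspend_zero]⟩

namespace Deformation

theorem isLInfinityMorphism_equivMap_iff (hl : IsLieBracket 𝒱 l) (hinv : IsInvariantForm l B)
    (m m' : Deformation 𝒱 l B p) {φ : ∀ n, Multi k n V V} :
    IsLInfinityMorphism (extGrading 𝒱 p) m.op m'.op (equivMap 𝒱 φ) ↔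
      φ 0 = 0 ∧ (∀ n : ℕ, HasParity 𝒱 𝒱 (p + (n + 1)) (φ n)) ∧ (∀ n, IsGradedAlt 𝒱 (φ n)) ∧
      m'.cochain 1 = m.cochain 1 ∧
      ∀ a, m'.cochain (a + 2) - m.cochain (a + 2) = lieDifferential 𝒱 l a (φ (a + 1)) := by
  have hm := fun n => (m.cochain_mem_cyclicCochains hl hinv n).1
  constructor
  · rintro ⟨h_zero, h_parity, h_symm, h_intertwines⟩
    rw [equivMap_zero_eq_zero_iff] at h_zero
    have hφ := fun n => hasParity_equivMap_iff.1 (h_parity n)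
    rw [m.op_eq, m'.op_eq, intertwines_iff hl h_zero hφ hm m.cochain_zero m'.cochain_zero]
      at h_intertwines
    exact ⟨h_zero, hφ, fun n => isGradedSymm_equivMap_iff.1 (h_symm n), h_intertwines⟩
  · rintro ⟨h_zero, h_parity, h_alt, h_cochain⟩
    refine ⟨equivMap_zero_eq_zero_iff.2 h_zero, fun n => hasParity_equivMap_iff.2 (h_parity n),
      fun n => isGradedSymm_equivMap_iff.2 (h_alt n), ?_⟩
    rwa [m.op_eq, m'.op_eq, intertwines_iff hl h_zero h_parity hm m.cochain_zero m'.cochain_zero]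

theorem isEquivalent_iff_exists_equivMap {m m' : Deformation 𝒱 l B p} :
    m.IsEquivalent m' ↔ ∃ φ, IsLInfinityMorphism (extGrading 𝒱 p) m.op m'.op (equivMap 𝒱 φ) ∧
      PreservesInnerProduct (extGrading 𝒱 p) (extForm 𝒱 p B) (equivMap 𝒱 φ) := by
  constructor
  · rintro ⟨f, h_morphism, h_linear, h_one, h_ne_one, h_preserves⟩
    rw [eq_equivMap h_linear h_one h_ne_one] at h_morphism h_preserves
    exact ⟨_, h_morphism, h_preserves⟩
  · rintro ⟨φ, h_morphism, h_preserves⟩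
    refine ⟨equivMap 𝒱 φ, h_morphism, fun n => ?_, fun z => add_zero _, fun n hn z => ?_,
      h_preserves⟩
    · exact (isGradedTLinear_idFam _ p n).add (isGradedTLinear_tPart _ _ _)
    · rw [equivMap, idFam_of_ne hn, zero_add, tPart_apply]

theorem isEquivalent_iff_exists (hl : IsLieBracket 𝒱 l) (hinv : IsInvariantForm l B)
    {m m' : Deformation 𝒱 l B p} :
    m.IsEquivalent m' ↔ ∃ φ : ∀ n, Multi k n V V, φ 0 = 0 ∧
      (∀ n : ℕ, φ n ∈ cyclicCochains 𝒱 B (p + (n + 1)) n) ∧ m'.cochain 1 = m.cochain 1 ∧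
      ∀ a, m'.cochain (a + 2) - m.cochain (a + 2) = lieDifferential 𝒱 l a (φ (a + 1)) := by
  rw [isEquivalent_iff_exists_equivMap]
  refine exists_congr fun φ => ?_
  rw [isLInfinityMorphism_equivMap_iff hl hinv]
  constructor
  · rintro ⟨⟨h_zero, h_parity, h_alt, h_cochain⟩, h_preserves⟩
    rw [preservesInnerProduct_equivMap_iff h_parity h_alt] at h_preserves
    refine ⟨h_zero, fun n => ?_, h_cochain⟩
    cases n with
    | zero => exact h_zero ▸ zero_mem _
    | succ n => exact ⟨h_parity _, h_alt _, by simpa only [Nat.cast_succ] using h_preserves n⟩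
  · rintro ⟨h_zero, h_mem, h_cochain⟩
    refine ⟨⟨h_zero, fun n => (h_mem n).1, fun n => (h_mem n).2.1, h_cochain⟩, ?_⟩
    rw [preservesInnerProduct_equivMap_iff (fun n => (h_mem n).1) fun n => (h_mem n).2.1]
    exact fun n => by simpa only [Nat.cast_succ] using (h_mem (n + 1)).2.2

theorem isEquivalent_iff_sub_mem_cyclicCoboundaries (hl : IsLieBracket 𝒱 l)
    (hinv : IsInvariantForm l B) {m m' : Deformation 𝒱 l B p} :
    m.IsEquivalent m' ↔ ∀ a, m'.cochain (a + 1) - m.cochain (a + 1) ∈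
      cyclicCoboundaries 𝒱 l B (p + (a + 1 : ℕ)) a := by
  rw [isEquivalent_iff_exists hl hinv]
  constructor
  · rintro ⟨φ, -, h_mem, h_one, h_add_two⟩ a
    cases a with
    | zero => exact (Submodule.mem_bot k).2 (sub_eq_zero.2 h_one)
    | succ a =>
      refine Submodule.mem_map.2 ⟨φ (a + 1), ?_, (h_add_two a).symm⟩
      simpa only [Nat.cast_succ] using h_mem (a + 1)
  · intro h
    have h_succ : ∀ a, ∃ φ ∈ cyclicCochains 𝒱 B (p + (a + 1 + 1 : ℕ)) (a + 1),
        lieDifferential 𝒱 l a φ = m'.cochain (a + 2) - m.cochain (a + 2) :=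
      fun a => Submodule.mem_map.1 (h (a + 1))
    choose φ hφ hd using h_succ
    refine ⟨extendZero φ, rfl, fun n => ?_, sub_eq_zero.1 ((Submodule.mem_bot k).1 (h 0)),
      fun a => (hd a).symm⟩
    cases n with
    | zero => exact zero_mem _
    | succ a => simpa only [Nat.cast_succ, extendZero] using hφ a

theorem equivalence_isEquivalent (hl : IsLieBracket 𝒱 l) (hinv : IsInvariantForm l B) :
    Equivalence (IsEquivalent (𝒱 := 𝒱) (l := l) (B := B) (p := p)) where
  refl m := (isEquivalent_iff_sub_mem_cyclicCoboundaries hl hinv).2 fun a => by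
    rw [sub_self]
    exact zero_mem _
  symm h := by
    rw [isEquivalent_iff_sub_mem_cyclicCoboundaries hl hinv] at h ⊢
    intro a
    rw [← neg_sub]
    exact neg_mem (h a)
  trans h h' := by
    rw [isEquivalent_iff_sub_mem_cyclicCoboundaries hl hinv] at h h' ⊢
    intro a
    rw [← sub_add_sub_cancel]
    exact add_mem (h' a) (h a)

theorem isEquivalent_iff_class_eq (hl : IsLieBracket 𝒱 l) (hinv : IsInvariantForm l B)
    (m m' : Deformation 𝒱 l B p) :
    m.IsEquivalent m' ↔ (fun a => (Submodule.Quotient.mk (deformationEquiv hl hinv m a) :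
        CyclicCohomology 𝒱 l B (p + (a + 1 : ℕ)) a)) =
      fun a => Submodule.Quotient.mk (deformationEquiv hl hinv m' a) := by
  rw [isEquivalent_iff_sub_mem_cyclicCoboundaries hl hinv, funext_iff]
  refine forall_congr' fun a => ?_
  rw [eq_comm, Submodule.Quotient.eq]
  rfl

end Deformation

/-- The bijection of the equivalence classes of deformations with the sequences of cyclic
cohomology classes, given by the classes of the components `λₙ`. -/
def deformationClassEquiv (hl : IsLieBracket 𝒱 l) (hinv : IsInvariantForm l B) :
    Quot (Deformation.IsEquivalent (𝒱 := 𝒱) (l := l) (B := B) (p := p)) ≃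
      ∀ a : ℕ, CyclicCohomology 𝒱 l B (p + (a + 1 : ℕ)) a :=
  Equiv.ofBijective
    (Quot.lift (fun m a => Submodule.Quotient.mk (deformationEquiv hl hinv m a))
      fun m m' h => (Deformation.isEquivalent_iff_class_eq hl hinv m m').1 h)
    (by
      constructor
      · rintro ⟨m⟩ ⟨m'⟩ h
        exact Quot.sound ((Deformation.isEquivalent_iff_class_eq hl hinv m m').2 h)
      · intro c
        choose φ hφ using fun a => Submodule.Quotient.mk_surjective _ (c a)
        refine ⟨Quot.mk _ ((deformationEquiv hl hinv).symm φ), ?_⟩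
        funext a
        change Submodule.Quotient.mk (deformationEquiv hl hinv
          ((deformationEquiv hl hinv).symm φ) a) = c a
        rw [Equiv.apply_symm_apply, hφ])

end Equivalence

/-! ### Permutations that fix or move the last element -/

/-- The extension of a permutation by a fixed last element. -/
def extPerm {n : ℕ} (σ : Equiv.Perm (Fin n)) : Equiv.Perm (Fin (n + 1)) :=
  finSuccEquivLast.symm.permCongr (Equiv.optionCongr σ)

@[simp] theorem extPerm_castSucc {n : ℕ} (σ : Equiv.Perm (Fin n)) (i : Fin n) :
    extPerm σ i.castSucc = (σ i).castSucc := by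
  simp [extPerm, Equiv.permCongr_apply]

@[simp] theorem extPerm_last {n : ℕ} (σ : Equiv.Perm (Fin n)) :
    extPerm σ (Fin.last n) = Fin.last n := by
  simp [extPerm, Equiv.permCongr_apply]

theorem extPerm_injective {n : ℕ} : Function.Injective (extPerm (n := n)) := by
  intro τ τ' h
  refine Equiv.ext fun i => Fin.castSucc_injective _ ?_
  rw [← extPerm_castSucc, ← extPerm_castSucc, h]

theorem koszul_extPerm {n : ℕ} (p : Fin (n + 1) → ZMod 2) (σ : Equiv.Perm (Fin n)) :
    koszul p (extPerm σ) = koszul (fun i => p i.castSucc) σ := by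
  rw [koszul, Fin.prod_univ_castSucc]
  simp only [Fin.prod_univ_castSucc, extPerm_castSucc, extPerm_last, Fin.castSucc_lt_castSucc_iff,
    (Fin.castSucc_lt_last _).not_gt, and_false, false_and, lt_irrefl, if_false,
    Finset.prod_const_one, mul_one]
  rfl

theorem sign_extPerm {n : ℕ} (σ : Equiv.Perm (Fin n)) :
    Equiv.Perm.sign (extPerm σ) = Equiv.Perm.sign σ := by
  rw [← koszul_one_eq_sign, koszul_extPerm, koszul_one_eq_sign]

theorem exists_eq_extPerm {n : ℕ} (π : Equiv.Perm (Fin (n + 1))) (h : π (Fin.last n) = Fin.last n) :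
    ∃ τ, π = extPerm τ := by
  have h_ne : ∀ i : Fin n, π i.castSucc ≠ Fin.last n := fun i hi =>
    (Fin.castSucc_lt_last i).ne (π.injective (hi.trans h.symm))
  have h_inj : Function.Injective fun i : Fin n => (π i.castSucc).castPred (h_ne i) := by
    intro i j hij
    exact Fin.castSucc_injective n (π.injective (Fin.castPred_inj.1 hij))
  refine ⟨Equiv.ofBijective _ (Finite.injective_iff_bijective.1 h_inj), Equiv.ext fun i => ?_⟩
  induction i using Fin.lastCases with
  | last => rw [extPerm_last, h]
  | cast i => simp

theorem exists_eq_extPerm_mul_skipPerm_mul_extPerm {n : ℕ} (π : Equiv.Perm (Fin (n + 2)))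
    (h : π (Fin.last (n + 1)) ≠ Fin.last (n + 1)) :
    ∃ τ τ', π = extPerm τ * (skipPerm 0 * extPerm τ') := by
  obtain ⟨i, hi⟩ := Fin.exists_castSucc_eq.2 h
  obtain ⟨τ', hτ'⟩ := exists_eq_extPerm
    ((skipPerm 0)⁻¹ * ((extPerm (Equiv.swap 0 i))⁻¹ * π)) (by
      rw [Equiv.Perm.mul_apply, Equiv.Perm.mul_apply, Equiv.Perm.inv_eq_iff_eq, skipPerm_last,
        Equiv.Perm.inv_eq_iff_eq, ← hi]
      change i.castSucc = extPerm (Equiv.swap 0 i) (0 : Fin (n + 1)).castSucc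
      rw [extPerm_castSucc, Equiv.swap_apply_left])
  exact ⟨Equiv.swap 0 i, τ', by rw [← hτ']; group⟩

/-- The permutation `(n, n + 1, 0, …, n - 1)`. -/
def rotateTwo (n : ℕ) : Equiv.Perm (Fin (n + 2)) := (skipPerm 0 * skipPerm 0)⁻¹

theorem rotateTwo_zero (n : ℕ) : rotateTwo n 0 = (Fin.last n).castSucc := by
  rw [rotateTwo, Equiv.Perm.inv_eq_iff_eq, Equiv.Perm.mul_apply, skipPerm_castSucc,
    Fin.succAbove_zero, Fin.succ_last, skipPerm_last]

theorem rotateTwo_one (n : ℕ) : rotateTwo n 1 = Fin.last (n + 1) := by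
  rw [rotateTwo, Equiv.Perm.inv_eq_iff_eq, Equiv.Perm.mul_apply, skipPerm_last]
  exact (skipPerm_castSucc 0 (0 : Fin (n + 1))).symm

theorem rotateTwo_succ_succ {n : ℕ} (j : Fin n) :
    rotateTwo n j.succ.succ = j.castSucc.castSucc := by
  rw [rotateTwo, Equiv.Perm.inv_eq_iff_eq, Equiv.Perm.mul_apply, skipPerm_castSucc,
    Fin.succAbove_zero, Fin.succ_castSucc, skipPerm_castSucc, Fin.succAbove_zero]

theorem sign_rotateTwo (n : ℕ) : Equiv.Perm.sign (rotateTwo n) = 1 := by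
  rw [rotateTwo, Equiv.Perm.sign_inv, Equiv.Perm.sign_mul, Int.units_mul_self]

theorem koszul_rotateTwo {n : ℕ} (p : Fin (n + 2) → ZMod 2) :
    koszul p (rotateTwo n) = sgn ((p (Fin.last n).castSucc + p (Fin.last (n + 1))) *
      ∑ j : Fin n, p j.castSucc.castSucc) := by
  have h_one := koszul_mul p (rotateTwo n) (skipPerm 0 * skipPerm 0)
  rw [show rotateTwo n * (skipPerm 0 * skipPerm 0) = 1 from inv_mul_cancel _, koszul_refl,
    koszul_mul, koszul_skipPerm_zero, koszul_skipPerm_zero] at h_one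
  have skipPerm_zero : skipPerm (0 : Fin (n + 2)) 0 = 1 := skipPerm_castSucc 0 (0 : Fin (n + 1))
  have skipPerm_succ : ∀ j : Fin n, skipPerm (0 : Fin (n + 2)) j.castSucc.succ = j.succ.succ := by
    intro j
    rw [Fin.succ_castSucc, skipPerm_castSucc, Fin.succAbove_zero]
  rw [Fin.sum_univ_succ, Fin.sum_univ_castSucc, Fin.succ_last, skipPerm_last, skipPerm_zero,
    rotateTwo_zero] at h_one
  simp only [skipPerm_succ, rotateTwo_succ_succ] at h_one
  rw [show (0 : Fin (n + 1)).succ = 1 from rfl, rotateTwo_one, ← sgn_add] at h_one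
  rw [← Int.units_inv_eq_self (koszul p _), ← eq_comm, ← mul_eq_one_iff_eq_inv']
  refine (congrArg (fun s => koszul p (rotateTwo n) * sgn s) ?_).trans h_one.symm
  linear_combination
    -(p (Fin.last n).castSucc * p (Fin.last (n + 1))) * CharTwo.two_eq_zero (R := ZMod 2)

theorem extPerm_mem_unshuffles_iff {n b : ℕ} {τ : Equiv.Perm (Fin n)} :
    extPerm τ ∈ unshuffles (n + 1) b ↔ τ ∈ unshuffles n b := by
  rw [mem_unshuffles, mem_unshuffles]
  constructor
  · intro hτ i j hij h
    simpa only [extPerm_castSucc, Fin.castSucc_lt_castSucc_iff] using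
      hτ i.castSucc j.castSucc hij h
  · intro hτ i j hij h
    obtain ⟨i, rfl⟩ := Fin.exists_castSucc_eq.2 (hij.trans_le (Fin.le_last j)).ne
    rw [extPerm_castSucc]
    induction j using Fin.lastCases with
    | last =>
      rw [extPerm_last]
      exact Fin.castSucc_lt_last _
    | cast j =>
      rw [extPerm_castSucc]
      exact hτ i j hij h

theorem sum_unshuffles_filter_last {X : Type*} [AddCommMonoid X] (n b : ℕ)
    (F : Equiv.Perm (Fin (n + 1)) → X) :
    ∑ σ ∈ unshuffles (n + 1) b with σ (Fin.last n) = Fin.last n, F σ =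
      ∑ τ ∈ unshuffles n b, F (extPerm τ) := by
  symm
  refine Finset.sum_bij (fun τ _ => extPerm τ) (fun τ hτ => ?_)
    (fun _ _ _ _ h => extPerm_injective h) (fun σ hσ => ?_) fun _ _ => rfl
  · exact Finset.mem_filter.2 ⟨extPerm_mem_unshuffles_iff.2 hτ, extPerm_last τ⟩
  · obtain ⟨hσ, h_last⟩ := Finset.mem_filter.1 hσ
    obtain ⟨τ, rfl⟩ := exists_eq_extPerm σ h_last
    exact ⟨τ, extPerm_mem_unshuffles_iff.1 hσ, rfl⟩

/-- The permutation `(i, n + 1, 0, …, i - 1, i + 1, …, n)`; for `n ≥ 1` these are the unshuffles of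
type `(2, n)` that move the last element. -/
def pairLastPerm {n : ℕ} (i : Fin (n + 1)) : Equiv.Perm (Fin (n + 2)) :=
  extPerm (skipPerm i) * rotateTwo n

theorem pairLastPerm_zero {n : ℕ} (i : Fin (n + 1)) : pairLastPerm i 0 = i.castSucc := by
  rw [pairLastPerm, Equiv.Perm.mul_apply, rotateTwo_zero, extPerm_castSucc, skipPerm_last]

theorem pairLastPerm_one {n : ℕ} (i : Fin (n + 1)) : pairLastPerm i 1 = Fin.last (n + 1) := by
  rw [pairLastPerm, Equiv.Perm.mul_apply, rotateTwo_one, extPerm_last]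

theorem pairLastPerm_succ_succ {n : ℕ} (i : Fin (n + 1)) (j : Fin n) :
    pairLastPerm i j.succ.succ = (i.succAbove j).castSucc := by
  rw [pairLastPerm, Equiv.Perm.mul_apply, rotateTwo_succ_succ, extPerm_castSucc, skipPerm_castSucc]

theorem sign_pairLastPerm {n : ℕ} (i : Fin (n + 1)) :
    Equiv.Perm.sign (pairLastPerm i) = sgn ((n - i : ℕ) : ZMod 2) := by
  rw [pairLastPerm, Equiv.Perm.sign_mul, sign_extPerm, sign_rotateTwo, mul_one, sign_skipPerm]

theorem koszul_pairLastPerm {n : ℕ} (p : Fin (n + 2) → ZMod 2) (i : Fin (n + 1)) :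
    koszul p (pairLastPerm i) = koszul (fun j => p j.castSucc) (skipPerm i) *
      sgn ((p i.castSucc + p (Fin.last (n + 1))) * ∑ j, p (i.succAbove j).castSucc) := by
  rw [pairLastPerm, koszul_mul, koszul_extPerm, koszul_rotateTwo]
  simp only [extPerm_castSucc, extPerm_last, skipPerm_castSucc, skipPerm_last]

theorem pairLastPerm_injective {n : ℕ} : Function.Injective (pairLastPerm (n := n)) := by
  intro i j h
  refine Fin.castSucc_injective _ ?_
  rw [← pairLastPerm_zero, ← pairLastPerm_zero, h]

theorem pairLastPerm_mem_unshuffles {n : ℕ} (i : Fin (n + 1)) :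
    pairLastPerm i ∈ unshuffles (n + 2) 2 := by
  refine mem_unshuffles.2 fun x y hxy h => ?_
  rcases h with hy | hx
  · obtain rfl : y = 1 := Fin.ext (by rw [Fin.val_one]; omega)
    obtain rfl : x = 0 := Fin.ext (by rw [Fin.lt_def, Fin.val_one] at hxy; rw [Fin.val_zero]; omega)
    rw [pairLastPerm_zero, pairLastPerm_one]
    exact Fin.castSucc_lt_last i
  · obtain ⟨x, rfl⟩ : ∃ x' : Fin n, x'.succ.succ = x :=
      ⟨⟨x - 2, by omega⟩, Fin.ext (by simp; omega)⟩
    obtain ⟨y, rfl⟩ : ∃ y' : Fin n, y'.succ.succ = y :=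
      ⟨⟨y - 2, by omega⟩, Fin.ext (by simp; omega)⟩
    rw [pairLastPerm_succ_succ, pairLastPerm_succ_succ, Fin.castSucc_lt_castSucc_iff]
    exact Fin.strictMono_succAbove i (by simpa using hxy)

theorem apply_one_eq_last_of_mem_unshuffles {n : ℕ} {σ : Equiv.Perm (Fin (n + 2))}
    (hσ : σ ∈ unshuffles (n + 2) 2) (h_last : σ (Fin.last (n + 1)) ≠ Fin.last (n + 1)) :
    σ 1 = Fin.last (n + 1) := by
  rw [mem_unshuffles] at hσ
  obtain ⟨x, hx⟩ := σ.surjective (Fin.last (n + 1))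
  have h_max : ∀ y, ¬ σ x < σ y := fun y h => (hx ▸ h).not_ge (Fin.le_last _)
  have h_ne : x ≠ Fin.last (n + 1) := fun h => h_last (h ▸ hx)
  have h_lt : (x : ℕ) < 2 := by
    by_contra! h
    exact h_max _ (hσ x _ (Fin.lt_last_iff_ne_last.2 h_ne) (Or.inr h))
  have h_ne_zero : (x : ℕ) ≠ 0 := by
    intro h
    refine h_max 1 (hσ x 1 ?_ (Or.inl ?_)) <;> simp [Fin.lt_def, h]
  obtain rfl : x = 1 := Fin.ext (by rw [Fin.val_one]; omega)
  exact hx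

theorem exists_eq_pairLastPerm {n : ℕ} {σ : Equiv.Perm (Fin (n + 2))}
    (hσ : σ ∈ unshuffles (n + 2) 2) (h_last : σ (Fin.last (n + 1)) ≠ Fin.last (n + 1)) :
    ∃ i, σ = pairLastPerm i := by
  have h_one := apply_one_eq_last_of_mem_unshuffles hσ h_last
  have h_ne : ∀ x, x ≠ 1 → σ x ≠ Fin.last (n + 1) :=
    fun x hx h => hx (σ.injective (h.trans h_one.symm))
  obtain ⟨i, hi⟩ := Fin.exists_castSucc_eq.2 (h_ne 0 Fin.zero_ne_one)
  have h_ne_one (j : Fin n) : j.succ.succ ≠ 1 :=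
    fun h => Fin.succ_ne_zero j (Fin.succ_injective _ h)
  have h_rest : (fun j : Fin n => (σ j.succ.succ).castPred (h_ne _ (h_ne_one j))) =
      i.succAbove := by
    refine strictMono_eq_succAbove (fun x y hxy => ?_) fun j hj => ?_
    · exact mem_unshuffles.1 hσ x.succ.succ y.succ.succ (by simpa using hxy) (Or.inr (by simp))
    · have h_eq : σ j.succ.succ = σ 0 := by rw [← hi, ← hj, Fin.castSucc_castPred]
      exact Fin.succ_ne_zero _ (σ.injective h_eq)
  refine ⟨i, Equiv.ext fun x => ?_⟩
  refine Fin.cases ?_ (Fin.cases ?_ fun j => ?_) x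
  · rw [pairLastPerm_zero, hi]
  · exact h_one.trans (pairLastPerm_one i).symm
  · rw [pairLastPerm_succ_succ, ← h_rest, Fin.castSucc_castPred]

theorem sum_unshuffles_two {X : Type*} [AddCommMonoid X] (a : ℕ)
    (F : Equiv.Perm (Fin (a + 3)) → X) :
    ∑ σ ∈ unshuffles (a + 3) 2, F σ = ∑ τ ∈ unshuffles (a + 2) 2, F (extPerm τ) +
      ∑ i : Fin (a + 2), F (pairLastPerm i) := by
  classical
  rw [← Finset.sum_filter_add_sum_filter_not _ fun σ => σ (Fin.last (a + 2)) = Fin.last (a + 2),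
    sum_unshuffles_filter_last]
  congr 1
  symm
  refine Finset.sum_bij (fun i _ => pairLastPerm i) (fun i _ => ?_)
    (fun _ _ _ _ h => pairLastPerm_injective h) (fun σ hσ => ?_) fun _ _ => rfl
  · refine Finset.mem_filter.2 ⟨pairLastPerm_mem_unshuffles i, fun h => ?_⟩
    rw [← Fin.succ_last, ← Fin.succ_last, pairLastPerm_succ_succ] at h
    exact (Fin.castSucc_lt_last _).ne h
  · obtain ⟨hσ, h_last⟩ := Finset.mem_filter.1 hσ
    obtain ⟨i, rfl⟩ := exists_eq_pairLastPerm hσ h_last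
    exact ⟨i, Finset.mem_univ _, rfl⟩

/-! ### Cyclic cochains and scalar cochains -/

section Tilde

variable {k V M : Type*} [Field k] [AddCommGroup V] [Module k V] [AddCommGroup M] [Module k M]

/-- Graded antisymmetry with respect to a single permutation, so that `IsGradedAlt` can be tested
on generators of the symmetric group. -/
def IsAltAt (𝒱 : ZMod 2 → Submodule k V) {n : ℕ} (φ : Multi k n V M) (σ : Equiv.Perm (Fin n)) :
    Prop :=
  ∀ p v, Homog 𝒱 p v → φ v = (Equiv.Perm.sign σ * koszul p σ) • φ (fun i => v (σ i))

theorem IsAltAt.mul {𝒱 : ZMod 2 → Submodule k V} {n : ℕ} {φ : Multi k n V M}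
    {σ τ : Equiv.Perm (Fin n)} (hσ : IsAltAt 𝒱 φ σ) (hτ : IsAltAt 𝒱 φ τ) :
    IsAltAt 𝒱 φ (σ * τ) := by
  intro p v hv
  rw [hσ p v hv, hτ _ _ (hv.comp σ), smul_smul, koszul_mul, Equiv.Perm.sign_mul,
    mul_mul_mul_comm]
  rfl

theorem tilde_apply (B : V →ₗ[k] V →ₗ[k] k) {n : ℕ} (φ : Multi k n V V) (v : Fin (n + 1) → V) :
    tilde B φ v = B (φ fun i => v i.castSucc) (v (Fin.last n)) := rfl

theorem tilde_snoc (B : V →ₗ[k] V →ₗ[k] k) {n : ℕ} (φ : Multi k n V V) (v : Fin n → V) (y : V) :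
    tilde B φ (Fin.snoc (α := fun _ => V) v y) = B (φ v) y := by
  simp only [tilde_apply, Fin.snoc_castSucc, Fin.snoc_last]

theorem tilde_injective {B : V →ₗ[k] V →ₗ[k] k} (hB : Function.Injective B) {n : ℕ} :
    Function.Injective (tilde B (n := n)) := by
  intro φ ψ h
  ext v
  refine hB (LinearMap.ext fun y => ?_)
  rw [← tilde_snoc, ← tilde_snoc, h]

theorem tilde_surjective {B : V →ₗ[k] V →ₗ[k] k} (hB : Function.Bijective B) {n : ℕ} :
    Function.Surjective (tilde B (n := n)) := by
  intro f
  let e := LinearEquiv.ofBijective B hB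
  refine ⟨e.symm.toLinearMap.compMultilinearMap f.curryRight, ?_⟩
  ext v
  change e (e.symm (f.curryRight (Fin.init v))) (v (Fin.last n)) = f v
  rw [e.apply_symm_apply, MultilinearMap.curryRight_apply, Fin.snoc_init_self]

/-- The isomorphism `φ ↦ φ~` of the multilinear maps `Vⁿ → V` with the multilinear maps
`Vⁿ⁺¹ → k`. -/
def tildeEquiv (B : V →ₗ[k] V →ₗ[k] k) (hB : Function.Bijective B) (n : ℕ) :
    Multi k n V V ≃ₗ[k] Multi k (n + 1) V k :=
  LinearEquiv.ofBijective
    { toFun := tilde B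
      map_add' φ ψ := by
        ext v
        simp [tilde_apply]
      map_smul' c φ := by
        ext v
        simp [tilde_apply] }
    ⟨tilde_injective hB.1, tilde_surjective hB⟩

theorem tildeEquiv_apply (B : V →ₗ[k] V →ₗ[k] k) (hB : Function.Bijective B) {n : ℕ}
    (φ : Multi k n V V) : tildeEquiv B hB n φ = tilde B φ := rfl

theorem groundGrading_mem_iff {i : ZMod 2} {c : k} : c ∈ groundGrading k i ↔ (i ≠ 0 → c = 0) := by
  rw [groundGrading]
  split_ifs with h <;> simp [h]

theorem insertMap_two {a : ℕ} (h : 2 + a = a + 2) (f : Multi k (a + 1) V M) (l : Multi k 2 V V)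
    (w : Fin (a + 2) → V) :
    insertMap h f l w = f (Fin.cons (l ![w 0, w 1]) fun j => w j.succ.succ) := by
  rw [insertMap_apply, eq_pair fun i => w (Fin.cast h (Fin.castAdd a i))]
  congr 2
  funext j
  congr 1
  ext
  simp

theorem insertMap_tilde (B : V →ₗ[k] V →ₗ[k] k) {n a b : ℕ} (h : b + a = n)
    (h' : b + (a + 1) = n + 1) (φ : Multi k (a + 1) V V) (ψ : Multi k b V V) :
    insertMap h' (tilde B φ) ψ = tilde B (insertMap h φ ψ) := by
  subst h
  ext v
  rw [insertMap_apply, tilde_apply, tilde_apply, insertMap_apply]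
  congr 3
  funext i
  induction i using Fin.cases <;> rfl

variable {𝒱 : ZMod 2 → Submodule k V} {B : V →ₗ[k] V →ₗ[k] k} {q : ZMod 2}

theorem isAltAt_tilde_skipPerm_zero_iff (hB : IsInnerProduct 𝒱 B) {n : ℕ} {φ : Multi k n V V}
    (hφ : HasParity 𝒱 𝒱 q φ) : IsAltAt 𝒱 (tilde B φ) (skipPerm 0) ↔ IsCyclic 𝒱 B q φ := by
  refine forall_congr' fun p => forall_congr' fun v => forall_congr' fun hv => ?_
  rw [tilde_apply, tilde_apply, sign_skipPerm, koszul_skipPerm_zero,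
    hB.symm _ _ _ (hv 0) _ (hφ _ _ (hv.comp Fin.succ)), sgn_smul_smul, ← sgn_add, skipPerm_last]
  simp only [skipPerm_castSucc, Fin.succAbove_zero]
  have h_sign : ((n - ((0 : Fin (n + 1)) : ℕ) : ℕ) : ZMod 2) + p 0 * ∑ i : Fin n, p i.succ =
      n + p 0 * q + p 0 * (q + ∑ i : Fin n, p i.succ) := by
    rw [Fin.val_zero, Nat.sub_zero]
    linear_combination -(p 0 * q) * CharTwo.two_eq_zero (R := ZMod 2)
  rw [h_sign]

/-- Invariance turns a bracket `[vᵢ, v_{n+1}]` inside `φ~` into `[φ(…), vᵢ]` paired with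
`v_{n+1}`. -/
theorem insertMap_tilde_pairLastPerm {l : Multi k 2 V V} (hl : IsLieBracket 𝒱 l)
    (hinv : IsInvariantForm l B) {a : ℕ} {φ : Multi k (a + 1) V V}
    (h_alt : IsGradedAlt 𝒱 (tilde B φ)) {p : Fin (a + 3) → ZMod 2} {v : Fin (a + 3) → V}
    (hv : Homog 𝒱 p v) (i : Fin (a + 2)) :
    insertMap (Nat.add_comm 2 (a + 1)) (tilde B φ) l (fun j => v (pairLastPerm i j)) =
      sgn ((a + 1 : ℕ) +
          (p i.castSucc + p (Fin.last (a + 2))) * ∑ j, p (i.succAbove j).castSucc) •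
        B (insertMap rfl l φ fun j => v (skipPerm i j).castSucc) (v (Fin.last (a + 2))) := by
  rw [insertMap_two, pairLastPerm_zero, pairLastPerm_one, insertMap_pair]
  simp only [pairLastPerm_succ_succ, skipPerm_castSucc, skipPerm_last]
  rw [h_alt.cons_eq_snoc (hv.comp fun j => (i.succAbove j).castSucc)
    (hl.map_mem (hv i.castSucc) (hv (Fin.last (a + 2)))), tilde_snoc, ← hinv]

variable [DirectSum.Decomposition 𝒱]

theorem IsInnerProduct.apply_parityProj_left (hB : IsInnerProduct 𝒱 B) (i : ZMod 2) (x y : V) :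
    B (parityProj 𝒱 i x) y = B x (parityProj 𝒱 i y) := by
  have h_orth {j : ZMod 2} (hj : j ≠ i) (x y : V) :
      B (parityProj 𝒱 j x) (parityProj 𝒱 i y) = 0 ∧ B (parityProj 𝒱 i x) (parityProj 𝒱 j y) = 0 :=
    ⟨hB.even _ _ hj _ (parityProj_mem 𝒱 _ _) _ (parityProj_mem 𝒱 _ _),
      hB.even _ _ hj.symm _ (parityProj_mem 𝒱 _ _) _ (parityProj_mem 𝒱 _ _)⟩
  conv_lhs => rw [← sum_parityProj 𝒱 y, map_sum]
  conv_rhs => rw [← sum_parityProj 𝒱 x, map_sum, LinearMap.sum_apply]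
  rw [Finset.sum_eq_single_of_mem i (Finset.mem_univ i) fun j _ hj => (h_orth hj x y).2,
    Finset.sum_eq_single_of_mem i (Finset.mem_univ i) fun j _ hj => (h_orth hj x y).1]

theorem IsInnerProduct.mem_iff (hB : IsInnerProduct 𝒱 B) {i : ZMod 2} {x : V} :
    x ∈ 𝒱 i ↔ ∀ j, j ≠ i → ∀ y ∈ 𝒱 j, B x y = 0 := by
  refine ⟨fun hx j hj y hy => hB.even _ _ hj.symm x hx y hy, fun h => ?_⟩
  have h_proj : ∀ j, j ≠ i → parityProj 𝒱 j x = 0 := fun j hj =>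
    (map_eq_zero_iff B hB.nondegenerate.1).1 <| LinearMap.ext fun y => by
      rw [hB.apply_parityProj_left, h j hj _ (parityProj_mem 𝒱 j y), LinearMap.zero_apply]
  rw [← sum_parityProj 𝒱 x, Finset.sum_eq_single_of_mem i (Finset.mem_univ i) fun j _ => h_proj j]
  exact parityProj_mem 𝒱 i x

theorem hasParity_tilde_iff (hB : IsInnerProduct 𝒱 B) {n : ℕ} {φ : Multi k n V V} :
    HasParity 𝒱 (groundGrading k) q (tilde B φ) ↔ HasParity 𝒱 𝒱 q φ := by
  constructor
  · refine fun h p v hv => hB.mem_iff.2 fun j hj y hy => ?_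
    have h_snoc := h _ _ (hv.snoc hy)
    rw [tilde_snoc, groundGrading_mem_iff, Fin.sum_univ_castSucc, ← add_assoc] at h_snoc
    simp only [Fin.snoc_castSucc, Fin.snoc_last] at h_snoc
    exact h_snoc fun h_zero => hj (CharTwo.add_eq_zero.1 h_zero).symm
  · intro h p v hv
    rw [groundGrading_mem_iff, tilde_apply, Fin.sum_univ_castSucc, ← add_assoc]
    exact fun h_ne => hB.even _ _ (fun h_eq => h_ne (CharTwo.add_eq_zero.2 h_eq)) _
      (h _ _ (hv.comp Fin.castSucc)) _ (hv (Fin.last n))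

theorem isAltAt_tilde_extPerm_iff (hB : Function.Injective B) {n : ℕ} {φ : Multi k n V V}
    (σ : Equiv.Perm (Fin n)) : IsAltAt 𝒱 (tilde B φ) (extPerm σ) ↔ IsAltAt 𝒱 φ σ := by
  have h_iff : ∀ (p : Fin (n + 1) → ZMod 2) (v : Fin (n + 1) → V),
      (tilde B φ v = (Equiv.Perm.sign (extPerm σ) * koszul p (extPerm σ)) •
        tilde B φ (fun i => v (extPerm σ i))) ↔
      B (φ fun i => v i.castSucc) (v (Fin.last n)) =
        B ((Equiv.Perm.sign σ * koszul (fun i => p i.castSucc) σ) •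
          φ (fun i => v (σ i).castSucc)) (v (Fin.last n)) := by
    intro p v
    rw [tilde_apply, tilde_apply, sign_extPerm, koszul_extPerm, LinearMap.map_smul_of_tower,
      LinearMap.smul_apply]
    simp only [extPerm_castSucc, extPerm_last]
  constructor
  · intro h p v hv
    refine hB (LinearMap.ext fun y => ?_)
    rw [← sum_parityProj 𝒱 y, map_sum, map_sum]
    refine Finset.sum_congr rfl fun i _ => ?_
    simpa using (h_iff _ _).1 (h _ _ (hv.snoc (parityProj_mem 𝒱 i y)))
  · intro h p v hv
    refine (h_iff p v).2 ?_
    rw [h _ _ (hv.comp Fin.castSucc)]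

theorem tilde_mem_scalarCochains_iff (hB : IsInnerProduct 𝒱 B) {n : ℕ}
    {φ : Multi k (n + 1) V V} :
    tilde B φ ∈ scalarCochains 𝒱 q (n + 2) ↔ φ ∈ cyclicCochains 𝒱 B q (n + 1) := by
  constructor
  · rintro ⟨h_parity, h_alt⟩
    have hφ := (hasParity_tilde_iff hB).1 h_parity
    exact ⟨hφ, fun σ => (isAltAt_tilde_extPerm_iff hB.nondegenerate.1 σ).1 (h_alt (extPerm σ)),
      (isAltAt_tilde_skipPerm_zero_iff hB hφ).1 (h_alt (skipPerm 0))⟩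
  · rintro ⟨hφ, h_alt, h_cyclic⟩
    refine ⟨(hasParity_tilde_iff hB).2 hφ, fun π => ?_⟩
    change IsAltAt 𝒱 (tilde B φ) π
    have h_ext : ∀ σ, IsAltAt 𝒱 (tilde B φ) (extPerm σ) :=
      fun σ => (isAltAt_tilde_extPerm_iff hB.nondegenerate.1 σ).2 (h_alt σ)
    by_cases hπ : π (Fin.last (n + 1)) = Fin.last (n + 1)
    · obtain ⟨τ, rfl⟩ := exists_eq_extPerm π hπ
      exact h_ext τ
    · obtain ⟨τ, τ', rfl⟩ := exists_eq_extPerm_mul_skipPerm_mul_extPerm π hπ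
      exact (h_ext τ).mul (((isAltAt_tilde_skipPerm_zero_iff hB hφ).2 h_cyclic).mul (h_ext τ'))

theorem scalarDifferential_tilde {l : Multi k 2 V V} (hl : IsLieBracket 𝒱 l)
    (hB : IsInnerProduct 𝒱 B) (hinv : IsInvariantForm l B) {a : ℕ} {φ : Multi k (a + 1) V V}
    (hφ : φ ∈ cyclicCochains 𝒱 B q (a + 1)) :
    scalarDifferential 𝒱 l (a + 1) (tilde B φ) = tilde B (lieDifferential 𝒱 l a φ) := by
  have h_alt := ((tilde_mem_scalarCochains_iff hB).2 hφ).2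
  refine Multi.ext_homog 𝒱 fun p v hv => ?_
  rw [tilde_apply]
  change extComp 𝒱 _ (tilde B φ) l v = B (extComp 𝒱 _ φ l _ -
    sgn a • extComp 𝒱 (a := 1) rfl l φ _) _
  rw [extComp_apply_homog 𝒱 _ _ _ hv, extComp_apply_homog 𝒱 _ _ _ (hv.comp Fin.castSucc),
    extComp_apply_homog 𝒱 _ _ _ (hv.comp Fin.castSucc), sum_unshuffles_two, sum_unshuffles_last,
    map_sub, LinearMap.sub_apply, sub_eq_add_neg]
  congr 1
  · rw [map_sum, LinearMap.sum_apply]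
    refine Finset.sum_congr rfl fun τ _ => ?_
    rw [sign_extPerm, koszul_extPerm, LinearMap.map_smul_of_tower, LinearMap.smul_apply,
      insertMap_tilde B (Nat.add_comm 2 a), tilde_apply]
    simp only [extPerm_castSucc, extPerm_last]
  · rw [LinearMap.map_smul_of_tower, LinearMap.smul_apply, map_sum, LinearMap.sum_apply,
      Finset.smul_sum, ← Finset.sum_neg_distrib]
    refine Finset.sum_congr rfl fun i _ => ?_
    rw [insertMap_tilde_pairLastPerm hl hinv h_alt hv, sign_pairLastPerm, koszul_pairLastPerm,
      sign_skipPerm, LinearMap.map_smul_of_tower, LinearMap.smul_apply, ← Units.neg_smul, smul_smul,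
      smul_smul, Nat.cast_add_one, sgn_add, sgn_add, sgn_one]
    congr 1
    generalize sgn ((p i.castSucc + p (Fin.last (a + 2))) * _) = s
    rcases Int.units_eq_one_or s with rfl | rfl <;> simp [mul_comm]

end Tilde

section Comparison

variable {k V : Type*} [Field k] [AddCommGroup V] [Module k V]
  {𝒱 : ZMod 2 → Submodule k V} [DirectSum.Decomposition 𝒱] {B : V →ₗ[k] V →ₗ[k] k}
  {l : Multi k 2 V V}

theorem map_tildeEquiv_cyclicCochains (hB : IsInnerProduct 𝒱 B) (q : ZMod 2) (n : ℕ) :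
    (cyclicCochains 𝒱 B q (n + 1)).map (tildeEquiv B hB.nondegenerate (n + 1)).toLinearMap =
      scalarCochains 𝒱 q (n + 2) := by
  ext f
  rw [Submodule.mem_map_equiv, ← tilde_mem_scalarCochains_iff hB, ← tildeEquiv_apply B
    hB.nondegenerate, LinearEquiv.apply_symm_apply]

theorem map_tildeEquiv_cyclicCocycles (hl : IsLieBracket 𝒱 l) (hB : IsInnerProduct 𝒱 B)
    (hinv : IsInvariantForm l B) (q : ZMod 2) (a : ℕ) :
    (cyclicCocycles 𝒱 l B q a).map (tildeEquiv B hB.nondegenerate (a + 1)).toLinearMap =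
      scalarCocycles 𝒱 l q (a + 1) := by
  ext f
  obtain ⟨φ, rfl⟩ := (tildeEquiv B hB.nondegenerate (a + 1)).surjective f
  rw [Submodule.mem_map_equiv, LinearEquiv.symm_apply_apply, tildeEquiv_apply]
  refine Iff.trans (and_congr_right fun hφ => ?_)
    (and_congr_left' (tilde_mem_scalarCochains_iff hB).symm)
  change lieDifferential 𝒱 l a φ = 0 ↔ scalarDifferential 𝒱 l (a + 1) (tilde B φ) = 0
  rw [scalarDifferential_tilde hl hB hinv hφ, ← tildeEquiv_apply B hB.nondegenerate,
    LinearEquiv.map_eq_zero_iff]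

/-- The isomorphism `φ ↦ φ~` from cyclic cocycles to cocycles with trivial coefficients. -/
def tildeCocycles (hl : IsLieBracket 𝒱 l) (hB : IsInnerProduct 𝒱 B)
    (hinv : IsInvariantForm l B) (q : ZMod 2) (a : ℕ) :
    cyclicCocycles 𝒱 l B q a ≃ₗ[k] scalarCocycles 𝒱 l q (a + 1) :=
  (tildeEquiv B hB.nondegenerate (a + 1)).ofSubmodules _ _
    (map_tildeEquiv_cyclicCocycles hl hB hinv q a)

theorem map_tildeEquiv_cyclicCoboundaries (hl : IsLieBracket 𝒱 l) (hB : IsInnerProduct 𝒱 B)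
    (hinv : IsInvariantForm l B) (q : ZMod 2) (a : ℕ) :
    (cyclicCoboundaries 𝒱 l B q (a + 1)).map
        (tildeEquiv B hB.nondegenerate (a + 2)).toLinearMap =
      scalarCoboundaries 𝒱 l q (a + 2) := by
  rw [cyclicCoboundaries, scalarCoboundaries, ← map_tildeEquiv_cyclicCochains hB,
    ← Submodule.map_comp, ← Submodule.map_comp]
  ext f
  refine exists_congr fun φ => and_congr_right fun hφ => ?_
  change tilde B (lieDifferential 𝒱 l a φ) = f ↔
    scalarDifferential 𝒱 l (a + 1) (tilde B φ) = f
  rw [scalarDifferential_tilde hl hB hinv hφ]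

/-- The isomorphism `HCⁿ(V) ≅ Hⁿ⁺¹(V, k)` for `n = a + 2`. -/
def tildeCohomology (hl : IsLieBracket 𝒱 l) (hB : IsInnerProduct 𝒱 B)
    (hinv : IsInvariantForm l B) (q : ZMod 2) (a : ℕ) :
    CyclicCohomology 𝒱 l B q (a + 1) ≃ₗ[k] ScalarCohomology 𝒱 l q (a + 2) :=
  Submodule.Quotient.equiv _ _ (tildeCocycles hl hB hinv q (a + 1)) (by
    ext f
    obtain ⟨φ, rfl⟩ := (tildeCocycles hl hB hinv q (a + 1)).surjective f
    refine Iff.trans (Submodule.mem_map_equiv _) ?_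
    rw [LinearEquiv.symm_apply_apply]
    change (φ : Multi k (a + 2) V V) ∈ cyclicCoboundaries 𝒱 l B q (a + 1) ↔
      tilde B (φ : Multi k (a + 2) V V) ∈ scalarCoboundaries 𝒱 l q (a + 2)
    rw [← map_tildeEquiv_cyclicCoboundaries hl hB hinv, ← tildeEquiv_apply B hB.nondegenerate,
      Submodule.mem_map_equiv, LinearEquiv.symm_apply_apply])

/-- The isomorphism of `HC¹(V)` with the space of `2`-cocycles with trivial coefficients. -/
def tildeCohomologyOne (hl : IsLieBracket 𝒱 l) (hB : IsInnerProduct 𝒱 B)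
    (hinv : IsInvariantForm l B) (q : ZMod 2) :
    CyclicCohomology 𝒱 l B q 0 ≃ₗ[k] scalarCocycles 𝒱 l q 1 :=
  (Submodule.quotEquivOfEqBot _ (Submodule.ker_subtype _)).trans (tildeCocycles hl hB hinv q 0)

end Comparison

end CyclicLInfinity

end

theorem mainTheorem8_general {k V : Type*} [Field k] [AddCommGroup V] [Module k V]
    (𝒱 : ZMod 2 → Submodule k V) [DirectSum.Decomposition 𝒱]
    (l : Multi k 2 V V) (hl : IsLieBracket 𝒱 l)
    (B : V →ₗ[k] V →ₗ[k] k) (hB : IsInnerProduct 𝒱 B) (hinv : IsInvariantForm l B) :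
    (∀ p : ZMod 2,
      Equivalence (Deformation.IsEquivalent (𝒱 := 𝒱) (l := l) (B := B) (p := p)) ∧
      ∃ Φ : Deformation 𝒱 l B p ≃ (∀ a : ℕ, cyclicCocycles 𝒱 l B (p + (a + 1 : ℕ)) a),
        (∀ m a, (Φ m a : Multi k (a + 1) V V) = m.cochain (a + 1)) ∧
        ∃ Ψ : Quot (Deformation.IsEquivalent (𝒱 := 𝒱) (l := l) (B := B) (p := p)) ≃
            (∀ a : ℕ, CyclicCohomology 𝒱 l B (p + (a + 1 : ℕ)) a),
          ∀ m a, Ψ (Quot.mk _ m) a = Submodule.Quotient.mk (Φ m a)) ∧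
    (∀ (q : ZMod 2) (a : ℕ),
      ∃ Θ : CyclicCohomology 𝒱 l B q (a + 1) ≃ₗ[k] ScalarCohomology 𝒱 l q (a + 2),
        ∀ φ : cyclicCocycles 𝒱 l B q (a + 1), ∃ f : scalarCocycles 𝒱 l q (a + 2),
          (f : Multi k (a + 3) V k) = tilde B (φ : Multi k (a + 2) V V) ∧
          Θ (Submodule.Quotient.mk φ) = Submodule.Quotient.mk f) ∧
    (∀ q : ZMod 2,
      ∃ Θ : CyclicCohomology 𝒱 l B q 0 ≃ₗ[k] scalarCocycles 𝒱 l q 1,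
        ∀ φ : cyclicCocycles 𝒱 l B q 0,
          (Θ (Submodule.Quotient.mk φ) : Multi k 2 V k) = tilde B (φ : Multi k 1 V V)) :=
  ⟨fun _ => ⟨Deformation.equivalence_isEquivalent hl hinv, deformationEquiv hl hinv,
      fun _ _ => rfl, deformationClassEquiv hl hinv, fun _ _ => rfl⟩,
    fun q a => ⟨tildeCohomology hl hB hinv q a, fun φ =>
      ⟨tildeCocycles hl hB hinv q (a + 1) φ, rfl, rfl⟩⟩,
    fun q => ⟨tildeCohomologyOne hl hB hinv q, fun _ => rfl⟩⟩

theorem mainTheorem8 {k V : Type*} [Field k] [CharZero k] [AddCommGroup V] [Module k V]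
    (𝒱 : ZMod 2 → Submodule k V) [DirectSum.Decomposition 𝒱]
    (l : Multi k 2 V V) (hl : IsLieBracket 𝒱 l)
    (B : V →ₗ[k] V →ₗ[k] k) (hB : IsInnerProduct 𝒱 B) (hinv : IsInvariantForm l B) :
    -- The deformations with a parameter of parity `p` are in bijection with the sequences of
    -- cyclic cocycles `λₙ`, `n = a + 1 ≥ 1`, of parity `p + n`, and their equivalence classes
    -- with the sequences of cyclic cohomology classes.
    (∀ p : ZMod 2,
      Equivalence (Deformation.IsEquivalent (𝒱 := 𝒱) (l := l) (B := B) (p := p)) ∧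
      ∃ Φ : Deformation 𝒱 l B p ≃ (∀ a : ℕ, cyclicCocycles 𝒱 l B (p + (a + 1 : ℕ)) a),
        (∀ m a, (Φ m a : Multi k (a + 1) V V) = m.cochain (a + 1)) ∧
        ∃ Ψ : Quot (Deformation.IsEquivalent (𝒱 := 𝒱) (l := l) (B := B) (p := p)) ≃
            (∀ a : ℕ, CyclicCohomology 𝒱 l B (p + (a + 1 : ℕ)) a),
          ∀ m a, Ψ (Quot.mk _ m) a = Submodule.Quotient.mk (Φ m a)) ∧
    -- `HCⁿ(V) ≅ Hⁿ⁺¹(V, k)` for `n = a + 2 ≥ 2`.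
    (∀ (q : ZMod 2) (a : ℕ),
      ∃ Θ : CyclicCohomology 𝒱 l B q (a + 1) ≃ₗ[k] ScalarCohomology 𝒱 l q (a + 2),
        ∀ φ : cyclicCocycles 𝒱 l B q (a + 1), ∃ f : scalarCocycles 𝒱 l q (a + 2),
          (f : Multi k (a + 3) V k) = tilde B (φ : Multi k (a + 2) V V) ∧
          Θ (Submodule.Quotient.mk φ) = Submodule.Quotient.mk f) ∧
    -- `HC¹(V)` is isomorphic to the space of `2`-cocycles with trivial coefficients.
    (∀ q : ZMod 2,
      ∃ Θ : CyclicCohomology 𝒱 l B q 0 ≃ₗ[k] scalarCocycles 𝒱 l q 1,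
        ∀ φ : cyclicCocycles 𝒱 l B q 0,
          (Θ (Submodule.Quotient.mk φ) : Multi k 2 V k) = tilde B (φ : Multi k 1 V V)) :=
  mainTheorem8_general 𝒱 l hl B hB hinv
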